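/- **Setting.** Let $\Omega\subset\mathbb R^3$ be a bounded connected open set with $C^2$ boundary, with outward unit normal $n(x)$, and let $R(x,v)=v-2(v\cdot n(x))n(x)$. Let $\gamma\in(-3,1]$, $c_\Phi,C_\Phi>0$, $\nu<0$, $b_0>0$, $\alpha\in[0,1]$, $T_B>0$, $0<\tau<T<\infty$. The collision kernel is $B=\Phi(|v-v_*|)\,b(\cos\theta)\ge 0$, $\cos\theta=\langle\frac{v-v_*}{|v-v_*|},\sigma\rangle$, where $\Phi$ is measurable and satisfies either $c_\Phi r^\gamma\le\Phi(r)\le C_\Phi r^\gamma$ for all $r>0$, or this for $r\ge1$ together with $c_\Phi\le\Phi\le C_\Phi$ on $[0,1]$; and $\theta\mapsto b(\cos\theta)\geq 0$ is continuous on $(0,\pi]$, positive near $\pi/2$, with $\lim_{\theta\to0^+}b(\cos\theta)\sin\theta\;\theta^{1+\nu}=b_0$. With $v'=\frac{v+v_*}2+\frac{|v-v_*|}2\sigma$ and $v'_*=\frac{v+v_*}2-\frac{|v-v_*|}2\sigma$ put $$Q^+[h_1,h_2](v)=\int_{\mathbb R^3\times\mathbb S^2}B\,h_2(v')h_1(v'_*)\,dv_*d\sigma,\qquad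 L[h](v)=\int_{\mathbb R^3\times\mathbb S^2}B\,h(v_*)\,dv_*d\sigma .$$ Let $t_b(x,v)=\sup(\{0\}\cup\{t>0: x-sv\in\Omega\ \forall\, 0<s<t\})$, $x_b(x,v)=x-t_b(x,v)v$, $t_\partial(x,v)=\sup\{t\ge0: x-sv\in\overline\Omega\ \forall s\in[0,t]\}$. Let $\Gamma^{+},\Gamma^0,\Gamma^-$ be the sets of $(x,v)\in\partial\Omega\times\mathbb R^3$ with $n(x)\cdot v>0$, $=0$, $<0$ respectively. Let $\Gamma^0_-$ be the set of $(x,v)\in\Gamma^0$ with $t_b(x,v)=0$, $t_b(x,-v)>0$ and $x-sv\notin\overline\Omega$ for all small $s>0$. Let $\Omega_{stop}$ be the set of $(x,v)\in\Gamma^0$ such that for every $\delta>0$ there is $s\in(0,\delta)$ with $x-sv\notin\overline\Omega$. Finally let $\Gamma_{conti}$ be the union of $\{0\}\times\overline\Omega\times\mathbb R^3$, of $(0,T)\times(\Gamma^-\cup\Gamma^0_-)$, and of the set of $(t,x,v)\in(0,T)\times(\Omega\times\mathbb R^3\cup\Gamma^+)$ with $t<t_b(x,v)$ or $(x_b(x,v),v)\in\Gamma^-\cup\Gamma^0_-$.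 **Solutions.** Let $f_0\ge0$ be continuous on $\overline\Omega\times\mathbb R^3$. A *continuous mild solution* with initial datum $f_0$ is a function $f\ge0$ on $[0,T)\times\overline\Omega\times\mathbb R^3$ which is continuous on $\Gamma_{conti}$, satisfies $f(t,x,v)\le C(1+|v|)^{-r}$ for $0<t<T$ and some $C>0$, $r>3$, and satisfies the following for all $(t,x,v)\in[0,T)\times\overline\Omega\times\mathbb R^3$. Write $X_s=x-(t-s)v$ and, for any path $X$, $D_X(s,t)=\exp\big(-\int_s^tL[f(s',X_{s'},\cdot)](v)\,ds'\big)$ and $G_X(a,t)=\int_a^tD_X(s,t)\,Q^+[f(s,X_s,\cdot),f(s,X_s,\cdot)](v)\,ds$. 1. If $t\le t_\partial(x,v)$, then $f(t,x,v)=f_0(x-tv,v)D_X(0,t)+G_X(0,t)$. 2. If $t\ge t_\partial(x,v)$, then with $a=t-t_\partial(x,v)$ and $y=x-t_\partial(x,v)v$, $$f(t,x,v)=\Big[\alpha f(a,y,R(y,v))+(1-\alpha)\Big(\int_{w\cdot n(y)>0}f(a,y,w)(w\cdot n(y))\,dw\Big)\frac{e^{-|v|^2/(2T_B)}}{2\pi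 T_B^2}\Big]D_X(a,t)+G_X(a,t).$$ 3. If $\alpha=1$ and $(x,v)\in\Omega_{stop}$ (where item 2 is void), then $f(t,x,v)=f_0(x,v)D_Y(0,t)+G_Y(0,t)$ along the resting characteristic $Y_s\equiv x$. Put $M=\int_{\Omega\times\mathbb R^3}f(0,x,v)\,dx\,dv$, $E_f=\sup_{[0,T)\times\Omega}\big(\int|v|^2f\,dv+\int f^2\,dv\big)$ and $L_{f,p}=\sup_{[0,T)\times\Omega}\big(\int f^p\,dv\big)^{1/p}$. **Theorem.** Suppose that $M>0$ and $E_f<\infty$ and, if $\gamma<0$, that also $L_{f,p}<\infty$ for some $p>\frac3{3+\gamma}$. Then there exist $\rho,\theta>0$ such that $$f(t,x,v)\ge\frac{\rho}{(2\pi\theta)^{3/2}}e^{-\frac{|v|^2}{2\theta}}\qquad\text{for all }t\in[\tau,T),\ x\in\overline\Omega,\ v\in\mathbb R^3 .$$ The constants $\rho,\theta$ depend only on $\Omega$, $\gamma,c_\Phi,C_\Phi$, $b$ (with $b_0,\nu$), $\alpha,T_B,T,\tau$, on $M$, on an upper bound for $E_f$ (and, if $\gamma<0$, on $p$ and an upper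 bound for $L_{f,p}$), and on a modulus of continuity of $f_0$ on $\overline\Omega\times\mathbb R^3$; they depend on $\Phi$, $f_0$ and $f$ only through these quantities. -/

import Mathlib

open MeasureTheory Set Filter Topology
open scoped ENNReal

noncomputable section

namespace Boltzmann

/-- Positions and velocities live in the Euclidean space `ℝ³`. -/
abbrev R3 := EuclideanSpace ℝ (Fin 3)

/-! ### The spatial domain -/

/-- `ψ` is a `C²` local defining function of `Ω` at `x`: it is `C²` near `x`, its gradient at `x`
does not vanish, and near `x` the set `Ω` is `{ψ < 0}`. -/
def IsC2DefiningFunction (Ω : Set R3) (x : R3) (ψ : R3 → ℝ) : Prop :=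
  ContDiffAt ℝ 2 ψ x ∧ gradient ψ x ≠ 0 ∧ ∀ᶠ y in 𝓝 x, (y ∈ Ω ↔ ψ y < 0)

/-- `Ω` is a bounded, connected (in particular non-empty) open set with `C²` boundary. -/
structure IsC2Domain (Ω : Set R3) : Prop where
  isOpen : IsOpen Ω
  isConnected : IsConnected Ω
  isBounded : Bornology.IsBounded Ω
  boundary : ∀ x ∈ frontier Ω, ∃ ψ : R3 → ℝ, IsC2DefiningFunction Ω x ψ

open Classical in
/-- The outward unit normal `n(x) = ∇ψ(x) / |∇ψ(x)|` at a boundary point, for a local defining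
function `ψ`; by `outwardNormal_eq` it does not depend on `ψ`. -/
def outwardNormal (Ω : Set R3) (x : R3) : R3 :=
  if h : ∃ ψ : R3 → ℝ, IsC2DefiningFunction Ω x ψ then
    ‖gradient h.choose x‖⁻¹ • gradient h.choose x
  else 0

theorem IsC2DefiningFunction.eq_zero {Ω : Set R3} {x : R3} {ψ : R3 → ℝ}
    (h : IsC2DefiningFunction Ω x ψ) (hx : x ∈ frontier Ω) : ψ x = 0 := by
  have hc : ContinuousAt ψ x := h.1.continuousAt
  rcases lt_trichotomy (ψ x) 0 with hlt | heq | hgt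
  · exfalso
    have h1 : ∀ᶠ y in 𝓝 x, y ∈ Ω := by
      filter_upwards [h.2.2, hc.eventually_lt_const hlt] with y hy hy'
      exact hy.2 hy'
    exact hx.2 (mem_interior_iff_mem_nhds.2 h1)
  · exact heq
  · exfalso
    have h1 : ∀ᶠ y in 𝓝 x, y ∉ Ω := by
      filter_upwards [h.2.2, hc.eventually_const_lt hgt] with y hy hy' hyΩ
      exact lt_asymm hy' (hy.1 hyΩ)
    exact (mem_closure_iff_frequently.1 hx.1) h1

theorem IsC2DefiningFunction.inner_nonpos {Ω : Set R3} {x : R3} {ψ φ : R3 → ℝ}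
    (hψ : IsC2DefiningFunction Ω x ψ) (hφ : IsC2DefiningFunction Ω x φ) (hx : x ∈ frontier Ω)
    (h : R3) (hh : inner ℝ (gradient ψ x) h < 0) : inner ℝ (gradient φ x) h ≤ 0 := by
  have key : ∀ χ : R3 → ℝ, IsC2DefiningFunction Ω x χ →
      Tendsto (fun t : ℝ => t⁻¹ * χ (x + t • h)) (𝓝[>] 0) (𝓝 (inner ℝ (gradient χ x) h)) := by
    intro χ hχ
    have hd : DifferentiableAt ℝ χ x := hχ.1.differentiableAt (by norm_num)
    have h1 : HasLineDerivAt ℝ χ (fderiv ℝ χ x h) x h := hd.hasFDerivAt.hasLineDerivAt h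
    have h2 := h1.tendsto_slope_zero_right
    have h3 : fderiv ℝ χ x h = inner ℝ (gradient χ x) h := by
      rw [hd.hasGradientAt.hasFDerivAt.fderiv, InnerProductSpace.toDual_apply_apply]
    rw [h3] at h2
    refine h2.congr fun t => ?_
    rw [hχ.eq_zero hx, sub_zero, smul_eq_mul]
  have hline : Tendsto (fun t : ℝ => x + t • h) (𝓝[>] 0) (𝓝 x) := by
    have : Continuous (fun t : ℝ => x + t • h) := by fun_prop
    simpa using (this.tendsto 0).mono_left nhdsWithin_le_nhds
  refine le_of_tendsto (key φ hφ) ?_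
  filter_upwards [(key ψ hψ).eventually_lt_const hh, hline.eventually hψ.2.2,
    hline.eventually hφ.2.2, self_mem_nhdsWithin] with t h1 h2 h3 ht
  have ht' : 0 < t⁻¹ := inv_pos.2 ht
  have h4 : ψ (x + t • h) < 0 := by
    by_contra hcon
    exact absurd h1 (not_lt.2 (mul_nonneg ht'.le (not_lt.1 hcon)))
  exact mul_nonpos_of_nonneg_of_nonpos ht'.le (h3.1 (h2.2 h4)).le

theorem outwardNormal_eq {Ω : Set R3} {x : R3} {ψ : R3 → ℝ}
    (h : IsC2DefiningFunction Ω x ψ) (hx : x ∈ frontier Ω) :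
    outwardNormal Ω x = ‖gradient ψ x‖⁻¹ • gradient ψ x := by
  have hex : ∃ ψ : R3 → ℝ, IsC2DefiningFunction Ω x ψ := ⟨ψ, h⟩
  rw [outwardNormal, dif_pos hex]
  have h' := hex.choose_spec
  set φ := hex.choose
  set g := gradient φ x with hg
  set k := gradient ψ x with hk
  have hg0 : 0 < ‖g‖ := norm_pos_iff.2 h'.2.1
  have hk0 : 0 < ‖k‖ := norm_pos_iff.2 h.2.1
  set m := ‖g‖⁻¹ • g with hm
  set n := ‖k‖⁻¹ • k with hn
  have hm1 : ‖m‖ = 1 := by rw [hm, norm_smul, norm_inv, norm_norm, inv_mul_cancel₀ hg0.ne']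
  have hn1 : ‖n‖ = 1 := by rw [hn, norm_smul, norm_inv, norm_norm, inv_mul_cancel₀ hk0.ne']
  by_contra hne
  have hlt : inner ℝ m n < 1 := (inner_lt_one_iff_real_of_norm_eq_one hm1 hn1).2 hne
  have hgm : g = ‖g‖ • m := by rw [hm, smul_smul, mul_inv_cancel₀ hg0.ne', one_smul]
  have hkn : k = ‖k‖ • n := by rw [hn, smul_smul, mul_inv_cancel₀ hk0.ne', one_smul]
  have e1 : inner ℝ g (n - m) = ‖g‖ * (inner ℝ m n - 1) := by
    conv_lhs => rw [hgm]
    rw [inner_smul_left, inner_sub_right, real_inner_self_eq_norm_sq, hm1]; simp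
  have e2 : inner ℝ k (n - m) = ‖k‖ * (1 - inner ℝ m n) := by
    conv_lhs => rw [hkn]
    rw [inner_smul_left, inner_sub_right, real_inner_self_eq_norm_sq, hn1, real_inner_comm m n]
    simp
  have h1 : inner ℝ g (n - m) < 0 := by
    rw [e1]; exact mul_neg_of_pos_of_neg hg0 (by linarith)
  have h2 := h'.inner_nonpos h hx (n - m) h1
  rw [← hk, e2] at h2
  have := mul_pos hk0 (sub_pos.2 hlt)
  linarith

/-- The specular reflection `R(x, v) = v - 2 (v · n(x)) n(x)`. -/
def reflect (Ω : Set R3) (x v : R3) : R3 :=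
  v - (2 * inner ℝ v (outwardNormal Ω x)) • outwardNormal Ω x

/-- `t_b(x, v) = sup ({0} ∪ {t > 0 | x - s v ∈ Ω for all 0 < s < t})`, possibly infinite. -/
def tB (Ω : Set R3) (x v : R3) : ℝ≥0∞ :=
  ⨆ (t : ℝ) (_ : 0 < t ∧ ∀ s ∈ Ioo 0 t, x - s • v ∈ Ω), ENNReal.ofReal t

/-- `x_b(x, v) = x - t_b(x, v) v` (used for `t_b(x, v) < ∞`). -/
def xB (Ω : Set R3) (x v : R3) : R3 := x - (tB Ω x v).toReal • v

/-- `t_∂(x, v) = sup {t ≥ 0 | x - s v ∈ closure Ω for all 0 ≤ s ≤ t}`, possibly infinite. -/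
def tBoundary (Ω : Set R3) (x v : R3) : ℝ≥0∞ :=
  ⨆ (t : ℝ) (_ : 0 ≤ t ∧ ∀ s ∈ Icc 0 t, x - s • v ∈ closure Ω), ENNReal.ofReal t

/-- The grazing set `Γ⁰`. -/
def gammaZero (Ω : Set R3) : Set (R3 × R3) :=
  {p | p.1 ∈ frontier Ω ∧ inner ℝ (outwardNormal Ω p.1) p.2 = 0}

/-- The outgoing set `Γ⁺`. -/
def gammaPlus (Ω : Set R3) : Set (R3 × R3) :=
  {p | p.1 ∈ frontier Ω ∧ 0 < inner ℝ (outwardNormal Ω p.1) p.2}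

/-- The incoming set `Γ⁻`. -/
def gammaMinus (Ω : Set R3) : Set (R3 × R3) :=
  {p | p.1 ∈ frontier Ω ∧ inner ℝ (outwardNormal Ω p.1) p.2 < 0}

/-- The inflow part `Γ⁰₋` of the grazing set. -/
def gammaZeroMinus (Ω : Set R3) : Set (R3 × R3) :=
  {p | p ∈ gammaZero Ω ∧ tB Ω p.1 p.2 = 0 ∧ 0 < tB Ω p.1 (-p.2) ∧
    ∃ δ > 0, ∀ s ∈ Ioo (0 : ℝ) δ, p.1 - s • p.2 ∈ (closure Ω)ᶜ}

/-- The stop set: grazing boundary points from which the backward ray leaves `closure Ω`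
immediately. -/
def stopSet (Ω : Set R3) : Set (R3 × R3) :=
  {p | p ∈ gammaZero Ω ∧ ∀ δ > 0, ∃ s ∈ Ioo (0 : ℝ) δ, p.1 - s • p.2 ∉ closure Ω}

/-- The set `Γ_conti` of points `(t, x, v)`, `0 ≤ t < T`, on which solutions are continuous. -/
def gammaConti (Ω : Set R3) (T : ℝ) : Set (ℝ × R3 × R3) :=
  {q | q.1 = 0 ∧ q.2.1 ∈ closure Ω} ∪
  {q | q.1 ∈ Ioo 0 T ∧ q.2 ∈ gammaMinus Ω ∪ gammaZeroMinus Ω} ∪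
  {q | q.1 ∈ Ioo 0 T ∧ (q.2.1 ∈ Ω ∨ q.2 ∈ gammaPlus Ω) ∧
    (ENNReal.ofReal q.1 < tB Ω q.2.1 q.2.2 ∨
      (xB Ω q.2.1 q.2.2, q.2.2) ∈ gammaMinus Ω ∪ gammaZeroMinus Ω)}

/-! ### The collision operator -/

/-- The assumptions on the kinetic factor `Φ`: either `c r^γ ≤ Φ(r) ≤ C r^γ` for all `r`, or this
for `r ≥ 1` together with `c ≤ Φ(r) ≤ C` for `r ≤ 1`. -/
structure IsKineticFactor (Φ : ℝ → ℝ) (γ c C : ℝ) : Prop where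
  measurable : Measurable Φ
  bounds :
    (∀ r > 0, c * r ^ γ ≤ Φ r ∧ Φ r ≤ C * r ^ γ) ∨
    ((∀ r ≥ 1, c * r ^ γ ≤ Φ r ∧ Φ r ≤ C * r ^ γ) ∧ ∀ r ∈ Icc (0 : ℝ) 1, c ≤ Φ r ∧ Φ r ≤ C)

/-- The assumptions on the angular factor `b`. -/
structure IsAngularFactor (b : ℝ → ℝ) (ν b₀ : ℝ) : Prop where
  nonneg : ∀ θ ∈ Ioc 0 Real.pi, 0 ≤ b (Real.cos θ)
  continuousOn : ContinuousOn (fun θ => b (Real.cos θ)) (Ioc 0 Real.pi)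
  pos_near : ∀ᶠ θ in 𝓝 (Real.pi / 2), 0 < b (Real.cos θ)
  asymptotics : Tendsto (fun θ => b (Real.cos θ) * Real.sin θ / θ ^ (-(1 + ν))) (𝓝[>] 0) (𝓝 b₀)

/-- The collision kernel `B(|v - v_*|, cos θ) = Φ(|v - v_*|) b(cos θ)` with
`cos θ = ⟨(v - v_*) / |v - v_*|, σ⟩`. -/
def kernel (Φ b : ℝ → ℝ) (v vs σ : R3) : ℝ :=
  Φ ‖v - vs‖ * b (inner ℝ (v - vs) σ / ‖v - vs‖)

/-- The gain operator `Q⁺[h₁, h₂](v) = ∫ B h₂(v') h₁(v'_*) dv_* dσ` for nonnegative `h₁, h₂`, with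
values in `[0, ∞]`; `dσ` is the surface measure of the unit sphere. -/
def Qplus (Φ b : ℝ → ℝ) (h₁ h₂ : R3 → ℝ) (v : R3) : ℝ≥0∞ :=
  ∫⁻ p : R3 × Metric.sphere (0 : R3) 1,
    ENNReal.ofReal (kernel Φ b v p.1 p.2 *
      (h₂ ((1 / 2 : ℝ) • (v + p.1) + (‖v - p.1‖ / 2) • (p.2 : R3)) *
       h₁ ((1 / 2 : ℝ) • (v + p.1) - (‖v - p.1‖ / 2) • (p.2 : R3))))
    ∂((volume : Measure R3).prod (volume : Measure R3).toSphere)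

/-- The loss frequency `L[h](v) = ∫ B h(v_*) dv_* dσ` for nonnegative `h`, with values in
`[0, ∞]`. -/
def Lloss (Φ b : ℝ → ℝ) (h : R3 → ℝ) (v : R3) : ℝ≥0∞ :=
  ∫⁻ p : R3 × Metric.sphere (0 : R3) 1, ENNReal.ofReal (kernel Φ b v p.1 p.2 * h p.1)
    ∂((volume : Measure R3).prod (volume : Measure R3).toSphere)

/-! ### Mild solutions -/

/-- `exp(-a)` for `a ∈ [0, ∞]`, with `exp(-∞) = 0`. -/
def expNeg (a : ℝ≥0∞) : ℝ≥0∞ := if a = ∞ then 0 else ENNReal.ofReal (Real.exp (-a.toReal))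

/-- `exp(-∫_s^t L[f(r, X(r), ·)](v) dr)` along a path `X`. -/
def damping (Φ b : ℝ → ℝ) (f : ℝ → R3 → R3 → ℝ) (X : ℝ → R3) (v : R3) (s t : ℝ) : ℝ≥0∞ :=
  expNeg (∫⁻ r in Ioc s t, Lloss Φ b (f r (X r)) v)

/-- `∫_a^t exp(-∫_s^t L[f(r, X(r), ·)](v) dr) Q⁺[f(s, X(s), ·), f(s, X(s), ·)](v) ds` along a
path `X`. -/
def gain (Φ b : ℝ → ℝ) (f : ℝ → R3 → R3 → ℝ) (X : ℝ → R3) (v : R3) (a t : ℝ) : ℝ≥0∞ :=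
  ∫⁻ s in Ioc a t, damping Φ b f X v s t * Qplus Φ b (f s (X s)) (f s (X s)) v

/-- The straight characteristic `s ↦ x - (t - s) v` arriving at `x` at time `t`; this is
`X_{s,t}(x, v)` for `t - t_∂(x, v) ≤ s ≤ t`. -/
def ray (t : ℝ) (x v : R3) (s : ℝ) : R3 := x - (t - s) • v

/-- The outgoing flux `∫_{w · n(y) > 0} g(w) (w · n(y)) dw`. -/
def outflux (Ω : Set R3) (y : R3) (g : R3 → ℝ) : ℝ≥0∞ :=
  ∫⁻ w in {w : R3 | 0 < inner ℝ w (outwardNormal Ω y)},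
    ENNReal.ofReal (g w * inner ℝ w (outwardNormal Ω y))

/-- The wall Maxwellian `(2π T_B²)⁻¹ exp(-|v|² / (2 T_B))`. -/
def wallMaxwellian (TB : ℝ) (v : R3) : ℝ :=
  1 / (2 * Real.pi * TB ^ 2) * Real.exp (-‖v‖ ^ 2 / (2 * TB))

/-- `f` is a continuous mild solution on `[0, T) × closure Ω × ℝ³`, with initial datum `f₀`, of the
Boltzmann equation with the mixed boundary condition (accommodation `α`, wall temperature `TB`).
Only the values of `f` on `[0, T) × closure Ω × ℝ³` and of `f₀` on `closure Ω × ℝ³` matter. -/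
structure IsContinuousMildSolution (Ω : Set R3) (Φ b : ℝ → ℝ) (α TB T : ℝ)
    (f₀ : R3 → R3 → ℝ) (f : ℝ → R3 → R3 → ℝ) : Prop where
  init_nonneg : ∀ x ∈ closure Ω, ∀ v, 0 ≤ f₀ x v
  init_continuous : ContinuousOn (fun p : R3 × R3 => f₀ p.1 p.2) (closure Ω ×ˢ univ)
  nonneg : ∀ t ∈ Ico 0 T, ∀ x ∈ closure Ω, ∀ v, 0 ≤ f t x v
  decay : ∃ C > 0, ∃ r > 3, ∀ t ∈ Ioo 0 T, ∀ x ∈ closure Ω, ∀ v,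
    |f t x v| ≤ C * (1 + ‖v‖) ^ (-r : ℝ)
  continuous : ContinuousOn (fun q : ℝ × R3 × R3 => f q.1 q.2.1 q.2.2) (gammaConti Ω T)
  /-- Duhamel's formula when the backward ray stays in `closure Ω` up to time `0`. -/
  duhamel_initial : ∀ t ∈ Ico 0 T, ∀ x ∈ closure Ω, ∀ v,
    ENNReal.ofReal t ≤ tBoundary Ω x v →
    ENNReal.ofReal (f t x v) =
      ENNReal.ofReal (f₀ (ray t x v 0) v) * damping Φ b f (ray t x v) v 0 t +
        gain Φ b f (ray t x v) v 0 t
  /-- Duhamel's formula when the backward ray leaves `closure Ω` at the time `a = t - t_∂(x, v)`,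
  through the boundary point `y = x - t_∂(x, v) v`. -/
  duhamel_boundary : ∀ t ∈ Ico 0 T, ∀ x ∈ closure Ω, ∀ v,
    tBoundary Ω x v ≤ ENNReal.ofReal t →
    ∀ a y, a = t - (tBoundary Ω x v).toReal → y = ray t x v a →
    ENNReal.ofReal (f t x v) =
      ENNReal.ofReal α * ENNReal.ofReal (f a y (reflect Ω y v)) *
          damping Φ b f (ray t x v) v a t +
        ENNReal.ofReal (1 - α) * outflux Ω y (f a y) * ENNReal.ofReal (wallMaxwellian TB v) *
          damping Φ b f (ray t x v) v a t +
        gain Φ b f (ray t x v) v a t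
  /-- Purely specular reflection: at a point of the stop set, where the boundary condition is void,
  the characteristic is at rest and Duhamel's formula holds along it. -/
  duhamel_stop : α = 1 → ∀ t ∈ Ico 0 T, ∀ x v, (x, v) ∈ stopSet Ω →
    ENNReal.ofReal (f t x v) =
      ENNReal.ofReal (f₀ x v) * damping Φ b f (fun _ => x) v 0 t +
        gain Φ b f (fun _ => x) v 0 t

/-! ### Macroscopic quantities -/

/-- `∫_{Ω × ℝ³} g dx dv`. -/
def totalMass (Ω : Set R3) (g : R3 → R3 → ℝ) : ℝ≥0∞ :=
  ∫⁻ p in Ω ×ˢ (univ : Set R3), ENNReal.ofReal (g p.1 p.2)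

/-- `E_f = sup_{[0,T) × Ω} (∫ |v|² f dv + ∫ f² dv)`. -/
def energyBound (Ω : Set R3) (T : ℝ) (f : ℝ → R3 → R3 → ℝ) : ℝ≥0∞ :=
  ⨆ t ∈ Ico 0 T, ⨆ x ∈ Ω,
    ((∫⁻ v, ENNReal.ofReal (‖v‖ ^ 2 * f t x v)) + ∫⁻ v, ENNReal.ofReal (f t x v ^ 2))

/-- `L_{f,p} = sup_{[0,T) × Ω} (∫ f^p dv)^{1/p}`. -/
def lpBound (Ω : Set R3) (T p : ℝ) (f : ℝ → R3 → R3 → ℝ) : ℝ≥0∞ :=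
  ⨆ t ∈ Ico 0 T, ⨆ x ∈ Ω, (∫⁻ v, ENNReal.ofReal (f t x v) ^ p) ^ (1 / p)

/-- `ω` is a modulus of continuity of `g` on `closure Ω × ℝ³`. -/
def HasModulus (Ω : Set R3) (ω : ℝ → ℝ) (g : R3 → R3 → ℝ) : Prop :=
  ∀ x ∈ closure Ω, ∀ y ∈ closure Ω, ∀ v w, |g x v - g y w| ≤ ω (‖x - y‖ + ‖v - w‖)

end Boltzmann

end

/-!
# Maxwellian lower bounds for the Boltzmann equation in a bounded domain

Along a ray inside the domain, Duhamel's formula bounds a solution from below by what is transported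
along the ray plus what the gain term `Q⁺` produces on it, damped by the collision frequency. The
latter is at most `C (1 + |v|)` (`exists_loss_bound`). The hypotheses control the velocity integrals
only in the interior; the bound extends to the boundary by Fatou's lemma, because from every point
almost all velocities lead to points of continuity: by Sard's theorem, grazing velocities form a
null set (`IsC2Domain.volume_grazing`).

*Positivity.* The mass, the energy bound and the modulus of continuity provide a bump of the initial
datum, of fixed size and centred in a fixed compact set (`exists_initial_bump`). A lower bound on a
ball of velocities of radius `r` yields one for `Q⁺` on the concentric ball of radius `√2 r (1 - ξ)`
(`exists_spread`), so positivity near a point soon holds for all velocities in any given ball; it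
persists, because slow particles hardly move; and it is carried along segments, hence to all of the
connected domain (`IsPositiveNear.forall_mem`). Close to a boundary point, the backward rays with
velocities near the outward normal enter the domain, and one more collision bounds `Q⁺` at small
velocities, and also the flux to the wall, from below uniformly up to the boundary
(`exists_gain_flux_lower`).

*From `Q⁺` to the solution.* For `α < 1`, a backward ray either stays inside long enough for `Q⁺` to
act, or meets the wall, which emits a Maxwellian. The latter happens to all fast particles, so
finitely many spreading steps suffice (`exists_maxwellian_diffuse`). For `α = 1`, the backward
characteristics may be reflected infinitely often in a finite time, and cannot simply be followed.
Instead, let `F_t` be the set of points of phase space at which the expected lower bound fails at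
time `t`. During a short time `h` the failure is propagated along characteristics with at most one
bounce, except on a nearly grazing set of measure `o(h)`. As transport and bounces preserve Lebesgue
measure (`IsC2Domain.volume_bounce_le`), the measure of `F_t` grows by at most `o(h)`, hence it
remains zero (`volume_failSet`). Continuity of the solution on `Γ_conti` then turns the bound almost
everywhere into a bound everywhere (`gainProfile_le_solution`), and the spreading can be iterated:
after `n` steps the solution is at least `exp (-A 2 ^ n)` at velocities of size up to the order of
`√2 ^ n`, which is a Maxwellian bound (`exists_maxwellian_specular`).

*Uniformity.* All positivity statements are proved for families of solutions, with constants that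
are common to the family. Since the centre of the initial bump ranges over a compact set, finitely
many families exhaust the admissible solutions (`exists_maxwellian`).
-/

noncomputable section

namespace Boltzmann

/-! ### Local geometry of a `C²` domain -/

section Geometry

variable {Ω : Set R3} {x : R3} {ψ : R3 → ℝ}

theorem IsC2DefiningFunction.differentiableAt (h : IsC2DefiningFunction Ω x ψ) :
    DifferentiableAt ℝ ψ x := h.1.differentiableAt (by norm_num)

theorem fderiv_eq_inner_gradient (h : DifferentiableAt ℝ ψ x) (v : R3) :
    fderiv ℝ ψ x v = inner ℝ (gradient ψ x) v := by
  rw [h.hasGradientAt.hasFDerivAt.fderiv, InnerProductSpace.toDual_apply_apply]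

theorem IsC2DefiningFunction.contDiffAt_fderiv (h : IsC2DefiningFunction Ω x ψ) :
    ContDiffAt ℝ 1 (fderiv ℝ ψ) x := h.1.fderiv_right (by norm_num)

theorem IsC2DefiningFunction.contDiffAt_gradient (h : IsC2DefiningFunction Ω x ψ) :
    ContDiffAt ℝ 1 (gradient ψ) x := by
  have : gradient ψ = fun y => (InnerProductSpace.toDual ℝ R3).symm (fderiv ℝ ψ y) := rfl
  rw [this]
  exact ((InnerProductSpace.toDual ℝ R3).symm.contDiff.contDiffAt).comp x h.contDiffAt_fderiv

theorem IsC2DefiningFunction.eventually (h : IsC2DefiningFunction Ω x ψ) :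
    ∀ᶠ y in 𝓝 x, IsC2DefiningFunction Ω y ψ := by
  have h1 : ∀ᶠ y in 𝓝 x, ContDiffAt ℝ 2 ψ y := h.1.eventually (by simp)
  have h2 : ∀ᶠ y in 𝓝 x, gradient ψ y ≠ 0 :=
    h.contDiffAt_gradient.continuousAt.eventually_ne h.2.1
  filter_upwards [h1, h2, h.2.2.eventually_nhds] with y a b c using ⟨a, b, c⟩

theorem IsC2DefiningFunction.nonpos_of_mem_closure (h : IsC2DefiningFunction Ω x ψ)
    (hx : x ∈ closure Ω) : ψ x ≤ 0 := by
  by_contra hcon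
  push Not at hcon
  have h1 : ∀ᶠ y in 𝓝 x, y ∉ Ω := by
    filter_upwards [h.2.2, h.1.continuousAt.eventually_const_lt hcon] with y hy hy' hyΩ
    exact lt_asymm hy' (hy.1 hyΩ)
  exact (mem_closure_iff_frequently.1 hx) h1

theorem IsC2Domain.norm_outwardNormal (hΩ : IsC2Domain Ω) (hx : x ∈ frontier Ω) :
    ‖outwardNormal Ω x‖ = 1 := by
  obtain ⟨ψ, h⟩ := hΩ.boundary x hx
  rw [outwardNormal_eq h hx, norm_smul, norm_inv, norm_norm,
    inv_mul_cancel₀ (norm_ne_zero_iff.2 h.2.1)]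

theorem IsC2DefiningFunction.fderiv_apply (h : IsC2DefiningFunction Ω x ψ)
    (hx : x ∈ frontier Ω) (v : R3) :
    fderiv ℝ ψ x v = ‖gradient ψ x‖ * inner ℝ (outwardNormal Ω x) v := by
  rw [fderiv_eq_inner_gradient h.differentiableAt, outwardNormal_eq h hx, inner_smul_left]
  have := norm_ne_zero_iff.2 h.2.1
  simp [this]

/-- The normalised gradient of a defining function, a `C¹` extension of the outward normal to a
neighbourhood of a boundary point. -/
def unitGradient (ψ : R3 → ℝ) (y : R3) : R3 := ‖gradient ψ y‖⁻¹ • gradient ψ y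

theorem IsC2DefiningFunction.contDiffAt_unitGradient (h : IsC2DefiningFunction Ω x ψ) :
    ContDiffAt ℝ 1 (unitGradient ψ) x :=
  ((h.contDiffAt_gradient.norm ℝ h.2.1).inv (norm_ne_zero_iff.2 h.2.1)).smul h.contDiffAt_gradient

/-- On the boundary the outward normal is uniformly locally Lipschitz. -/
theorem IsC2Domain.exists_lipschitz_normal (hΩ : IsC2Domain Ω) :
    ∃ ε > 0, ∃ C > 0, ∀ y ∈ frontier Ω, ∀ z ∈ frontier Ω, ‖y - z‖ < ε →
      ‖outwardNormal Ω y - outwardNormal Ω z‖ ≤ C * ‖y - z‖ := by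
  have hc : IsCompact (frontier Ω) :=
    Metric.isCompact_of_isClosed_isBounded isClosed_frontier
      (hΩ.isBounded.closure.subset frontier_subset_closure)
  refine hc.induction_on (p := fun S => ∃ ε > 0, ∃ C > 0, ∀ y ∈ S, ∀ z ∈ frontier Ω,
      ‖y - z‖ < ε → ‖outwardNormal Ω y - outwardNormal Ω z‖ ≤ C * ‖y - z‖) ?_ ?_ ?_ ?_
  · exact ⟨1, one_pos, 1, one_pos, by simp⟩
  · rintro s t hst ⟨ε, hε, C, hC, H⟩
    exact ⟨ε, hε, C, hC, fun y hy => H y (hst hy)⟩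
  · rintro s t ⟨ε, hε, C, hC, H⟩ ⟨ε', hε', C', hC', H'⟩
    refine ⟨min ε ε', lt_min hε hε', max C C', lt_max_of_lt_left hC, ?_⟩
    rintro y (hy | hy) z hz hyz
    · exact (H y hy z hz (hyz.trans_le (min_le_left _ _))).trans (by gcongr; exact le_max_left _ _)
    · exact (H' y hy z hz (hyz.trans_le (min_le_right _ _))).trans
        (by gcongr; exact le_max_right _ _)
  · intro x hx
    obtain ⟨ψ, h⟩ := hΩ.boundary x hx
    obtain ⟨K, t, ht, hK⟩ := h.contDiffAt_unitGradient.exists_lipschitzOnWith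
    obtain ⟨ε, hε, hball⟩ := Metric.mem_nhds_iff.1 (inter_mem ht h.eventually)
    refine ⟨Metric.ball x (ε / 2) ∩ frontier Ω, inter_comm _ _ ▸ inter_mem_nhdsWithin _
      (Metric.ball_mem_nhds x (by positivity)), ε / 2, by positivity, K + 1, by positivity, ?_⟩
    rintro y ⟨hy, hyf⟩ z hz hyz
    have hy' : y ∈ Metric.ball x ε := Metric.ball_subset_ball (by linarith) hy
    have hz' : z ∈ Metric.ball x ε := by
      rw [Metric.mem_ball] at hy ⊢
      calc dist z x ≤ dist z y + dist y x := dist_triangle _ _ _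
        _ < ε / 2 + ε / 2 := by rw [dist_comm z y, dist_eq_norm y z]; linarith
        _ = ε := by ring
    rw [outwardNormal_eq (hball hy').2 hyf, outwardNormal_eq (hball hz').2 hz]
    have := hK.norm_sub_le (hball hy').1 (hball hz').1
    refine this.trans ?_
    gcongr
    simp

/-- Uniform interior sphere condition, in the form of a lower bound for the length of the chord
issued from `y` in a direction making a given angle with the boundary. -/
theorem IsC2Domain.exists_chord_bound (hΩ : IsC2Domain Ω) :
    ∃ ε > 0, ∃ C > 0, ∀ y ∈ frontier Ω, ∀ v : R3, ∀ s : ℝ, 0 < s → s * ‖v‖ ≤ ε →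
      C * s * ‖v‖ ^ 2 < inner ℝ (outwardNormal Ω y) v → y - s • v ∈ Ω := by
  have hc : IsCompact (frontier Ω) :=
    Metric.isCompact_of_isClosed_isBounded isClosed_frontier
      (hΩ.isBounded.closure.subset frontier_subset_closure)
  refine hc.induction_on (p := fun S => ∃ ε > 0, ∃ C > 0, ∀ y ∈ S, ∀ v : R3, ∀ s : ℝ, 0 < s →
      s * ‖v‖ ≤ ε → C * s * ‖v‖ ^ 2 < inner ℝ (outwardNormal Ω y) v → y - s • v ∈ Ω) ?_ ?_ ?_ ?_
  · exact ⟨1, one_pos, 1, one_pos, by simp⟩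
  · rintro s t hst ⟨ε, hε, C, hC, H⟩
    exact ⟨ε, hε, C, hC, fun y hy => H y (hst hy)⟩
  · rintro s t ⟨ε, hε, C, hC, H⟩ ⟨ε', hε', C', hC', H'⟩
    refine ⟨min ε ε', lt_min hε hε', max C C', lt_max_of_lt_left hC, ?_⟩
    rintro y (hy | hy) v s hs hsv hv
    · refine H y hy v s hs (hsv.trans (min_le_left _ _)) (lt_of_le_of_lt ?_ hv)
      gcongr; exact le_max_left _ _
    · refine H' y hy v s hs (hsv.trans (min_le_right _ _)) (lt_of_le_of_lt ?_ hv)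
      gcongr; exact le_max_right _ _
  · intro x hx
    obtain ⟨ψ, h⟩ := hΩ.boundary x hx
    obtain ⟨K, t, ht, hK⟩ := h.contDiffAt_fderiv.exists_lipschitzOnWith
    have hm : 0 < ‖gradient ψ x‖ := norm_pos_iff.2 h.2.1
    have hm' : ∀ᶠ y in 𝓝 x, ‖gradient ψ x‖ / 2 < ‖gradient ψ y‖ :=
      h.contDiffAt_gradient.continuousAt.norm.eventually_const_lt (by linarith)
    obtain ⟨ε, hε, hball⟩ := Metric.mem_nhds_iff.1 (inter_mem (inter_mem ht h.eventually) hm')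
    set m := ‖gradient ψ x‖ with hmdef
    refine ⟨Metric.ball x (ε / 2) ∩ frontier Ω, inter_comm _ _ ▸ inter_mem_nhdsWithin _
      (Metric.ball_mem_nhds x (by positivity)), ε / 4, by positivity, 2 * (K + 1) / m,
      by positivity, ?_⟩
    rintro y ⟨hy, hyf⟩ v s hs hsv hv
    have hy' : y ∈ Metric.ball x ε := Metric.ball_subset_ball (by linarith) hy
    have hsub : Metric.closedBall y (s * ‖v‖) ⊆ Metric.ball x ε := by
      intro z hz
      rw [Metric.mem_ball] at hy ⊢
      rw [Metric.mem_closedBall] at hz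
      linarith [dist_triangle z y x]
    have hyd := (hball hy').1.2
    have hz : y - s • v ∈ Metric.closedBall y (s * ‖v‖) := by
      rw [Metric.mem_closedBall, dist_eq_norm, sub_sub_cancel_left, norm_neg, norm_smul,
        Real.norm_of_nonneg hs.le]
    have hyc : y ∈ Metric.closedBall y (s * ‖v‖) :=
      Metric.mem_closedBall_self (by positivity)
    -- Taylor's formula: `ψ (y - s v)` differs from its linearisation `-s ‖∇ψ(y)‖ ⟨n(y), v⟩` by at
    -- most `K (s ‖v‖) ^ 2`, where `K` is a Lipschitz constant of the derivative.
    have key := (convex_closedBall y (s * ‖v‖)).norm_image_sub_le_of_norm_hasFDerivWithin_le'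
      (f := ψ) (f' := fderiv ℝ ψ) (φ := fderiv ℝ ψ y) (C := K * (s * ‖v‖))
      (fun z hz => ((hball (hsub hz)).1.2.differentiableAt.hasFDerivAt).hasFDerivWithinAt)
      (fun z hz => by
        have := hK.norm_sub_le (hball (hsub hz)).1.1 (hball hy').1.1
        refine this.trans ?_
        gcongr
        rwa [Metric.mem_closedBall, dist_eq_norm] at hz) hyc hz
    rw [hyd.eq_zero hyf, sub_zero, sub_sub_cancel_left, norm_neg, norm_smul,
      Real.norm_of_nonneg hs.le, map_neg, map_smul, hyd.fderiv_apply hyf, smul_eq_mul,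
      Real.norm_eq_abs] at key
    have key' := (abs_le.1 key).2
    refine ((hball (hsub hz)).1.2.2.2.self_of_nhds).2 ?_
    have hgy : m / 2 < ‖gradient ψ y‖ := (hball hy').2
    have hin : 0 < inner ℝ (outwardNormal Ω y) v := lt_of_le_of_lt (by positivity) hv
    have h1 : s * (m / 2 * inner ℝ (outwardNormal Ω y) v) ≤
        s * (‖gradient ψ y‖ * inner ℝ (outwardNormal Ω y) v) := by gcongr
    have h2 : s * (m / 2 * (2 * (K + 1) / m * s * ‖v‖ ^ 2)) <
        s * (m / 2 * inner ℝ (outwardNormal Ω y) v) := by gcongr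
    have h3 : s * (m / 2 * (2 * (K + 1) / m * s * ‖v‖ ^ 2)) =
        K * (s * ‖v‖) * (s * ‖v‖) + (s * ‖v‖) ^ 2 := by field_simp
    nlinarith [sq_nonneg (s * ‖v‖)]

/-- Interior cone condition: from all points of `closure Ω` near a boundary point `x`, the backward
rays with velocities close to the outward normal at `x` enter the domain. It needs only the strict
differentiability of a defining function at `x`. -/
theorem IsC2Domain.exists_cone (hΩ : IsC2Domain Ω) (hx : x ∈ frontier Ω) :
    ∃ ε > 0, ∀ y ∈ closure Ω, ‖y - x‖ < ε → ∀ v : R3, ‖v - outwardNormal Ω x‖ ≤ 4 / 5 →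
      ∀ s ∈ Ioo 0 ε, y - s • v ∈ Ω := by
  obtain ⟨ψ, h⟩ := hΩ.boundary x hx
  have hm : 0 < ‖gradient ψ x‖ := norm_pos_iff.2 h.2.1
  set m := ‖gradient ψ x‖ with hmdef
  have hn := hΩ.norm_outwardNormal hx
  have hs : HasStrictFDerivAt ψ (fderiv ℝ ψ x) x := h.1.hasStrictFDerivAt (by norm_num)
  have h1 := hs.isLittleO.def (c := m / 10) (by positivity)
  rw [nhds_prod_eq] at h1
  obtain ⟨t, ht, htP⟩ := mem_prod_self_iff.1 h1
  have hP : ∀ a ∈ t, ∀ b ∈ t, ‖ψ a - ψ b - fderiv ℝ ψ x (a - b)‖ ≤ m / 10 * ‖a - b‖ :=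
    fun a ha b hb => htP (mk_mem_prod ha hb)
  obtain ⟨ε, hε, hball⟩ := Metric.mem_nhds_iff.1 (inter_mem ht h.eventually)
  refine ⟨ε / 3, by positivity, ?_⟩
  intro y hy hyx v hv s hs
  have hvn : ‖v‖ ≤ 9 / 5 := by
    calc ‖v‖ = ‖(v - outwardNormal Ω x) + outwardNormal Ω x‖ := by simp
      _ ≤ _ := norm_add_le _ _
      _ ≤ 4 / 5 + 1 := by rw [hn]; gcongr
      _ = 9 / 5 := by norm_num
  have hin : 1 / 5 ≤ inner ℝ (outwardNormal Ω x) v := by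
    have e : inner ℝ (outwardNormal Ω x) v = 1 + inner ℝ (outwardNormal Ω x)
        (v - outwardNormal Ω x) := by
      rw [inner_sub_right, real_inner_self_eq_norm_sq, hn]; ring
    have := abs_le.1 (abs_real_inner_le_norm (outwardNormal Ω x) (v - outwardNormal Ω x))
    rw [hn, one_mul] at this
    linarith [this.1]
  have hyb : y ∈ Metric.ball x ε := by rw [Metric.mem_ball, dist_eq_norm]; linarith
  have hzb : y - s • v ∈ Metric.ball x ε := by
    rw [Metric.mem_ball, dist_eq_norm, sub_right_comm]
    calc ‖y - x - s • v‖ ≤ ‖y - x‖ + ‖s • v‖ := norm_sub_le _ _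
      _ < ε / 3 + ε / 3 * (9 / 5) := by
        rw [norm_smul, Real.norm_of_nonneg hs.1.le]
        have := hs.2
        have : s * ‖v‖ ≤ ε / 3 * (9 / 5) := by gcongr
        linarith
      _ ≤ ε := by linarith
  have key := hP (y - s • v) (hball hzb).1 y (hball hyb).1
  simp only [sub_sub_cancel_left, norm_neg, norm_smul, Real.norm_of_nonneg hs.1.le,
    h.fderiv_apply hx, inner_neg_right, inner_smul_right, ← hmdef, Real.norm_eq_abs] at key
  refine ((hball hzb).2.2.2.self_of_nhds).2 ?_
  have hy0 := (hball hyb).2.nonpos_of_mem_closure hy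
  have := (abs_le.1 key).2
  have h2 : s * (m * (1 / 5)) ≤ s * (m * inner ℝ (outwardNormal Ω x) v) := by
    have := hs.1; gcongr
  have h3 : m / 10 * (s * ‖v‖) ≤ m / 10 * (s * (9 / 5)) := by have := hs.1; gcongr
  nlinarith [mul_pos hs.1 hm]

/-- A ray leaving a boundary point in an outward direction leaves the closure at once. -/
theorem IsC2Domain.eventually_notMem_closure (hΩ : IsC2Domain Ω) (hx : x ∈ frontier Ω) {v : R3}
    (hv : 0 < inner ℝ (outwardNormal Ω x) v) : ∀ᶠ s in 𝓝[>] (0 : ℝ), x + s • v ∉ closure Ω := by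
  obtain ⟨ψ, h⟩ := hΩ.boundary x hx
  have h1 : HasLineDerivAt ℝ ψ (fderiv ℝ ψ x v) x v :=
    h.differentiableAt.hasFDerivAt.hasLineDerivAt v
  have h2 := h1.tendsto_slope_zero_right
  have hpos : 0 < fderiv ℝ ψ x v := by
    rw [h.fderiv_apply hx]; exact mul_pos (norm_pos_iff.2 h.2.1) hv
  have hline : Tendsto (fun t : ℝ => x + t • v) (𝓝[>] 0) (𝓝 x) := by
    have : Continuous (fun t : ℝ => x + t • v) := by fun_prop
    simpa using (this.tendsto 0).mono_left nhdsWithin_le_nhds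
  filter_upwards [h2.eventually_const_lt hpos, hline.eventually h.eventually,
    self_mem_nhdsWithin] with s hs hs' hs0 hcl
  have := hs'.nonpos_of_mem_closure hcl
  rw [h.eq_zero hx, sub_zero, smul_eq_mul] at hs
  have hs0' : 0 < s⁻¹ := inv_pos.2 hs0
  nlinarith

/-- A backward ray leaving a boundary point against an outward direction enters the domain. -/
theorem IsC2Domain.eventually_mem (hΩ : IsC2Domain Ω) (hx : x ∈ frontier Ω) {v : R3}
    (hv : 0 < inner ℝ (outwardNormal Ω x) v) : ∀ᶠ s in 𝓝[>] (0 : ℝ), x - s • v ∈ Ω := by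
  obtain ⟨ε, hε, C, hC, H⟩ := hΩ.exists_chord_bound
  have h1 : Tendsto (fun s : ℝ => s * ‖v‖) (𝓝[>] 0) (𝓝 0) := by
    have : Continuous (fun s : ℝ => s * ‖v‖) := by fun_prop
    simpa using (this.tendsto 0).mono_left nhdsWithin_le_nhds
  have h2 : Tendsto (fun s : ℝ => C * s * ‖v‖ ^ 2) (𝓝[>] 0) (𝓝 0) := by
    have : Continuous (fun s : ℝ => C * s * ‖v‖ ^ 2) := by fun_prop
    simpa using (this.tendsto 0).mono_left nhdsWithin_le_nhds
  filter_upwards [h1.eventually_le_const hε, h2.eventually_lt_const hv, self_mem_nhdsWithin]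
    with s a b c using H x hx v s c a b

theorem IsC2Domain.isCompact_frontier (hΩ : IsC2Domain Ω) : IsCompact (frontier Ω) :=
  Metric.isCompact_of_isClosed_isBounded isClosed_frontier
    (hΩ.isBounded.closure.subset frontier_subset_closure)

theorem IsC2Domain.isCompact_closure (hΩ : IsC2Domain Ω) : IsCompact (closure Ω) :=
  Metric.isCompact_of_isClosed_isBounded isClosed_closure hΩ.isBounded.closure

theorem IsC2Domain.mem_or_mem_frontier (hΩ : IsC2Domain Ω) (hx : x ∈ closure Ω) :
    x ∈ Ω ∨ x ∈ frontier Ω := by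
  by_cases h : x ∈ Ω
  · exact Or.inl h
  · right; exact ⟨hx, by rwa [hΩ.isOpen.interior_eq]⟩

theorem inner_reflect (hΩ : IsC2Domain Ω) (hx : x ∈ frontier Ω) (v : R3) :
    inner ℝ (outwardNormal Ω x) (reflect Ω x v) = -inner ℝ (outwardNormal Ω x) v := by
  have hn := hΩ.norm_outwardNormal hx
  rw [reflect, inner_sub_right, inner_smul_right, real_inner_self_eq_norm_sq, hn,
    real_inner_comm v]
  ring

theorem norm_reflect (hΩ : IsC2Domain Ω) (hx : x ∈ frontier Ω) (v : R3) :
    ‖reflect Ω x v‖ = ‖v‖ := by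
  have hn := hΩ.norm_outwardNormal hx
  have : ‖reflect Ω x v‖ ^ 2 = ‖v‖ ^ 2 := by
    rw [reflect, norm_sub_sq_real, norm_smul, inner_smul_right, hn, Real.norm_eq_abs, mul_one,
      sq_abs]
    ring
  exact (pow_left_inj₀ (norm_nonneg _) (norm_nonneg _) two_ne_zero).1 this

end Geometry

/-! ### Boundary charts and their Jacobians -/

/-- The orthogonal projection along the unit vector `e`. -/
def planeProj (e w : R3) : R3 := w - inner ℝ e w • e

/-- The orthogonal projection along `e`, as a continuous linear map. -/
def planeProjL (e : R3) : R3 →L[ℝ] R3 :=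
  ContinuousLinearMap.id ℝ R3 - (innerSL ℝ e).smulRight e

/-- The derivative of `w ↦ Θ(w - ⟨e, w⟩ e) + ⟨e, w⟩ v`, where `A` is the derivative of `Θ`. The two
tangential coordinates of `w` thus parametrise the boundary, and the coordinate along `e` is the
time of flight with the velocity `v`. -/
def tubeDeriv (e : R3) (A : R3 →L[ℝ] R3) (v : R3) : R3 →L[ℝ] R3 :=
  A.comp (planeProjL e) + (innerSL ℝ e).smulRight v

/-- A `C¹` chart `Θ` of a neighbourhood `V` of a boundary point, with inverse `κ`, such that the
part of the plane `e^⊥` in the domain `U` of `Θ` covers `V ∩ ∂Ω`; here `A` is the derivative of `Θ`.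
The last fields record the Jacobian `j ⟨n, v⟩` of the tube coordinates
`w ↦ Θ(w - ⟨e, w⟩ e) + ⟨e, w⟩ v` at the boundary. Its second factor is the density of the flux
measure `|⟨n, v⟩|`, and vanishes exactly at grazing velocities. -/
structure BoundaryChart (Ω : Set R3) where
  V : Set R3
  U : Set R3
  e : R3
  κ : R3 → R3
  Θ : R3 → R3
  A : R3 → R3 →L[ℝ] R3
  j : R3 → ℝ
  isOpen_V : IsOpen V
  isOpen_U : IsOpen U
  norm_e : ‖e‖ = 1
  mapsTo : ∀ y ∈ V, y ∈ frontier Ω → κ y ∈ U ∧ inner ℝ e (κ y) = 0 ∧ Θ (κ y) = y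
  left_inv : ∀ w ∈ U, κ (Θ w) = w
  mem_V : ∀ w ∈ U, Θ w ∈ V
  hasFDerivAt : ∀ w ∈ U, HasFDerivAt Θ (A w) w
  continuousOn_j : ContinuousOn j U
  det_eq : ∀ w ∈ U, Θ w ∈ frontier Ω → ∀ v,
    (tubeDeriv e (A w) v).det = j w * inner ℝ (outwardNormal Ω (Θ w)) v
  j_ne : ∀ w ∈ U, j w ≠ 0

theorem det_id_add_smulRight (f : R3 →L[ℝ] ℝ) (u : R3) :
    (ContinuousLinearMap.id ℝ R3 + f.smulRight u).det = 1 + f u := by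
  exact LinearMap.transvection.det (f : R3 →ₗ[ℝ] ℝ) u

/-- The derivative of the tube coordinates is the composition of the derivative `B⁻¹` of the chart
and of the transvection `w ↦ w + ⟨e, w⟩ (B v - e)`. -/
theorem det_tubeDeriv (e : R3) (he : ‖e‖ = 1) (B : R3 ≃L[ℝ] R3) (v : R3) :
    (tubeDeriv e (B.symm : R3 →L[ℝ] R3) v).det =
      ((B : R3 →L[ℝ] R3).det)⁻¹ * inner ℝ e (B v) := by
  have h1 : tubeDeriv e (B.symm : R3 →L[ℝ] R3) v = (B.symm : R3 →L[ℝ] R3).comp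
      (ContinuousLinearMap.id ℝ R3 + (innerSL ℝ e).smulRight (B v - e)) := by
    ext1 δ
    simp [tubeDeriv, planeProjL, sub_eq_add_neg]
    abel
  have h2 : (B.symm : R3 →L[ℝ] R3).det * (B : R3 →L[ℝ] R3).det = 1 := by
    have := LinearMap.det_comp (B.symm : R3 →ₗ[ℝ] R3) (B : R3 →ₗ[ℝ] R3)
    have h3 : (B.symm : R3 →ₗ[ℝ] R3) ∘ₗ (B : R3 →ₗ[ℝ] R3) = LinearMap.id := by ext; simp
    rw [h3, LinearMap.det_id] at this
    exact this.symm
  have h3 : (B : R3 →L[ℝ] R3).det ≠ 0 := right_ne_zero_of_mul_eq_one h2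
  rw [h1]
  have h4 := LinearMap.det_comp (B.symm : R3 →ₗ[ℝ] R3)
    ((ContinuousLinearMap.id ℝ R3 + (innerSL ℝ e).smulRight (B v - e) : R3 →L[ℝ] R3) : R3 →ₗ[ℝ] R3)
  have h5 := det_id_add_smulRight (innerSL ℝ e) (B v - e)
  calc _ = (B.symm : R3 →L[ℝ] R3).det *
      (ContinuousLinearMap.id ℝ R3 + (innerSL ℝ e).smulRight (B v - e)).det := h4
    _ = _ := by
      rw [h5, eq_inv_of_mul_eq_one_left h2, innerSL_apply_apply, inner_sub_right,
        real_inner_self_eq_norm_sq, he]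
      ring

/-- The inverse `κ` of the chart is `y ↦ y - x` with the coordinate along the normal `e` at `x`
replaced by `ψ(y) / ‖∇ψ(x)‖`, where `ψ` is a defining function. The inverse function theorem applies
to it, and it straightens the boundary, on which `ψ = 0`. -/
theorem IsC2Domain.exists_boundaryChart {Ω : Set R3} (hΩ : IsC2Domain Ω) {x : R3}
    (hx : x ∈ frontier Ω) : ∃ c : BoundaryChart Ω, x ∈ c.V := by
  obtain ⟨ψ, h⟩ := hΩ.boundary x hx
  have hm : 0 < ‖gradient ψ x‖ := norm_pos_iff.2 h.2.1
  set m := ‖gradient ψ x‖ with hmdef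
  set e : R3 := m⁻¹ • gradient ψ x with he
  have hen : ‖e‖ = 1 := by rw [he, norm_smul, norm_inv, norm_norm, inv_mul_cancel₀ hm.ne']
  set κ : R3 → R3 := fun y => (y - x) + (m⁻¹ * ψ y - inner ℝ e (y - x)) • e with hκ
  set B : R3 → R3 →L[ℝ] R3 := fun y => ContinuousLinearMap.id ℝ R3 +
    (m⁻¹ • fderiv ℝ ψ y - innerSL ℝ e).smulRight e with hB
  have hκd : ∀ y, IsC2DefiningFunction Ω y ψ → HasFDerivAt κ (B y) y := by
    intro y hy
    have h1 : HasFDerivAt (fun y : R3 => y - x) (ContinuousLinearMap.id ℝ R3) y :=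
      (hasFDerivAt_id y).sub_const x
    have h2 : HasFDerivAt (fun y : R3 => inner ℝ e (y - x)) (innerSL ℝ e) y := by
      exact (innerSL ℝ e).hasFDerivAt.comp y h1
    exact h1.add (((hy.differentiableAt.hasFDerivAt.const_mul m⁻¹).sub h2).smul_const e)
  have hdet : ∀ y, (B y).det = m⁻¹ * fderiv ℝ ψ y e := by
    intro y
    rw [hB, det_id_add_smulRight]
    simp [hen]
  have hBe : ∀ y v, inner ℝ e (B y v) = m⁻¹ * fderiv ℝ ψ y v := by
    intro y v
    simp [hB, inner_add_right, inner_smul_right, hen]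
  have hge : fderiv ℝ ψ x e = m := by
    rw [fderiv_eq_inner_gradient h.differentiableAt, he, inner_smul_right,
      real_inner_self_eq_norm_sq, ← hmdef]
    field_simp
  have hpos : ∀ᶠ y in 𝓝 x, 0 < fderiv ℝ ψ y e := by
    have : ContinuousAt (fun y => fderiv ℝ ψ y e) x :=
      h.contDiffAt_fderiv.continuousAt.clm_apply continuousAt_const
    exact this.eventually_const_lt (by simpa only [hge] using hm)
  have hκc : ContDiffAt ℝ 1 κ x := by
    have h1 : ContDiffAt ℝ 1 ψ x := h.1.of_le (by norm_num)
    have h2 : ContDiffAt ℝ 1 (fun y : R3 => inner ℝ e (y - x)) x :=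
      contDiffAt_const.inner ℝ (contDiffAt_id.sub contDiffAt_const)
    exact (contDiffAt_id.sub contDiffAt_const).add
      (((contDiffAt_const.mul h1).sub h2).smul contDiffAt_const)
  have hdet0 : ∀ y, 0 < fderiv ℝ ψ y e → (B y).det ≠ 0 := fun y hy => by
    rw [hdet]; exact (mul_pos (inv_pos.2 hm) hy).ne'
  have hdet1 : (B x).det ≠ 0 := hdet0 x (by rw [hge]; exact hm)
  have hstrict : HasStrictFDerivAt κ
      (((B x).toContinuousLinearEquivOfDetNeZero hdet1 : R3 ≃L[ℝ] R3) : R3 →L[ℝ] R3) x := by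
    have := hκc.hasStrictFDerivAt' (hκd x h) (by norm_num)
    simpa using this
  set H := hstrict.toOpenPartialHomeomorph κ with hH
  have hHκ : (H : R3 → R3) = κ := rfl
  obtain ⟨V', hV'sub, hV'o, hxV'⟩ := eventually_nhds_iff.1 (h.eventually.and hpos)
  have hcg : ∀ y ∈ V', ContinuousAt (fderiv ℝ ψ) y := fun y hy =>
    (hV'sub y hy).1.contDiffAt_fderiv.continuousAt
  have hU : ∀ w ∈ H.symm.source ∩ H.symm ⁻¹' V', H.symm w ∈ V' := fun w hw => hw.2
  refine ⟨{ V := H.source ∩ V'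
            U := H.symm.source ∩ H.symm ⁻¹' V'
            e := e
            κ := κ
            Θ := H.symm
            A := fun w => if hw : (B (H.symm w)).det ≠ 0 then
              (((B (H.symm w)).toContinuousLinearEquivOfDetNeZero hw).symm : R3 →L[ℝ] R3) else 0
            j := fun w => (fderiv ℝ ψ (H.symm w) e)⁻¹ * ‖gradient ψ (H.symm w)‖
            isOpen_V := H.open_source.inter hV'o
            isOpen_U := H.symm.isOpen_inter_preimage hV'o
            norm_e := hen
            mapsTo := ?_
            left_inv := ?_
            mem_V := ?_
            hasFDerivAt := ?_
            continuousOn_j := ?_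
            det_eq := ?_
            j_ne := ?_ }, ⟨hstrict.mem_toOpenPartialHomeomorph_source, hxV'⟩⟩
  · rintro y ⟨hy, hy'⟩ hyf
    refine ⟨⟨?_, ?_⟩, ?_, ?_⟩
    · rw [H.symm_source, ← hHκ]; exact H.map_source hy
    · rw [mem_preimage, ← hHκ, H.left_inv hy]; exact hy'
    · rw [hκ]
      simp [inner_add_right, inner_smul_right, hen,
        (hV'sub y hy').1.eq_zero hyf]
    · rw [← hHκ, H.left_inv hy]
  · rintro w ⟨hw, hw'⟩
    rw [← hHκ]; exact H.right_inv hw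
  · rintro w ⟨hw, hw'⟩
    exact ⟨H.symm.map_source hw, hw'⟩
  · rintro w ⟨hw, hw'⟩
    have hd := hdet0 _ (hV'sub _ hw').2
    rw [dif_pos hd]
    refine H.hasFDerivAt_symm hw ?_
    have := hκd _ (hV'sub _ hw').1
    rw [ContinuousLinearMap.coe_toContinuousLinearEquivOfDetNeZero]
    exact this
  · rintro w ⟨hw, hw'⟩
    have h1 : ContinuousAt H.symm w := H.symm.continuousAt hw
    have h2 : ContinuousAt (fun w => fderiv ℝ ψ (H.symm w)) w :=
      ContinuousAt.comp (g := fderiv ℝ ψ) (hcg _ hw') h1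
    have h3 : ContinuousAt (fun w => gradient ψ (H.symm w)) w :=
      (InnerProductSpace.toDual ℝ R3).symm.continuous.continuousAt.comp h2
    exact (((h2.clm_apply continuousAt_const).inv₀ (hV'sub _ hw').2.ne').mul
      h3.norm).continuousWithinAt
  · rintro w ⟨hw, hw'⟩ hwf v
    have hd := hdet0 _ (hV'sub _ hw').2
    simp only [dif_pos hd]
    rw [det_tubeDeriv e hen]
    rw [ContinuousLinearMap.coe_toContinuousLinearEquivOfDetNeZero]
    have : ((B (H.symm w)).toContinuousLinearEquivOfDetNeZero hd) v = B (H.symm w) v := rfl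
    rw [this, hBe, hdet, (hV'sub _ hw').1.fderiv_apply hwf v, mul_inv, inv_inv]
    field_simp
  · rintro w ⟨hw, hw'⟩
    exact mul_ne_zero (inv_ne_zero (hV'sub _ hw').2.ne')
      (norm_ne_zero_iff.2 (hV'sub _ hw').1.2.1)

/-! ### Null sets: the boundary, and the velocities of grazing rays -/

theorem planeProj_add_smul {e : R3} (he : ‖e‖ = 1) {p : R3} (hp : inner ℝ e p = 0) (s : ℝ) :
    planeProj e (p + s • e) = p := by
  rw [planeProj, inner_add_right, inner_smul_right, real_inner_self_eq_norm_sq, he, hp]; simp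

theorem inner_add_smul_self {e : R3} (he : ‖e‖ = 1) {p : R3} (hp : inner ℝ e p = 0) (s : ℝ) :
    inner ℝ e (p + s • e) = s := by
  rw [inner_add_right, inner_smul_right, real_inner_self_eq_norm_sq, he, hp]; simp

theorem hasFDerivAt_planeProj (e w : R3) : HasFDerivAt (planeProj e) (planeProjL e) w :=
  (planeProjL e).hasFDerivAt

theorem continuous_planeProj (e : R3) : Continuous (planeProj e) := by
  unfold planeProj; fun_prop

theorem volume_hyperplane {e : R3} (he : e ≠ 0) : volume {w : R3 | inner ℝ e w = 0} = 0 := by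
  have h : ((innerSL ℝ e : R3 →L[ℝ] ℝ) : R3 →ₗ[ℝ] ℝ).ker ≠ ⊤ := by
    intro h
    have : e ∈ ((innerSL ℝ e : R3 →L[ℝ] ℝ) : R3 →ₗ[ℝ] ℝ).ker := by rw [h]; trivial
    exact he (inner_self_eq_zero.1 (show inner ℝ e e = 0 from this))
  exact Measure.addHaar_submodule volume _ h

theorem IsC2Domain.volume_frontier {Ω : Set R3} (hΩ : IsC2Domain Ω) :
    volume (frontier Ω) = 0 := by
  refine measure_null_of_locally_null _ fun x hx => ?_
  obtain ⟨c, hc⟩ := hΩ.exists_boundaryChart hx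
  refine ⟨frontier Ω ∩ c.V, inter_mem_nhdsWithin _ (c.isOpen_V.mem_nhds hc), ?_⟩
  have hsub : frontier Ω ∩ c.V ⊆ c.Θ '' (c.U ∩ {w | inner ℝ c.e w = 0}) := by
    rintro y ⟨hy, hyV⟩
    obtain ⟨h1, h2, h3⟩ := c.mapsTo y hyV hy
    exact ⟨c.κ y, ⟨h1, h2⟩, h3⟩
  have he : c.e ≠ 0 := fun h => by simpa [h] using c.norm_e
  refine measure_mono_null hsub (addHaar_image_eq_zero_of_differentiableOn_of_addHaar_eq_zero
    volume ?_ (measure_mono_null inter_subset_right (volume_hyperplane he)))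
  exact fun w hw => (c.hasFDerivAt w hw.1).differentiableAt.differentiableWithinAt

theorem BoundaryChart.hasFDerivAt_tube {Ω : Set R3} (c : BoundaryChart Ω) {w : R3}
    (hw : planeProj c.e w ∈ c.U) (v : R3) :
    HasFDerivAt (fun w => c.Θ (planeProj c.e w) + (inner ℝ c.e w : ℝ) • v)
      (tubeDeriv c.e (c.A (planeProj c.e w)) v) w :=
  ((c.hasFDerivAt _ hw).comp w (hasFDerivAt_planeProj c.e w)).add
    ((innerSL ℝ c.e).hasFDerivAt.smul_const v)

/-- The velocities of the backward rays from `x` which graze the boundary form a null set. This is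
an instance of Sard's theorem: in tube coordinates, such velocities are values of the map
`M w = (x - Θ(w - ⟨e, w⟩ e)) / ⟨e, w⟩` at points at which its derivative is degenerate. -/
theorem IsC2Domain.volume_grazing {Ω : Set R3} (hΩ : IsC2Domain Ω) (x : R3) :
    volume {v : R3 | ∃ s > (0 : ℝ), x - s • v ∈ frontier Ω ∧
      inner ℝ (outwardNormal Ω (x - s • v)) v = 0} = 0 := by
  suffices H : volume {v : R3 | ∃ s > (0 : ℝ), x - s • v ∈ frontier Ω ∧
      (x - s • v ∈ frontier Ω ∧ inner ℝ (outwardNormal Ω (x - s • v)) v = 0)} = 0 from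
    measure_mono_null (by rintro v ⟨s, hs, h1, h2⟩; exact ⟨s, hs, h1, h1, h2⟩) H
  refine hΩ.isCompact_frontier.induction_on (p := fun S => volume {v : R3 | ∃ s > (0 : ℝ),
    x - s • v ∈ S ∧ (x - s • v ∈ frontier Ω ∧ inner ℝ (outwardNormal Ω (x - s • v)) v = 0)} = 0)
    ?_ ?_ ?_ ?_
  · simp
  · intro s t hst h
    exact measure_mono_null (by rintro v ⟨s, hs, h1, h2⟩; exact ⟨s, hs, hst h1, h2⟩) h
  · intro s t hs ht
    refine measure_mono_null ?_ (measure_union_null hs ht)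
    rintro v ⟨r, hr, h1 | h1, h2⟩
    · exact Or.inl ⟨r, hr, h1, h2⟩
    · exact Or.inr ⟨r, hr, h1, h2⟩
  · intro y hy
    obtain ⟨c, hc⟩ := hΩ.exists_boundaryChart hy
    refine ⟨c.V, mem_nhdsWithin_of_mem_nhds (c.isOpen_V.mem_nhds hc), ?_⟩
    set M : R3 → R3 := fun w => (inner ℝ c.e w : ℝ)⁻¹ • (x - c.Θ (planeProj c.e w)) with hM
    set D : Set R3 := {w | planeProj c.e w ∈ c.U ∧ 0 < (inner ℝ c.e w : ℝ) ∧
      c.Θ (planeProj c.e w) ∈ frontier Ω ∧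
      inner ℝ (outwardNormal Ω (c.Θ (planeProj c.e w))) (M w) = 0} with hD
    have hsub : {v : R3 | ∃ s > (0 : ℝ), x - s • v ∈ c.V ∧ (x - s • v ∈ frontier Ω ∧
        inner ℝ (outwardNormal Ω (x - s • v)) v = 0)} ⊆ M '' D := by
      rintro v ⟨s, hs, h1, h2, h3⟩
      obtain ⟨k1, k2, k3⟩ := c.mapsTo _ h1 h2
      have hMv : M (c.κ (x - s • v) + s • c.e) = v := by
        simp only [hM]
        rw [planeProj_add_smul c.norm_e k2, inner_add_smul_self c.norm_e k2, k3, sub_sub_cancel,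
          smul_smul, inv_mul_cancel₀ hs.ne', one_smul]
      refine ⟨c.κ (x - s • v) + s • c.e, ?_, hMv⟩
      simp only [hD, mem_ofPred_eq]
      rw [hMv, planeProj_add_smul c.norm_e k2, inner_add_smul_self c.norm_e k2, k3]
      exact ⟨k1, hs, h2, h3⟩
    refine measure_mono_null hsub (addHaar_image_eq_zero_of_det_fderivWithin_eq_zero volume
      (f' := fun w => (-(inner ℝ c.e w : ℝ)⁻¹) • tubeDeriv c.e (c.A (planeProj c.e w)) (M w)) ?_ ?_)
    · rintro w ⟨h1, h2, h3, h4⟩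
      have d1 : HasFDerivAt (fun w : R3 => (inner ℝ c.e w : ℝ)⁻¹)
          (-((inner ℝ c.e w : ℝ) ^ 2)⁻¹ • innerSL ℝ c.e) w := by
        have := (hasDerivAt_inv h2.ne').comp_hasFDerivAt w (innerSL ℝ c.e).hasFDerivAt
        exact this
      have d2 : HasFDerivAt (fun w => x - c.Θ (planeProj c.e w))
          (-(c.A (planeProj c.e w)).comp (planeProjL c.e)) w :=
        ((c.hasFDerivAt _ h1).comp w (hasFDerivAt_planeProj c.e w)).const_sub x
      refine ((d1.smul d2).congr_fderiv ?_).hasFDerivWithinAt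
      ext1 δ
      simp only [tubeDeriv, hM, smul_sub, ContinuousLinearMap.smulRight_apply,
        add_apply, smul_apply, neg_apply,
        ContinuousLinearMap.comp_apply, smul_add, smul_smul, innerSL_apply_apply, smul_eq_mul,
        neg_smul, smul_neg]
      congr 1
      field_simp
      abel
    · rintro w ⟨h1, h2, h3, h4⟩
      have := c.det_eq _ h1 h3 (M w)
      rw [h4, mul_zero] at this
      have h5 := LinearMap.det_smul (-(inner ℝ c.e w : ℝ)⁻¹)
        ((tubeDeriv c.e (c.A (planeProj c.e w)) (M w) : R3 →L[ℝ] R3) : R3 →ₗ[ℝ] R3)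
      refine Eq.trans h5 ?_
      have h6 : LinearMap.det ((tubeDeriv c.e (c.A (planeProj c.e w)) (M w) : R3 →L[ℝ] R3) :
        R3 →ₗ[ℝ] R3) = 0 := this
      rw [h6, mul_zero]

/-! ### The billiard bounce preserves Lebesgue measure -/

/-- The reflection in the plane orthogonal to `n` (for `‖n‖ = 1`). -/
def mirror (n v : R3) : R3 := v - (2 * inner ℝ v n) • n

theorem mirror_mirror {n : R3} (hn : ‖n‖ = 1 ∨ n = 0) (v : R3) : mirror n (mirror n v) = v := by
  rcases hn with hn | rfl
  · have : inner ℝ n n = (1 : ℝ) := by rw [real_inner_self_eq_norm_sq, hn]; norm_num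
    simp only [mirror, inner_sub_left, inner_smul_left, this]
    simp only [conj_trivial, mul_one, sub_sub, ← add_smul]
    ring_nf
    simp
  · simp [mirror]

theorem measurePreserving_mirror {n : R3} (hn : ‖n‖ = 1 ∨ n = 0) :
    MeasurePreserving (mirror n) (volume : Measure R3) volume := by
  rcases hn with hn | rfl
  · have : mirror n = fun v => (Submodule.reflection (ℝ ∙ n)ᗮ) v := by
      ext1 v
      rw [Submodule.reflection_orthogonal_apply, Submodule.reflection_singleton_apply, hn,
        real_inner_comm, mirror]
      simp [mul_smul, two_smul]
    rw [this]
    exact (Submodule.reflection (ℝ ∙ n)ᗮ).measurePreserving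
  · have : mirror 0 = id := by ext1 v; simp [mirror]
    rw [this]
    exact MeasurePreserving.id _

section

variable (Ω : Set R3)

/-- The outward normal extended by zero outside the boundary, which makes it measurable. -/
def normalExt (y : R3) : R3 := (frontier Ω).indicator (outwardNormal Ω) y

/-- Pairs `(y, u)` such that the segment from `y` to `y + u` lies in `closure Ω`. -/
def segSet : Set (R3 × R3) := {q | ∀ l ∈ Icc (0 : ℝ) 1, q.1 + l • q.2 ∈ closure Ω}

/-- Triples `(s, y, v)` describing one bounce during a time interval of length `h`: the backward
characteristic hits the boundary at the point `y` with velocity `v` after the time `s`, and arrives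
in `A` after being reflected. -/
def bounceSet (h : ℝ) (B : Set R3) (A : Set (R3 × R3)) : Set (ℝ × R3 × R3) :=
  {q | q.1 ∈ Ioo 0 h ∧ q.2.1 ∈ B ∧ inner ℝ (normalExt Ω q.2.1) q.2.2 < 0 ∧
    (q.2.1, q.1 • q.2.2) ∈ segSet Ω ∧
    (q.2.1, -((h - q.1) • mirror (normalExt Ω q.2.1) q.2.2)) ∈ segSet Ω ∧
    (q.2.1 - (h - q.1) • mirror (normalExt Ω q.2.1) q.2.2, mirror (normalExt Ω q.2.1) q.2.2) ∈ A}

/-- The phase space point from which the bounce is followed backwards. -/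
def preBounce (q : ℝ × R3 × R3) : R3 × R3 := (q.2.1 + q.1 • q.2.2, q.2.2)

/-- The phase space point at which the backward characteristic arrives after the bounce. -/
def postBounce (h : ℝ) (q : ℝ × R3 × R3) : R3 × R3 :=
  (q.2.1 - (h - q.1) • mirror (normalExt Ω q.2.1) q.2.2, mirror (normalExt Ω q.2.1) q.2.2)

variable {Ω}

theorem normalExt_of_mem {y : R3} (hy : y ∈ frontier Ω) : normalExt Ω y = outwardNormal Ω y := by
  simp [normalExt, hy]

theorem mirror_normalExt {y : R3} (hy : y ∈ frontier Ω) (v : R3) :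
    mirror (normalExt Ω y) v = reflect Ω y v := by
  rw [normalExt_of_mem hy]; rfl

theorem norm_normalExt (hΩ : IsC2Domain Ω) (y : R3) : ‖normalExt Ω y‖ = 1 ∨ normalExt Ω y = 0 := by
  by_cases hy : y ∈ frontier Ω
  · left; rw [normalExt_of_mem hy, hΩ.norm_outwardNormal hy]
  · right; simp [normalExt, hy]

theorem IsC2Domain.continuousOn_outwardNormal (hΩ : IsC2Domain Ω) :
    ContinuousOn (outwardNormal Ω) (frontier Ω) := by
  obtain ⟨ε, hε, C, hC, H⟩ := hΩ.exists_lipschitz_normal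
  intro y hy
  rw [ContinuousWithinAt, tendsto_iff_norm_sub_tendsto_zero]
  have h1 : Tendsto (fun z : R3 => ‖z - y‖) (𝓝[frontier Ω] y) (𝓝 0) := by
    have : Continuous (fun z : R3 => ‖z - y‖) := by fun_prop
    simpa using (this.tendsto y).mono_left nhdsWithin_le_nhds
  have h2 : Tendsto (fun z : R3 => C * ‖z - y‖) (𝓝[frontier Ω] y) (𝓝 0) := by
    simpa using h1.const_mul C
  refine squeeze_zero' (Eventually.of_forall fun _ => norm_nonneg _) ?_ h2
  filter_upwards [h1.eventually_lt_const hε, self_mem_nhdsWithin] with z hz hzf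
    using H z hzf y hy hz

theorem measurable_normalExt (hΩ : IsC2Domain Ω) : Measurable (normalExt Ω) := by
  classical
  have := hΩ.continuousOn_outwardNormal.measurable_piecewise (g := fun _ => (0 : R3))
    continuousOn_const isClosed_frontier.measurableSet
  convert this using 1
  ext1 y
  simp [normalExt, indicator, piecewise]

theorem isClosed_segSet : IsClosed (segSet Ω) := by
  have : segSet Ω = ⋂ l ∈ Icc (0 : ℝ) 1, {q : R3 × R3 | q.1 + l • q.2 ∈ closure Ω} := by
    ext q; simp [segSet]
  rw [this]
  exact isClosed_biInter fun l _ => isClosed_closure.preimage (by fun_prop)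

theorem measurable_mirror_normalExt (hΩ : IsC2Domain Ω) :
    Measurable (fun q : R3 × R3 => mirror (normalExt Ω q.1) q.2) := by
  have h : Measurable (fun q : R3 × R3 => normalExt Ω q.1) :=
    (measurable_normalExt hΩ).comp measurable_fst
  have h' : Measurable (fun q : R3 × R3 => (inner ℝ q.2 (normalExt Ω q.1) : ℝ)) :=
    Measurable.inner (𝕜 := ℝ) measurable_snd h
  unfold mirror
  exact measurable_snd.sub ((h'.const_mul 2).smul h)

theorem measurableSet_bounceSet (hΩ : IsC2Domain Ω) (h : ℝ) {B : Set R3} (hB : MeasurableSet B)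
    {A : Set (R3 × R3)} (hA : MeasurableSet A) : MeasurableSet (bounceSet Ω h B A) := by
  have m1 : Measurable (fun q : ℝ × R3 × R3 => normalExt Ω q.2.1) :=
    (measurable_normalExt hΩ).comp (measurable_fst.comp measurable_snd)
  have m2 : Measurable (fun q : ℝ × R3 × R3 => mirror (normalExt Ω q.2.1) q.2.2) :=
    (measurable_mirror_normalExt hΩ).comp measurable_snd
  have m3 : Measurable (fun q : ℝ × R3 × R3 => q.2.1) := measurable_fst.comp measurable_snd
  have m4 : Measurable (fun q : ℝ × R3 × R3 => q.2.2) := measurable_snd.comp measurable_snd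
  have m5 : Measurable (fun q : ℝ × R3 × R3 => (h - q.1) • mirror (normalExt Ω q.2.1) q.2.2) :=
    (measurable_fst.const_sub h).smul m2
  refine (measurable_fst measurableSet_Ioo).inter ((m3 hB).inter ?_)
  refine (measurableSet_lt (Measurable.inner (𝕜 := ℝ) m1 m4) measurable_const).inter ?_
  refine MeasurableSet.inter ((m3.prodMk (measurable_fst.smul m4)) isClosed_segSet.measurableSet) ?_
  refine MeasurableSet.inter ((m3.prodMk m5.neg) isClosed_segSet.measurableSet) ?_
  exact ((m3.sub m5).prodMk m2) hA

theorem measurable_preBounce : Measurable preBounce :=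
  ((measurable_fst.comp measurable_snd).add
    (measurable_fst.smul (measurable_snd.comp measurable_snd))).prodMk
    (measurable_snd.comp measurable_snd)

theorem measurable_postBounce (hΩ : IsC2Domain Ω) (h : ℝ) : Measurable (postBounce Ω h) := by
  have m2 : Measurable (fun q : ℝ × R3 × R3 => mirror (normalExt Ω q.2.1) q.2.2) :=
    (measurable_mirror_normalExt hΩ).comp measurable_snd
  exact ((measurable_fst.comp measurable_snd).sub ((measurable_fst.const_sub h).smul m2)).prodMk m2

/-- A ray which stays in `closure Ω` cannot cross the boundary outwards before its end. -/
theorem IsC2Domain.not_mem_segSet_of_exit (hΩ : IsC2Domain Ω) {y u : R3} (hy : y ∈ frontier Ω)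
    (hu : 0 < inner ℝ (outwardNormal Ω y) u) {c : ℝ} (hc : 0 < c) :
    ¬ ∀ s ∈ Icc 0 c, y + s • u ∈ closure Ω := by
  intro h
  have h1 := hΩ.eventually_notMem_closure hy hu
  have h2 : ∀ᶠ s in 𝓝[>] (0 : ℝ), s ∈ Ioc 0 c := Ioc_mem_nhdsGT hc
  obtain ⟨s, hs1, hs2⟩ := (h1.and h2).exists
  exact hs1 (h s ⟨hs2.1.le, hs2.2⟩)

theorem segSet_iff {y u : R3} {c : ℝ} (hc : 0 < c) :
    (y, c • u) ∈ segSet Ω ↔ ∀ s ∈ Icc 0 c, y + s • u ∈ closure Ω := by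
  constructor
  · intro h s hs
    have := h (s / c) ⟨div_nonneg hs.1 hc.le, (div_le_one hc).2 hs.2⟩
    simpa [smul_smul, div_mul_cancel₀ _ hc.ne'] using this
  · intro h l hl
    have := h (l * c) ⟨mul_nonneg hl.1 hc.le, mul_le_of_le_one_left hc.le hl.2⟩
    simpa [smul_smul] using this

theorem inner_mirror_neg (hΩ : IsC2Domain Ω) {y v : R3} (hy : y ∈ frontier Ω) :
    inner ℝ (outwardNormal Ω y) (mirror (normalExt Ω y) v) = -inner ℝ (outwardNormal Ω y) v := by
  rw [mirror_normalExt hy, inner_reflect hΩ hy]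

/-- The boundary point and the time of a bounce are determined by its starting point: a backward ray
cannot leave `closure Ω` transversally at one boundary point and yet stay in `closure Ω` until it
reaches another one. -/
theorem injOn_preBounce (hΩ : IsC2Domain Ω) (h : ℝ) {B : Set R3} (hB : B ⊆ frontier Ω)
    (A : Set (R3 × R3)) : InjOn preBounce (bounceSet Ω h B A) := by
  have key : ∀ s y s' y' v, (s, y, v) ∈ bounceSet Ω h B A → (s', y', v) ∈ bounceSet Ω h B A →
      y + s • v = y' + s' • v → s < s' → False := by
    rintro s y s' y' v ⟨a1, a2, a3, a4, -⟩ ⟨b1, b2, b3, b4, -⟩ he hlt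
    simp only at *
    have hy := hB a2
    rw [normalExt_of_mem hy] at a3
    refine hΩ.not_mem_segSet_of_exit hy (u := -v) (c := s' - s) (by rw [inner_neg_right]; linarith)
      (by linarith) fun r hr => ?_
    have := (segSet_iff b1.1).1 b4 (s' - s - r) ⟨by linarith [hr.2], by linarith [hr.1, a1.1]⟩
    convert this using 1
    have : y = y' + (s' - s) • v := by rw [sub_smul, ← add_sub_assoc, ← he]; abel
    rw [this, sub_smul (s' - s), smul_neg]; abel
  rintro ⟨s, y, v⟩ ha ⟨s', y', v'⟩ hb he
  simp only [preBounce, Prod.mk.injEq] at he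
  obtain ⟨he, rfl⟩ := he
  rcases lt_trichotomy s s' with hlt | rfl | hlt
  · exact (key _ _ _ _ _ ha hb he hlt).elim
  · simpa using he
  · exact (key _ _ _ _ _ hb ha he.symm hlt).elim

/-- The forward ray from the end point of a bounce leaves `closure Ω` at the boundary point of the
bounce. -/
theorem postBounce_exit (hΩ : IsC2Domain Ω) {h : ℝ} {B : Set R3} (hB : B ⊆ frontier Ω)
    {A : Set (R3 × R3)} {q : ℝ × R3 × R3} (hq : q ∈ bounceSet Ω h B A) {c : ℝ} (hc : h - q.1 < c) :
    ¬ ∀ r ∈ Icc 0 c, (postBounce Ω h q).1 + r • (postBounce Ω h q).2 ∈ closure Ω := by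
  intro hcon
  obtain ⟨a1, a2, a3, a4, -⟩ := hq
  have hy := hB a2
  rw [normalExt_of_mem hy] at a3
  refine hΩ.not_mem_segSet_of_exit hy (u := mirror (normalExt Ω q.2.1) q.2.2)
    (c := c - (h - q.1)) (by rw [inner_mirror_neg hΩ hy]; linarith) (by linarith) fun r hr => ?_
  have := hcon (h - q.1 + r) ⟨by linarith [hr.1, a1.2], by linarith [hr.2]⟩
  convert this using 1
  simp only [postBounce, add_smul]
  abel

theorem injOn_postBounce (hΩ : IsC2Domain Ω) (h : ℝ) {B : Set R3} (hB : B ⊆ frontier Ω)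
    (A : Set (R3 × R3)) : InjOn (postBounce Ω h) (bounceSet Ω h B A) := by
  have key : ∀ p q, p ∈ bounceSet Ω h B A → q ∈ bounceSet Ω h B A →
      postBounce Ω h p = postBounce Ω h q → p.1 < q.1 → False := by
    intro p q hp hq he hlt
    refine postBounce_exit hΩ hB hq (c := h - p.1) (by linarith) ?_
    rw [← he]
    obtain ⟨a1, a2, a3, -, a5, -⟩ := hp
    intro r hr
    rw [← smul_neg, segSet_iff (by linarith [a1.2])] at a5
    have := a5 (h - p.1 - r) ⟨by linarith [hr.2], by linarith [hr.1]⟩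
    convert this using 1
    simp only [postBounce, smul_neg, sub_smul]
    abel
  intro p hp q hq he
  have hs : p.1 = q.1 := by
    rcases lt_trichotomy p.1 q.1 with hlt | heq | hlt
    · exact (key _ _ hp hq he hlt).elim
    · exact heq
    · exact (key _ _ hq hp he.symm hlt).elim
  simp only [postBounce, Prod.mk.injEq] at he
  obtain ⟨he1, he2⟩ := he
  have hy : p.2.1 = q.2.1 := by
    rw [he2, hs] at he1; simpa using he1
  have hv : p.2.2 = q.2.2 := by
    rw [← mirror_mirror (norm_normalExt hΩ p.2.1) p.2.2, he2, hy,
      mirror_mirror (norm_normalExt hΩ q.2.1)]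
  exact Prod.ext hs (Prod.ext hy hv)

end

section

variable {Ω : Set R3} (c : BoundaryChart Ω)

open Classical in
/-- The chart map, extended by zero to a measurable map. -/
def BoundaryChart.Θext (w : R3) : R3 := c.U.piecewise c.Θ (fun _ => 0) w

open Classical in
/-- The Jacobian factor of the chart, extended by zero to a measurable function. -/
def BoundaryChart.jext (w : R3) : ℝ := c.U.piecewise c.j (fun _ => 0) w

theorem BoundaryChart.measurable_Θext : Measurable c.Θext := by
  classical
  refine ContinuousOn.measurable_piecewise (fun w hw => ?_) continuousOn_const
    c.isOpen_U.measurableSet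
  exact (c.hasFDerivAt w hw).continuousAt.continuousWithinAt

theorem BoundaryChart.measurable_jext : Measurable c.jext := by
  classical
  exact c.continuousOn_j.measurable_piecewise continuousOn_const c.isOpen_U.measurableSet

theorem BoundaryChart.Θext_of_mem {w : R3} (hw : w ∈ c.U) : c.Θext w = c.Θ w := by
  simp [BoundaryChart.Θext, hw]

theorem BoundaryChart.jext_of_mem {w : R3} (hw : w ∈ c.U) : c.jext w = c.j w := by
  simp [BoundaryChart.jext, hw]

/-- Tube coordinates: `w = p + s e` with `p ⊥ e`, and `v`, give the time `s`, the boundary point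
`Θ p` and the velocity `v`. -/
def BoundaryChart.tube (q : R3 × R3) : ℝ × R3 × R3 :=
  (inner ℝ c.e q.1, c.Θext (planeProj c.e q.1), q.2)

/-- The density `|j ⟨n, v⟩|` of Lebesgue measure on phase space in tube coordinates. -/
def BoundaryChart.dens (q : R3 × R3) : ℝ≥0∞ :=
  ENNReal.ofReal |c.jext (planeProj c.e q.1) *
    inner ℝ (normalExt Ω (c.Θext (planeProj c.e q.1))) q.2|

theorem BoundaryChart.measurable_tube : Measurable c.tube := by
  have h1 : Measurable (fun q : R3 × R3 => (inner ℝ c.e q.1 : ℝ)) := by fun_prop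
  have h2 : Measurable (fun q : R3 × R3 => c.Θext (planeProj c.e q.1)) :=
    c.measurable_Θext.comp ((continuous_planeProj c.e).measurable.comp measurable_fst)
  exact h1.prodMk (h2.prodMk measurable_snd)

theorem BoundaryChart.measurable_dens (hΩ : IsC2Domain Ω) : Measurable c.dens := by
  have h0 : Measurable (fun q : R3 × R3 => planeProj c.e q.1) :=
    (continuous_planeProj c.e).measurable.comp measurable_fst
  have h1 : Measurable (fun q : R3 × R3 => normalExt Ω (c.Θext (planeProj c.e q.1))) :=
    (measurable_normalExt hΩ).comp (c.measurable_Θext.comp h0)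
  have h2 : Measurable (fun q : R3 × R3 =>
      (inner ℝ (normalExt Ω (c.Θext (planeProj c.e q.1))) q.2 : ℝ)) :=
    Measurable.inner (𝕜 := ℝ) h1 measurable_snd
  exact (((c.measurable_jext.comp h0).mul h2).abs).ennreal_ofReal

/-- The domain of the tube coordinates. -/
def BoundaryChart.tubeDomain : Set (R3 × R3) :=
  {q | planeProj c.e q.1 ∈ c.U ∧ c.Θ (planeProj c.e q.1) ∈ frontier Ω}

/-- The area formula in tube coordinates, applied for each fixed velocity. -/
theorem BoundaryChart.volume_image_tube (hΩ : IsC2Domain Ω) {Y : Set (R3 × R3)}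
    (hY : MeasurableSet Y) (hYd : Y ⊆ c.tubeDomain)
    (hinj : InjOn (fun q => preBounce (c.tube q)) Y) :
    volume ((fun q => preBounce (c.tube q)) '' Y) = ∫⁻ q in Y, c.dens q := by
  have hEm : Measurable (fun q => preBounce (c.tube q)) :=
    measurable_preBounce.comp c.measurable_tube
  have himg : MeasurableSet ((fun q => preBounce (c.tube q)) '' Y) :=
    hY.image_of_measurable_injOn hEm hinj
  rw [Measure.volume_eq_prod, Measure.prod_apply_symm himg, ← lintegral_indicator hY,
    lintegral_prod_symm _ ((c.measurable_dens hΩ).indicator hY).aemeasurable]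
  congr 1
  ext1 v
  set Yv : Set R3 := {w | (w, v) ∈ Y} with hYv
  have hYvm : MeasurableSet Yv := hY.preimage (measurable_id.prodMk measurable_const)
  set F : R3 → R3 := fun w => c.Θ (planeProj c.e w) + (inner ℝ c.e w : ℝ) • v with hF
  have hEF : ∀ w ∈ Yv, preBounce (c.tube (w, v)) = (F w, v) := by
    intro w hw
    simp [preBounce, BoundaryChart.tube, hF, c.Θext_of_mem (hYd hw).1]
  have h1 : (fun x => (x, v)) ⁻¹' ((fun q => preBounce (c.tube q)) '' Y) = F '' Yv := by
    ext x
    constructor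
    · rintro ⟨⟨w, v'⟩, hw, he⟩
      have : v' = v := congrArg Prod.snd he
      subst this
      refine ⟨w, hw, ?_⟩
      have h2 := hEF w hw
      simp only at he
      rw [he] at h2
      exact (congrArg Prod.fst h2).symm
    · rintro ⟨w, hw, rfl⟩
      exact ⟨(w, v), hw, hEF w hw⟩
  have hinjF : InjOn F Yv := by
    intro w hw w' hw' he
    have : preBounce (c.tube (w, v)) = preBounce (c.tube (w', v)) := by
      rw [hEF w hw, hEF w' hw', he]
    exact congrArg Prod.fst (hinj hw hw' this)
  rw [h1, ← lintegral_abs_det_fderiv_eq_addHaar_image volume hYvm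
    (fun w hw => (c.hasFDerivAt_tube (hYd hw).1 v).hasFDerivWithinAt) hinjF,
    ← lintegral_indicator hYvm]
  congr 1
  ext1 w
  by_cases hw : w ∈ Yv
  · have hw' : (w, v) ∈ Y := hw
    rw [indicator_of_mem hw, indicator_of_mem hw', c.det_eq _ (hYd hw).1 (hYd hw).2]
    simp only [BoundaryChart.dens, c.Θext_of_mem (hYd hw).1, c.jext_of_mem (hYd hw).1]
    rw [normalExt_of_mem (hYd hw).2]
  · have hw' : (w, v) ∉ Y := hw
    rw [indicator_of_notMem hw, indicator_of_notMem hw']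

/-- The reflection in tube coordinates. -/
def BoundaryChart.tubeMirror (q : R3 × R3) : R3 × R3 :=
  (q.1, mirror (normalExt Ω (c.Θext (planeProj c.e q.1))) q.2)

theorem BoundaryChart.tubeMirror_tubeMirror (hΩ : IsC2Domain Ω) (q : R3 × R3) :
    c.tubeMirror (c.tubeMirror q) = q := by
  simp only [BoundaryChart.tubeMirror]
  rw [mirror_mirror (norm_normalExt hΩ _)]

theorem BoundaryChart.measurePreserving_tubeMirror (hΩ : IsC2Domain Ω) :
    MeasurePreserving c.tubeMirror volume volume := by
  have h0 : Measurable (fun q : R3 × R3 => planeProj c.e q.1) :=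
    (continuous_planeProj c.e).measurable.comp measurable_fst
  have hm : Measurable (Function.uncurry
      (fun w v => mirror (normalExt Ω (c.Θext (planeProj c.e w))) v)) :=
    (measurable_mirror_normalExt hΩ).comp ((c.measurable_Θext.comp h0).prodMk measurable_snd)
  exact (MeasurePreserving.id (volume : Measure R3)).skew_product hm
    (Eventually.of_forall fun w => (measurePreserving_mirror (norm_normalExt hΩ _)).map_eq)

/-- The density `|j ⟨n, v⟩|` is invariant under the reflection, which only changes the sign of
`⟨n, v⟩`. -/
theorem BoundaryChart.dens_tubeMirror (hΩ : IsC2Domain Ω) (q : R3 × R3) :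
    c.dens (c.tubeMirror q) = c.dens q := by
  simp only [BoundaryChart.dens, BoundaryChart.tubeMirror]
  by_cases hy : c.Θext (planeProj c.e q.1) ∈ frontier Ω
  · have := inner_mirror_neg hΩ hy (v := q.2)
    rw [← normalExt_of_mem hy] at this
    rw [this, mul_neg, abs_neg]
  · have : normalExt Ω (c.Θext (planeProj c.e q.1)) = 0 := by simp [normalExt, hy]
    simp [this]

/-- Free transport for the time `h`, backwards. -/
def shear (h : ℝ) (q : R3 × R3) : R3 × R3 := (q.1 - h • q.2, q.2)

theorem measurePreserving_shear (h : ℝ) : MeasurePreserving (shear h) volume volume := by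
  have h1 : MeasurePreserving (fun p : R3 × R3 => (p.1, p.2 - h • p.1))
      ((volume : Measure R3).prod volume) (volume.prod volume) :=
    (MeasurePreserving.id _).skew_product (g := fun v x => x - h • v)
      (by unfold Function.uncurry; fun_prop)
      (Eventually.of_forall fun v => (measurePreserving_sub_right volume (h • v)).map_eq)
  have h2 := (Measure.measurePreserving_swap (μ := (volume : Measure R3))
    (ν := (volume : Measure R3)))
  exact h2.comp (h1.comp h2)

theorem shear_injective (h : ℝ) : Function.Injective (shear h) := by
  rintro ⟨x, v⟩ ⟨x', v'⟩ he
  simp only [shear, Prod.mk.injEq] at he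
  obtain ⟨he, rfl⟩ := he
  simpa using he

theorem volume_image_shear (h : ℝ) {S : Set (R3 × R3)} (hS : MeasurableSet S) :
    volume (shear h '' S) = volume S := by
  have hm : MeasurableSet (shear h '' S) :=
    hS.image_of_measurable_injOn (measurePreserving_shear h).measurable (shear_injective h).injOn
  rw [← (measurePreserving_shear h).measure_preimage hm.nullMeasurableSet,
    preimage_image_eq _ (shear_injective h)]

/-- A bounce at a boundary piece covered by one chart preserves Lebesgue measure: in tube
coordinates the bounce is the reflection, followed by free transport for the time `h`, and both
preserve the measure. -/
theorem BoundaryChart.volume_bounce (hΩ : IsC2Domain Ω) (h : ℝ) {B : Set R3}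
    (hB : MeasurableSet B) (hBf : B ⊆ frontier Ω) (hBV : B ⊆ c.V) {A : Set (R3 × R3)}
    (hA : MeasurableSet A) :
    volume (preBounce '' bounceSet Ω h B A) = volume (postBounce Ω h '' bounceSet Ω h B A) := by
  set Z := bounceSet Ω h B A with hZ
  set Y : Set (R3 × R3) := c.tube ⁻¹' Z ∩ {q | planeProj c.e q.1 ∈ c.U} with hYdef
  have hZm : MeasurableSet Z := measurableSet_bounceSet hΩ h hB hA
  have hPm : Measurable (fun q : R3 × R3 => planeProj c.e q.1) :=
    (continuous_planeProj c.e).measurable.comp measurable_fst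
  have hYm : MeasurableSet Y :=
    (c.measurable_tube hZm).inter (hPm c.isOpen_U.measurableSet)
  have hYd : Y ⊆ c.tubeDomain := by
    rintro q ⟨hq, hq'⟩
    refine ⟨hq', ?_⟩
    rw [← c.Θext_of_mem hq']
    exact hBf hq.2.1
  have htY : c.tube '' Y = Z := by
    ext ⟨s, y, v⟩
    constructor
    · rintro ⟨q, hq, he⟩
      rw [← he]; exact hq.1
    · intro hq
      obtain ⟨k1, k2, k3⟩ := c.mapsTo y (hBV hq.2.1) (hBf hq.2.1)
      have e1 : c.tube (c.κ y + s • c.e, v) = (s, y, v) := by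
        simp only [BoundaryChart.tube]
        rw [planeProj_add_smul c.norm_e k2, inner_add_smul_self c.norm_e k2, c.Θext_of_mem k1, k3]
      refine ⟨(c.κ y + s • c.e, v), ⟨?_, ?_⟩, e1⟩
      · rw [mem_preimage, e1]; exact hq
      · rw [mem_ofPred_eq, planeProj_add_smul c.norm_e k2]; exact k1
  have hinjt : InjOn c.tube Y := by
    rintro ⟨w, v⟩ hq ⟨w', v'⟩ hq' he
    simp only [BoundaryChart.tube, Prod.mk.injEq] at he
    obtain ⟨h1, h2, rfl⟩ := he
    rw [c.Θext_of_mem hq.2, c.Θext_of_mem hq'.2] at h2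
    have h3 : planeProj c.e w = planeProj c.e w' := by
      rw [← c.left_inv _ hq.2, h2, c.left_inv _ hq'.2]
    rw [planeProj, planeProj, h1] at h3
    simpa using h3
  set Y' := c.tubeMirror ⁻¹' Y with hY'
  have hmm := c.measurePreserving_tubeMirror hΩ
  have hY'm : MeasurableSet Y' := hmm.measurable hYm
  have hY'd : Y' ⊆ c.tubeDomain := by
    intro q hq
    have : c.tubeMirror q ∈ c.tubeDomain := hYd hq
    exact this
  have himY' : c.tubeMirror '' Y = Y' := by
    ext q
    constructor
    · rintro ⟨p, hp, rfl⟩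
      rw [hY', mem_preimage, c.tubeMirror_tubeMirror hΩ]; exact hp
    · intro hq
      exact ⟨c.tubeMirror q, hq, c.tubeMirror_tubeMirror hΩ q⟩
  -- After the free transport for the time `h`, mirrored tube coordinates give the point after the
  -- bounce.
  have hpost : ∀ q, postBounce Ω h (c.tube q) = shear h (preBounce (c.tube (c.tubeMirror q))) := by
    intro q
    simp only [postBounce, BoundaryChart.tube, shear, preBounce, BoundaryChart.tubeMirror,
      sub_smul, Prod.mk.injEq, and_true]
    abel
  have hinj1 : InjOn (fun q => preBounce (c.tube q)) Y :=
    (injOn_preBounce hΩ h hBf A).comp hinjt (fun q hq => hq.1)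
  have hinj2 : InjOn (fun q => postBounce Ω h (c.tube q)) Y :=
    (injOn_postBounce hΩ h hBf A).comp hinjt (fun q hq => hq.1)
  have hinj3 : InjOn (fun q => preBounce (c.tube q)) Y' := by
    intro q hq q' hq' he
    have h1 := hinj2 (show c.tubeMirror q ∈ Y from hq) (show c.tubeMirror q' ∈ Y from hq')
    simp only [hpost, c.tubeMirror_tubeMirror hΩ] at h1
    have h2 := h1 (by simp only at he; rw [he])
    rw [← c.tubeMirror_tubeMirror hΩ q, h2, c.tubeMirror_tubeMirror hΩ]
  have e1 : volume (preBounce '' Z) = ∫⁻ q in Y, c.dens q := by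
    rw [← htY, image_image]
    exact c.volume_image_tube hΩ hYm hYd hinj1
  have e2 : postBounce Ω h '' Z = shear h '' ((fun q => preBounce (c.tube q)) '' Y') := by
    rw [← htY, image_image, image_image, ← himY', image_image]
    simp only [hpost]
  have hm3 : MeasurableSet ((fun q => preBounce (c.tube q)) '' Y') :=
    hY'm.image_of_measurable_injOn (measurable_preBounce.comp c.measurable_tube) hinj3
  rw [e1, e2, volume_image_shear h hm3, c.volume_image_tube hΩ hY'm hY'd hinj3,
    ← lintegral_indicator hYm, ← lintegral_indicator hY'm,
    ← hmm.lintegral_comp ((c.measurable_dens hΩ).indicator hYm)]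
  congr 1
  ext1 q
  by_cases hq : c.tubeMirror q ∈ Y
  · rw [indicator_of_mem hq, indicator_of_mem (show q ∈ Y' from hq), c.dens_tubeMirror hΩ]
  · rw [indicator_of_notMem hq, indicator_of_notMem (show q ∉ Y' from hq)]

/-- The backward bounces during a time interval of length `h` do not decrease Lebesgue measure, and
they end at points whose forward ray leaves `closure Ω` before the time `h`. The latter makes these
points disjoint from those reached by free transport. -/
theorem IsC2Domain.volume_bounce_le (hΩ : IsC2Domain Ω) (h : ℝ) {A : Set (R3 × R3)}
    (hA : MeasurableSet A) :
    volume (preBounce '' bounceSet Ω h (frontier Ω) A) ≤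
      volume (A \ {q | (q.1, h • q.2) ∈ segSet Ω}) := by
  -- The boundary is covered by finitely many charts, and bounces at disjoint boundary pieces have
  -- disjoint sets of end points.
  have key : ∃ W : Set R3, IsOpen W ∧ frontier Ω ⊆ W ∧ ∀ B, MeasurableSet B → B ⊆ W →
      B ⊆ frontier Ω → volume (preBounce '' bounceSet Ω h B A) ≤
        volume (postBounce Ω h '' bounceSet Ω h B A) := by
    refine hΩ.isCompact_frontier.induction_on (p := fun S => ∃ W : Set R3, IsOpen W ∧ S ⊆ W ∧
      ∀ B, MeasurableSet B → B ⊆ W → B ⊆ frontier Ω → volume (preBounce '' bounceSet Ω h B A) ≤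
        volume (postBounce Ω h '' bounceSet Ω h B A)) ?_ ?_ ?_ ?_
    · refine ⟨∅, isOpen_empty, subset_rfl, fun B _ hB _ => ?_⟩
      have : bounceSet Ω h B A = ∅ := by
        ext q
        simp only [mem_empty_iff_false, iff_false]
        exact fun hq => hB hq.2.1
      simp [this]
    · rintro s t hst ⟨W, h1, h2, h3⟩
      exact ⟨W, h1, hst.trans h2, h3⟩
    · rintro s t ⟨W, h1, h2, h3⟩ ⟨W', h1', h2', h3'⟩
      refine ⟨W ∪ W', h1.union h1', union_subset_union h2 h2', fun B hB hBW hBf => ?_⟩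
      have hB1 : MeasurableSet (B ∩ W) := hB.inter h1.measurableSet
      have hB2 : MeasurableSet (B \ W) := hB.diff h1.measurableSet
      have i1 := h3 (B ∩ W) hB1 inter_subset_right (inter_subset_left.trans hBf)
      have i2 := h3' (B \ W) hB2 (fun y hy => (hBW hy.1).resolve_left hy.2) (sdiff_subset.trans hBf)
      have hun : bounceSet Ω h B A = bounceSet Ω h (B ∩ W) A ∪ bounceSet Ω h (B \ W) A := by
        ext q
        simp only [bounceSet, mem_union, mem_ofPred_eq, mem_inter_iff, Set.mem_sdiff]
        tauto
      have hdisj : Disjoint (bounceSet Ω h (B ∩ W) A) (bounceSet Ω h (B \ W) A) := by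
        rw [disjoint_left]
        exact fun q hq hq' => hq'.2.1.2 hq.2.1.2
      have hinj := injOn_postBounce hΩ h hBf A
      rw [hun] at hinj ⊢
      have hm2 : MeasurableSet (postBounce Ω h '' bounceSet Ω h (B \ W) A) :=
        (measurableSet_bounceSet hΩ h hB2 hA).image_of_measurable_injOn
          (measurable_postBounce hΩ h) (hinj.mono subset_union_right)
      rw [image_union, image_union, measure_union (disjoint_image_image fun p hp q hq he =>
        disjoint_left.1 hdisj hp (hinj (Or.inl hp) (Or.inr hq) he ▸ hq)) hm2]
      exact (measure_union_le _ _).trans (add_le_add i1 i2)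
    · intro y hy
      obtain ⟨c, hc⟩ := hΩ.exists_boundaryChart hy
      exact ⟨c.V, mem_nhdsWithin_of_mem_nhds (c.isOpen_V.mem_nhds hc), c.V, c.isOpen_V, subset_rfl,
        fun B hB hBV hBf => (c.volume_bounce hΩ h hB hBf hBV hA).le⟩
  obtain ⟨W, -, hW, H⟩ := key
  refine (H _ isClosed_frontier.measurableSet hW subset_rfl).trans (measure_mono ?_)
  rintro _ ⟨q, hq, rfl⟩
  refine ⟨hq.2.2.2.2.2, fun hcon => ?_⟩
  have hh : 0 < h := hq.1.1.trans hq.1.2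
  exact postBounce_exit hΩ subset_rfl hq (c := h) (by linarith [hq.1.1]) ((segSet_iff hh).1 hcon)

end

/-! ### Exit times -/

section

variable {Ω : Set R3} {x v : R3}

/-- The supremum in the definition of `t_∂` is attained, because `closure Ω` is closed. -/
theorem le_tBoundary_iff (hx : x ∈ closure Ω) {s : ℝ} (hs : 0 ≤ s) :
    ENNReal.ofReal s ≤ tBoundary Ω x v ↔ ∀ r ∈ Icc 0 s, x - r • v ∈ closure Ω := by
  constructor
  · intro h
    have hlt : ∀ r ∈ Ico 0 s, x - r • v ∈ closure Ω := by
      intro r hr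
      have h1 : ENNReal.ofReal r < tBoundary Ω x v :=
        lt_of_lt_of_le ((ENNReal.ofReal_lt_ofReal_iff (hr.1.trans_lt hr.2)).2 hr.2) h
      simp only [tBoundary, lt_iSup_iff] at h1
      obtain ⟨t, ⟨ht0, ht⟩, hrt⟩ := h1
      exact ht r ⟨hr.1, ((ENNReal.ofReal_lt_ofReal_iff_of_nonneg hr.1).1 hrt).le⟩
    rcases hs.eq_or_lt with rfl | hs0
    · intro r hr
      have : r = 0 := le_antisymm hr.2 hr.1
      simpa [this] using hx
    · have hc : IsClosed {r : ℝ | x - r • v ∈ closure Ω} := isClosed_closure.preimage (by fun_prop)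
      have := hc.closure_subset_iff.2 (show Ico 0 s ⊆ _ from hlt)
      rwa [closure_Ico hs0.ne] at this
  · intro h
    exact le_iSup₂_of_le s ⟨hs, h⟩ le_rfl

theorem tBoundary_sub_smul (hx : x ∈ closure Ω) {s σ : ℝ} (hs : 0 ≤ s) (hsσ : s ≤ σ)
    (h : tBoundary Ω x v = ENNReal.ofReal σ) :
    tBoundary Ω (x - s • v) v = ENNReal.ofReal (σ - s) := by
  have hσ := (le_tBoundary_iff hx (hs.trans hsσ)).1 h.ge
  have hxs : x - s • v ∈ closure Ω := hσ s ⟨hs, hsσ⟩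
  refine le_antisymm ?_ ?_
  · by_contra hcon
    push Not at hcon
    simp only [tBoundary, lt_iSup_iff] at hcon
    obtain ⟨t, ⟨ht0, ht⟩, hrt⟩ := hcon
    have hlt := (ENNReal.ofReal_lt_ofReal_iff_of_nonneg (by linarith)).1 hrt
    have : ENNReal.ofReal (s + t) ≤ tBoundary Ω x v := by
      rw [le_tBoundary_iff hx (by linarith)]
      intro r hr
      rcases le_total r s with hrs | hrs
      · exact hσ r ⟨hr.1, hrs.trans hsσ⟩
      · have := ht (r - s) ⟨by linarith, by linarith [hr.2]⟩
        rwa [sub_sub, ← add_smul, add_sub_cancel] at this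
    rw [h, ENNReal.ofReal_le_ofReal_iff (by linarith)] at this
    linarith
  · rw [le_tBoundary_iff hxs (by linarith)]
    intro r hr
    have := hσ (s + r) ⟨by linarith [hr.1], by linarith [hr.2]⟩
    rwa [add_smul, ← sub_sub] at this

/-- A backward ray leaves `closure Ω` at a boundary point, where its velocity is either incoming or
belongs to the stop set. -/
theorem IsC2Domain.exit_point (hΩ : IsC2Domain Ω) (hx : x ∈ closure Ω) {σ : ℝ} (hσ : 0 ≤ σ)
    (h : tBoundary Ω x v = ENNReal.ofReal σ) :
    x - σ • v ∈ frontier Ω ∧ tBoundary Ω (x - σ • v) v = 0 ∧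
      (inner ℝ (outwardNormal Ω (x - σ • v)) v < 0 ∨ (x - σ • v, v) ∈ stopSet Ω) := by
  have hcl : x - σ • v ∈ closure Ω := (le_tBoundary_iff hx hσ).1 h.ge σ ⟨hσ, le_rfl⟩
  have h0 : tBoundary Ω (x - σ • v) v = 0 := by
    rw [tBoundary_sub_smul hx hσ le_rfl h]; simp
  have hex : ∀ δ > 0, ∃ s ∈ Ioo (0 : ℝ) δ, x - σ • v - s • v ∉ closure Ω := by
    intro δ hδ
    by_contra hcon
    push Not at hcon
    have : ENNReal.ofReal (δ / 2) ≤ tBoundary Ω (x - σ • v) v := by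
      rw [le_tBoundary_iff hcl (by positivity)]
      intro r hr
      rcases hr.1.eq_or_lt with rfl | hr0
      · simpa using hcl
      · exact hcon r ⟨hr0, by linarith [hr.2]⟩
    rw [h0, nonpos_iff_eq_zero, ENNReal.ofReal_eq_zero] at this
    linarith
  have key : ∀ {w : R3}, (∀ᶠ s in 𝓝[>] (0 : ℝ), w - s • v ∈ Ω) →
      ¬ ∀ δ > 0, ∃ s ∈ Ioo (0 : ℝ) δ, w - s • v ∉ closure Ω := by
    intro w hw hcon
    obtain ⟨δ, hδ, hsub⟩ := mem_nhdsGT_iff_exists_Ioo_subset.1 hw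
    obtain ⟨s, hs, hs'⟩ := hcon δ hδ
    exact hs' (subset_closure (hsub hs))
  have hf : x - σ • v ∈ frontier Ω := by
    rcases hΩ.mem_or_mem_frontier hcl with hin | hf
    · exfalso
      refine key ?_ hex
      have : Continuous (fun s : ℝ => x - σ • v - s • v) := by fun_prop
      have h1 : ∀ᶠ s in 𝓝 (0 : ℝ), x - σ • v - s • v ∈ Ω :=
        this.continuousAt.eventually (hΩ.isOpen.mem_nhds (by simpa using hin))
      exact h1.filter_mono nhdsWithin_le_nhds
    · exact hf
  refine ⟨hf, h0, ?_⟩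
  rcases lt_trichotomy (inner ℝ (outwardNormal Ω (x - σ • v)) v) 0 with hlt | heq | hgt
  · exact Or.inl hlt
  · exact Or.inr ⟨⟨hf, heq⟩, hex⟩
  · exact (key (hΩ.eventually_mem hf hgt) hex).elim

/-- Backward rays of outgoing velocity that stay in `closure Ω` only for a short time are almost
tangential. -/
theorem IsC2Domain.exists_short_chord (hΩ : IsC2Domain Ω) :
    ∃ ε > 0, ∃ C > 0, ∀ y ∈ frontier Ω, ∀ v : R3, ∀ h : ℝ, 0 < h → h * ‖v‖ ≤ ε →
      C * h * ‖v‖ ^ 2 < inner ℝ (outwardNormal Ω y) v → ∀ r ∈ Icc 0 h, y - r • v ∈ closure Ω := by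
  obtain ⟨ε, hε, C, hC, H⟩ := hΩ.exists_chord_bound
  refine ⟨ε, hε, C, hC, fun y hy v h hh hhv hv r hr => ?_⟩
  rcases hr.1.eq_or_lt with rfl | hr0
  · simpa using frontier_subset_closure hy
  · refine subset_closure (H y hy v r hr0 (le_trans ?_ hhv) (lt_of_le_of_lt ?_ hv))
    · gcongr; exact hr.2
    · gcongr; exact hr.2

end

/-! ### Duhamel's formula -/

section

theorem expNeg_zero : expNeg 0 = 1 := by simp [expNeg]

theorem expNeg_le_one (a : ℝ≥0∞) : expNeg a ≤ 1 := by
  unfold expNeg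
  split_ifs
  · exact zero_le_one
  · rw [← ENNReal.ofReal_one]
    exact ENNReal.ofReal_le_ofReal (Real.exp_le_one_iff.2 (by simp))

theorem expNeg_add (a b : ℝ≥0∞) : expNeg (a + b) = expNeg a * expNeg b := by
  by_cases ha : a = ∞
  · simp [expNeg, ha]
  by_cases hb : b = ∞
  · simp [expNeg, hb]
  rw [expNeg, expNeg, expNeg, if_neg ha, if_neg hb, if_neg (ENNReal.add_ne_top.2 ⟨ha, hb⟩),
    ENNReal.toReal_add ha hb, neg_add, Real.exp_add, ENNReal.ofReal_mul (Real.exp_pos _).le]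

theorem ofReal_exp_le_expNeg {a : ℝ≥0∞} {r : ℝ} (hr : 0 ≤ r) (h : a ≤ ENNReal.ofReal r) :
    ENNReal.ofReal (Real.exp (-r)) ≤ expNeg a := by
  have ha : a ≠ ∞ := ne_top_of_le_ne_top ENNReal.ofReal_ne_top h
  rw [expNeg, if_neg ha]
  refine ENNReal.ofReal_le_ofReal (Real.exp_le_exp.2 (neg_le_neg ?_))
  exact ENNReal.toReal_le_of_le_ofReal hr h

variable {Ω : Set R3} {Φ b : ℝ → ℝ} {f : ℝ → R3 → R3 → ℝ} {X : ℝ → R3} {v : R3} {s a t : ℝ}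

theorem setLIntegral_Ioc_add (g : ℝ → ℝ≥0∞) (h1 : s ≤ a) (h2 : a ≤ t) :
    ∫⁻ r in Ioc s t, g r = (∫⁻ r in Ioc s a, g r) + ∫⁻ r in Ioc a t, g r := by
  rw [← Ioc_union_Ioc_eq_Ioc h1 h2, lintegral_union measurableSet_Ioc]
  exact Ioc_disjoint_Ioc_of_le le_rfl

theorem damping_self : damping Φ b f X v t t = 1 := by simp [damping, expNeg_zero]

theorem damping_mul (h1 : s ≤ a) (h2 : a ≤ t) :
    damping Φ b f X v s t = damping Φ b f X v s a * damping Φ b f X v a t := by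
  rw [damping, setLIntegral_Ioc_add _ h1 h2, expNeg_add]; rfl

theorem gain_self : gain Φ b f X v t t = 0 := by simp [gain]

theorem gain_add (h1 : s ≤ a) (h2 : a ≤ t) :
    gain Φ b f X v s t = gain Φ b f X v s a * damping Φ b f X v a t + gain Φ b f X v a t := by
  rw [gain, setLIntegral_Ioc_add _ h1 h2]
  congr 1
  rw [gain, ← lintegral_mul_const' (damping Φ b f X v a t) _
    (ne_top_of_le_ne_top ENNReal.one_ne_top (expNeg_le_one _))]
  refine setLIntegral_congr_fun measurableSet_Ioc fun r hr => ?_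
  rw [damping_mul hr.2 h2, mul_right_comm]

theorem damping_lower (hat : a ≤ t) {l : ℝ} (hl : 0 ≤ l)
    (hL : ∀ r ∈ Ioc a t, Lloss Φ b (f r (X r)) v ≤ ENNReal.ofReal l) :
    ENNReal.ofReal (Real.exp (-(l * (t - a)))) ≤ damping Φ b f X v a t := by
  refine ofReal_exp_le_expNeg (mul_nonneg hl (by linarith)) ?_
  calc ∫⁻ r in Ioc a t, Lloss Φ b (f r (X r)) v ≤ ∫⁻ _ in Ioc a t, ENNReal.ofReal l :=
        setLIntegral_mono' measurableSet_Ioc hL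
    _ = ENNReal.ofReal (l * (t - a)) := by
        rw [setLIntegral_const, Real.volume_Ioc, ENNReal.ofReal_mul hl]

theorem gain_lower {l q : ℝ} (hl : 0 ≤ l) (hq : 0 ≤ q)
    (hL : ∀ r ∈ Ioc a t, Lloss Φ b (f r (X r)) v ≤ ENNReal.ofReal l)
    (hQ : ∀ r ∈ Ioc a t, ENNReal.ofReal q ≤ Qplus Φ b (f r (X r)) (f r (X r)) v) :
    ENNReal.ofReal (Real.exp (-(l * (t - a))) * (q * (t - a))) ≤ gain Φ b f X v a t := by
  calc ENNReal.ofReal (Real.exp (-(l * (t - a))) * (q * (t - a)))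
      = ∫⁻ _ in Ioc a t, ENNReal.ofReal (Real.exp (-(l * (t - a)))) * ENNReal.ofReal q := by
        rw [setLIntegral_const, Real.volume_Ioc, ← ENNReal.ofReal_mul (Real.exp_pos _).le,
          ← ENNReal.ofReal_mul (by positivity), mul_assoc]
    _ ≤ gain Φ b f X v a t := by
        refine setLIntegral_mono' measurableSet_Ioc fun r hr => ?_
        refine mul_le_mul' ?_ (hQ r hr)
        refine le_trans (ENNReal.ofReal_le_ofReal (Real.exp_le_exp.2 ?_))
          (damping_lower hr.2 hl fun r' hr' => hL r' ⟨hr.1.trans hr'.1, hr'.2⟩)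
        have := hr.1
        gcongr

variable {α TB T : ℝ} {f₀ : R3 → R3 → ℝ} {x : R3}

theorem ray_ray (t a : ℝ) (x v : R3) : ray a (ray t x v a) v = ray t x v := by
  funext r
  simp only [ray, sub_sub, ← add_smul]
  congr 2
  ring

/-- Duhamel's formula between two times `a ≤ t` along a backward ray inside `closure Ω`. The
equations of the definition reach back to the time `0` or to the boundary; the formula follows by
comparing them at `(t, x)` and at the earlier point of the ray. -/
theorem IsContinuousMildSolution.duhamel (hf : IsContinuousMildSolution Ω Φ b α TB T f₀ f)
    (ht : t ∈ Ico 0 T) (hx : x ∈ closure Ω) (ha : 0 ≤ a) (hat : a ≤ t)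
    (hray : ∀ r ∈ Icc 0 (t - a), x - r • v ∈ closure Ω) :
    ENNReal.ofReal (f t x v) = ENNReal.ofReal (f a (ray t x v a) v) *
      damping Φ b f (ray t x v) v a t + gain Φ b f (ray t x v) v a t := by
  have hXa : ray t x v a ∈ closure Ω := hray (t - a) ⟨by linarith, le_rfl⟩
  have haT : a ∈ Ico 0 T := ⟨ha, hat.trans_lt ht.2⟩
  rcases le_total (ENNReal.ofReal t) (tBoundary Ω x v) with h | h
  · have h' : ENNReal.ofReal a ≤ tBoundary Ω (ray t x v a) v := by
      rw [le_tBoundary_iff hXa ha]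
      rw [le_tBoundary_iff hx ht.1] at h
      intro r hr
      have := h (t - a + r) ⟨by linarith [hr.1], by linarith [hr.2]⟩
      rwa [add_smul, ← sub_sub] at this
    have e1 := hf.duhamel_initial t ht x hx v h
    have e2 := hf.duhamel_initial a haT _ hXa v h'
    rw [ray_ray] at e2
    rw [e1, e2, damping_mul ha hat, gain_add ha hat, add_mul, mul_assoc, add_assoc]
  · have hfin : tBoundary Ω x v ≠ ∞ := ne_top_of_le_ne_top ENNReal.ofReal_ne_top h
    set σ := (tBoundary Ω x v).toReal with hσ
    have hσ' : tBoundary Ω x v = ENNReal.ofReal σ := (ENNReal.ofReal_toReal hfin).symm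
    have hσt : σ ≤ t := ENNReal.toReal_le_of_le_ofReal ht.1 h
    have h1 : t - a ≤ σ := by
      rw [← ENNReal.ofReal_le_ofReal_iff ENNReal.toReal_nonneg, ← hσ',
        le_tBoundary_iff hx (by linarith)]
      exact hray
    have h2 := tBoundary_sub_smul hx (by linarith) h1 hσ'
    have h3 : tBoundary Ω (ray t x v a) v = ENNReal.ofReal (σ - (t - a)) := h2
    have e1 := hf.duhamel_boundary t ht x hx v h _ _ rfl rfl
    have e2 := hf.duhamel_boundary a haT _ hXa v (by
      rw [h3]; exact ENNReal.ofReal_le_ofReal (by linarith)) (t - σ) _ (by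
      rw [h3, ENNReal.toReal_ofReal (by linarith)]; ring) rfl
    rw [ray_ray] at e2
    rw [e1, e2, ← hσ, damping_mul (s := t - σ) (a := a) (by linarith) hat,
      gain_add (s := t - σ) (a := a) (by linarith) hat]
    ring

/-- Lower bound along a ray, for a collision frequency `≤ l` and a gain term `≥ q`. -/
theorem IsContinuousMildSolution.lower_of_ray (hf : IsContinuousMildSolution Ω Φ b α TB T f₀ f)
    (ht : t ∈ Ico 0 T) (hx : x ∈ closure Ω) (ha : 0 ≤ a) (hat : a ≤ t)
    (hray : ∀ r ∈ Icc 0 (t - a), x - r • v ∈ closure Ω) {l q : ℝ} (hl : 0 ≤ l) (hq : 0 ≤ q)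
    (hL : ∀ r ∈ Ioc a t, Lloss Φ b (f r (ray t x v r)) v ≤ ENNReal.ofReal l)
    (hQ : ∀ r ∈ Ioc a t, ENNReal.ofReal q ≤
      Qplus Φ b (f r (ray t x v r)) (f r (ray t x v r)) v) :
    Real.exp (-(l * (t - a))) * (f a (ray t x v a) v + q * (t - a)) ≤ f t x v := by
  have hXa : ray t x v a ∈ closure Ω := hray (t - a) ⟨by linarith, le_rfl⟩
  have h0 : 0 ≤ f a (ray t x v a) v := hf.nonneg a ⟨ha, hat.trans_lt ht.2⟩ _ hXa v
  rw [← ENNReal.ofReal_le_ofReal_iff (hf.nonneg t ht x hx v), hf.duhamel ht hx ha hat hray,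
    mul_add, ENNReal.ofReal_add (by positivity)
      (mul_nonneg (Real.exp_pos _).le (mul_nonneg hq (by linarith)))]
  refine add_le_add ?_ (gain_lower hl hq hL hQ)
  rw [mul_comm, ENNReal.ofReal_mul h0]
  gcongr
  exact damping_lower hat hl hL

/-- The specular boundary condition at points from which the backward ray leaves at once. -/
theorem IsContinuousMildSolution.eq_reflect (hf : IsContinuousMildSolution Ω Φ b 1 TB T f₀ f)
    (ht : t ∈ Ico 0 T) (hx : x ∈ frontier Ω) (h0 : tBoundary Ω x v = 0) :
    f t x v = f t x (reflect Ω x v) := by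
  have hxc := frontier_subset_closure hx
  have e := hf.duhamel_boundary t ht x hxc v (by rw [h0]; exact bot_le) t x (by simp [h0])
    (by simp [ray])
  rw [damping_self, gain_self] at e
  simp only [ENNReal.ofReal_one, one_mul, mul_one, sub_self, ENNReal.ofReal_zero, zero_mul,
    add_zero] at e
  rwa [ENNReal.ofReal_eq_ofReal_iff (hf.nonneg t ht x hxc v) (hf.nonneg t ht x hxc _)] at e

/-- The diffuse part of the boundary condition alone gives a lower bound. -/
theorem IsContinuousMildSolution.diffuse_le (hf : IsContinuousMildSolution Ω Φ b α TB T f₀ f)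
    (ht : t ∈ Ico 0 T) (hx : x ∈ frontier Ω) (h0 : tBoundary Ω x v = 0) :
    ENNReal.ofReal (1 - α) * outflux Ω x (f t x) * ENNReal.ofReal (wallMaxwellian TB v) ≤
      ENNReal.ofReal (f t x v) := by
  have e := hf.duhamel_boundary t ht x (frontier_subset_closure hx) v (by rw [h0]; exact bot_le)
    t x (by simp [h0]) (by simp [ray])
  rw [damping_self, gain_self, mul_one, mul_one, add_zero] at e
  rw [e]
  exact le_add_self

/-- Lower bound along the resting characteristic at the stop set. -/
theorem IsContinuousMildSolution.lower_of_mem_stopSet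
    (hf : IsContinuousMildSolution Ω Φ b 1 TB T f₀ f)
    (ht : t ∈ Ico 0 T) (hx : (x, v) ∈ stopSet Ω) (ha : 0 ≤ a) (hat : a ≤ t)
    {l q : ℝ} (hl : 0 ≤ l) (hq : 0 ≤ q)
    (hL : ∀ r ∈ Ioc a t, Lloss Φ b (f r x) v ≤ ENNReal.ofReal l)
    (hQ : ∀ r ∈ Ioc a t, ENNReal.ofReal q ≤ Qplus Φ b (f r x) (f r x) v) :
    Real.exp (-(l * (t - a))) * (q * (t - a)) ≤ f t x v := by
  rw [← ENNReal.ofReal_le_ofReal_iff (hf.nonneg t ht x (frontier_subset_closure hx.1.1) v),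
    hf.duhamel_stop rfl t ht x v hx, gain_add ha hat]
  exact (gain_lower hl hq hL hQ).trans (le_add_self.trans le_add_self)

end

/-! ### Upper bounds for the collision frequency -/

theorem lintegral_ball_rpow_lt_top {E : Type*} [NormedAddCommGroup E] [NormedSpace ℝ E]
    [Nontrivial E] [FiniteDimensional ℝ E] [MeasurableSpace E] [BorelSpace E] (μ : Measure E)
    [μ.IsAddHaarMeasure] {r : ℝ} (hr : -(Module.finrank ℝ E : ℝ) < r) :
    ∫⁻ x in Metric.ball 0 1, ENNReal.ofReal (‖x‖ ^ r) ∂μ < ∞ := by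
  have hpos : 0 < Module.finrank ℝ E := Module.finrank_pos
  have h1 : IntegrableOn (fun x : E => ‖x‖ ^ r) (Metric.ball 0 1) μ := by
    refine (integrableOn_fun_norm_addHaar μ (f := fun y : ℝ => y ^ r)).2 ?_
    have h2 : IntegrableOn (fun y : ℝ => y ^ ((Module.finrank ℝ E : ℝ) - 1 + r)) (Ioo 0 1) := by
      rw [← integrableOn_Ioc_iff_integrableOn_Ioo]
      exact (intervalIntegral.intervalIntegrable_rpow' (by linarith)).1
    refine h2.congr_fun (fun y hy => ?_) measurableSet_Ioo
    simp only [smul_eq_mul]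
    rw [Real.rpow_add hy.1, ← Real.rpow_natCast, Nat.cast_sub hpos, Nat.cast_one]
  have h3 := h1.2
  rw [hasFiniteIntegral_iff_enorm] at h3
  refine lt_of_le_of_lt (lintegral_mono fun x => ?_) h3
  rw [← ofReal_norm]
  exact ENNReal.ofReal_le_ofReal (le_abs_self _)

/-- An orthonormal basis whose third vector is a given unit vector. -/
theorem exists_orthonormalBasis (k : R3) (hk : ‖k‖ = 1) :
    ∃ B : OrthonormalBasis (Fin 3) ℝ R3, B 2 = k := by
  have h : Orthonormal ℝ (({2} : Set (Fin 3)).domRestrict (fun _ => k)) := by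
    refine ⟨fun i => hk, fun i j hij => ?_⟩
    exact (hij (Subtype.ext (i.2.trans j.2.symm))).elim
  obtain ⟨B, hB⟩ := h.exists_orthonormalBasis_extension_of_card_eq (by simp)
  exact ⟨B, hB 2 rfl⟩

/-- Integrals over the unit sphere as integrals of radially constant functions over the unit ball;
`1 / 3` is `∫₀¹ r² dr`. -/
theorem lintegral_sphere_eq (F : Metric.sphere (0 : R3) 1 → ℝ≥0∞) (hF : Measurable F) :
    (∫⁻ s, F s ∂(volume : Measure R3).toSphere) * ENNReal.ofReal (1 / 3) =
      ∫⁻ q : ({0}ᶜ : Set R3), (if ‖(q : R3)‖ < 1 then F (homeomorphUnitSphereProd R3 q).1 else 0)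
        ∂((volume : Measure R3).comap (↑)) := by
  have h := (volume : Measure R3).measurePreserving_homeomorphUnitSphereProd
  set G : Metric.sphere (0 : R3) 1 × Ioi (0 : ℝ) → ℝ≥0∞ := fun p =>
    F p.1 * (Iio (⟨1, mem_Ioi.2 one_pos⟩ : Ioi (0 : ℝ))).indicator 1 p.2 with hG
  have hGm : Measurable G := (hF.comp measurable_fst).mul
    ((measurable_one.indicator measurableSet_Iio).comp measurable_snd)
  have e : ∀ q : ({0}ᶜ : Set R3), (if ‖(q : R3)‖ < 1 then F (homeomorphUnitSphereProd R3 q).1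
      else 0) = G (homeomorphUnitSphereProd R3 q) := by
    intro q
    rw [hG]
    simp only [indicator_apply, mem_Iio, ← Subtype.coe_lt_coe,
        homeomorphUnitSphereProd_apply_snd_coe,
      Pi.one_apply, mul_ite, mul_one, mul_zero]
  simp_rw [e]
  rw [h.lintegral_comp hGm, lintegral_prod_mul hF.aemeasurable
    (measurable_one.indicator measurableSet_Iio).aemeasurable,
    lintegral_indicator_one measurableSet_Iio,
    Measure.volumeIoiPow_apply_Iio]
  congr 2
  simp
  norm_num

theorem volume_map_coords (B : OrthonormalBasis (Fin 3) ℝ R3) :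
    MeasurePreserving (fun x : R3 => (fun i => B.repr x i : Fin 3 → ℝ)) volume volume :=
  (EuclideanSpace.volume_preserving_symm_measurableEquiv_toLp (Fin 3)).comp
    B.measurePreserving_repr

theorem ennreal_rpow_anti {a b : ℝ≥0∞} {z : ℝ} (hz : z ≤ 0) (h : a ≤ b) : b ^ z ≤ a ^ z := by
  have e : ∀ c : ℝ≥0∞, c ^ z = (c ^ (-z))⁻¹ := fun c => by rw [← ENNReal.rpow_neg, neg_neg]
  rw [e, e, ENNReal.inv_le_inv]
  exact ENNReal.rpow_le_rpow h (by linarith)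

theorem lintegral_pi_three {a b c : ℝ → ℝ≥0∞} (ha : Measurable a) (hb : Measurable b)
    (hc : Measurable c) : ∫⁻ y : Fin 3 → ℝ, a (y 0) * b (y 1) * c (y 2) =
      (∫⁻ t, a t) * (∫⁻ t, b t) * ∫⁻ t, c t := by
  have h1 := volume_preserving_piFinSuccAbove (fun _ : Fin 3 => ℝ) 2
  have h2 := volume_preserving_finTwoArrow ℝ
  have e1 : ∫⁻ y : Fin 3 → ℝ, a (y 0) * b (y 1) * c (y 2) =
      ∫⁻ p : ℝ × (Fin 2 → ℝ), c p.1 * (a (p.2 0) * b (p.2 1)) := by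
    rw [← h1.lintegral_comp
      (f := fun p : ℝ × (Fin 2 → ℝ) => c p.1 * (a (p.2 0) * b (p.2 1))) (by fun_prop)]
    refine lintegral_congr fun y => ?_
    rw [mul_comm]
    rfl
  have e2 : ∫⁻ z : Fin 2 → ℝ, a (z 0) * b (z 1) = (∫⁻ t, a t) * ∫⁻ t, b t := by
    rw [← lintegral_prod_mul ha.aemeasurable hb.aemeasurable, ← Measure.volume_eq_prod,
      ← h2.lintegral_comp (f := fun p : ℝ × ℝ => a p.1 * b p.2) (by fun_prop)]
    rfl
  rw [e1, Measure.volume_eq_prod, lintegral_prod_mul hc.aemeasurable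
    (g := fun z : Fin 2 → ℝ => a (z 0) * b (z 1)) (by fun_prop), e2, mul_comm]

/-- The functions `|σ₀ σ₁| ^ (β - 1)` are integrable on the sphere. They are homogeneous of negative
degree, so that their integral is controlled by the integral over the unit ball, hence over the cube
`[-1, 1]³`, where the variables separate. -/
theorem lintegral_sphere_coords_lt_top {β : ℝ} (hβ : 0 < β) (hβ1 : β < 1) :
    ∃ C : ℝ≥0∞, C < ∞ ∧ ∀ B : OrthonormalBasis (Fin 3) ℝ R3,
      ∫⁻ s : Metric.sphere (0 : R3) 1, ENNReal.ofReal (|B.repr s 0|) ^ (β - 1) *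
        ENNReal.ofReal (|B.repr s 1|) ^ (β - 1) ∂(volume : Measure R3).toSphere ≤ C := by
  set g : ℝ → ℝ≥0∞ := fun t => (Icc (-1) 1).indicator
    (fun t => ENNReal.ofReal |t| ^ (β - 1)) t with hg
  have hgm : Measurable g := by
    refine Measurable.indicator ?_ measurableSet_Icc
    fun_prop
  set D := ∫⁻ t, g t with hD
  have hDfin : D < ∞ := by
    have h1 := lintegral_ball_rpow_lt_top (E := ℝ) volume (r := β - 1) (by simp; linarith)
    rw [hD, hg, lintegral_indicator measurableSet_Icc]
    have h2 : Icc (-1 : ℝ) 1 =ᵐ[volume] Metric.ball 0 1 := by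
      rw [Real.ball_eq_Ioo]; simpa using Ioo_ae_eq_Icc.symm
    rw [Measure.restrict_congr_set h2]
    refine lt_of_le_of_lt (le_of_eq (lintegral_congr_ae ?_)) h1
    have h3 : ∀ᵐ t : ℝ ∂(volume.restrict (Metric.ball (0 : ℝ) 1)), t ≠ 0 :=
      ae_restrict_of_ae (Measure.ae_ne volume 0)
    filter_upwards [h3] with t ht
    rw [ENNReal.ofReal_rpow_of_pos (abs_pos.2 ht), Real.norm_eq_abs]
  set g' : ℝ → ℝ≥0∞ := (Icc (-1) 1).indicator 1 with hg'
  have hg'm : Measurable g' := measurable_one.indicator measurableSet_Icc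
  have hD' : ∫⁻ t, g' t = 2 := by
    rw [hg', lintegral_indicator_one measurableSet_Icc, Real.volume_Icc]; norm_num
  refine ⟨D * D * 2 * (ENNReal.ofReal (1 / 3))⁻¹, ?_, fun B => ?_⟩
  · refine ENNReal.mul_lt_top (ENNReal.mul_lt_top (ENNReal.mul_lt_top hDfin hDfin) (by simp)) ?_
    rw [ENNReal.inv_lt_top]; simp
  have hBm : ∀ i, Measurable (fun x : R3 => B.repr x i) := fun i => by fun_prop
  have hFm : Measurable (fun s : Metric.sphere (0 : R3) 1 =>
      ENNReal.ofReal (|B.repr s 0|) ^ (β - 1) * ENNReal.ofReal (|B.repr s 1|) ^ (β - 1)) := by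
    have h0 := (hBm 0).comp (measurable_subtype_coe (p := (· ∈ Metric.sphere (0 : R3) 1)))
    have h1 := (hBm 1).comp (measurable_subtype_coe (p := (· ∈ Metric.sphere (0 : R3) 1)))
    simp only [Function.comp_def] at h0 h1
    fun_prop
  rw [← div_eq_mul_inv, ENNReal.le_div_iff_mul_le (by simp) (by simp), lintegral_sphere_eq _ hFm]
  calc _ ≤ ∫⁻ q : ({0}ᶜ : Set R3), g (B.repr q 0) * g (B.repr q 1) * g' (B.repr q 2)
        ∂((volume : Measure R3).comap (↑)) := by
        refine lintegral_mono fun q => ?_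
        simp only
        split_ifs with hq
        swap
        · exact bot_le
        have hq0 : 0 < ‖(q : R3)‖ := norm_pos_iff.2 q.2
        have hi : ∀ i, |B.repr q i| ≤ 1 := fun i => by
          have := PiLp.norm_apply_le (B.repr q) i
          rw [Real.norm_eq_abs, B.repr.norm_map] at this
          linarith
        have hmem : ∀ i, B.repr q i ∈ Icc (-1 : ℝ) 1 := fun i => abs_le.1 (hi i)
        have hco : ∀ i, |B.repr (homeomorphUnitSphereProd R3 q).1 i| =
            ‖(q : R3)‖⁻¹ * |B.repr q i| := by
          intro i
          rw [homeomorphUnitSphereProd_apply_fst_coe]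
          simp [abs_mul]
        have hle : ∀ i, ENNReal.ofReal |B.repr (homeomorphUnitSphereProd R3 q).1 i| ^ (β - 1) ≤
            g (B.repr q i) := by
          intro i
          rw [hg]
          simp only [indicator_of_mem (hmem i)]
          refine ennreal_rpow_anti (by linarith) (ENNReal.ofReal_le_ofReal ?_)
          rw [hco]
          exact le_mul_of_one_le_left (abs_nonneg _) ((one_le_inv₀ hq0).2 hq.le)
        have : g' (B.repr q 2) = 1 := by rw [hg', indicator_of_mem (hmem 2)]; rfl
        rw [this, mul_one]
        exact mul_le_mul' (hle 0) (hle 1)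
    _ = ∫⁻ x : R3 in {0}ᶜ, g (B.repr x 0) * g (B.repr x 1) * g' (B.repr x 2) := by
        rw [lintegral_subtype_comap (measurableSet_singleton _).compl
          (fun x : R3 => g (B.repr x 0) * g (B.repr x 1) * g' (B.repr x 2))]
    _ ≤ ∫⁻ x : R3, g (B.repr x 0) * g (B.repr x 1) * g' (B.repr x 2) :=
        setLIntegral_le_lintegral _ _
    _ = ∫⁻ y : Fin 3 → ℝ, g (y 0) * g (y 1) * g' (y 2) := by
        rw [← (volume_map_coords B).lintegral_comp (f := fun y => g (y 0) * g (y 1) * g' (y 2))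
          (by fun_prop)]
    _ = D * D * 2 := by rw [lintegral_pi_three hgm hgm hg'm, ← hD, hD']

/-- Near `θ = 0` the angular factor is of the order `θ ^ (-2 - ν)`, which is integrable on the
sphere since `ν < 0`. The exponent is replaced by a smaller one, of the form `2 (β - 1)` with
`0 < β < 1`. -/
theorem IsAngularFactor.exists_power_bound {b : ℝ → ℝ} {ν b₀ : ℝ} (hb : IsAngularFactor b ν b₀)
    (hν : ν < 0) : ∃ β ∈ Ioo (0 : ℝ) 1, ∃ C > 0, ∀ θ ∈ Ioc 0 Real.pi,
      b (Real.cos θ) ≤ C * θ ^ (2 * (β - 1)) := by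
  obtain ⟨β, hβ0, hβ1, hβν⟩ : ∃ β : ℝ, 0 < β ∧ β < 1 ∧ 2 * β ≤ -ν :=
    ⟨min (-ν / 2) (1 / 2), lt_min (by linarith) (by norm_num),
      (min_le_right _ _).trans_lt (by norm_num), by linarith [min_le_left (-ν / 2) (1 / 2)]⟩
  have h1 : ∀ᶠ θ in 𝓝[>] (0 : ℝ), b (Real.cos θ) * Real.sin θ / θ ^ (-(1 + ν)) < |b₀| + 1 :=
    hb.asymptotics.eventually_lt_const (by linarith [le_abs_self b₀])
  obtain ⟨δ, hδ, hsub⟩ := mem_nhdsGT_iff_exists_Ioo_subset.1 h1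
  set δ' := min (δ / 2) 1 with hδ'
  have hδ'0 : 0 < δ' := lt_min (half_pos hδ) one_pos
  have hcomp : IsCompact (Icc δ' Real.pi) := isCompact_Icc
  obtain ⟨C₁, hC₁⟩ := hcomp.bddAbove_image (hb.continuousOn.mono fun θ hθ =>
    ⟨hδ'0.trans_le hθ.1, hθ.2⟩)
  set C₂ := (|b₀| + 1) * (Real.pi / 2) with hC₂
  have hC₂0 : 0 < C₂ := by positivity
  set C₃ := |C₁| / Real.pi ^ (2 * (β - 1)) with hC₃
  have hC₃0 : 0 ≤ C₃ := by positivity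
  refine ⟨β, ⟨hβ0, hβ1⟩, C₂ + C₃, by positivity, fun θ hθ => ?_⟩
  have hpos : 0 < θ ^ (2 * (β - 1)) := Real.rpow_pos_of_pos hθ.1 _
  rcases lt_or_ge θ δ' with hlt | hge
  · have hθδ : θ ∈ Ioo 0 δ := ⟨hθ.1, hlt.trans_le ((min_le_left _ _).trans
      (by linarith [mem_Ioi.1 hδ]))⟩
    have hθ1 : θ ≤ 1 := hlt.le.trans (min_le_right _ _)
    have h2 := hsub hθδ
    simp only [mem_ofPred_eq] at h2
    have hp2 : 0 < θ ^ (-(1 + ν)) := Real.rpow_pos_of_pos hθ.1 _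
    rw [div_lt_iff₀ hp2] at h2
    have hsin : 2 / Real.pi * θ ≤ Real.sin θ :=
      Real.mul_le_sin hθ.1.le (by linarith [Real.pi_gt_three])
    have hbn := hb.nonneg θ hθ
    have h3 : b (Real.cos θ) * (2 / Real.pi * θ) ≤ (|b₀| + 1) * θ ^ (-(1 + ν)) :=
      (mul_le_mul_of_nonneg_left hsin hbn).trans h2.le
    have h4 : b (Real.cos θ) ≤ C₂ * (θ ^ (-(1 + ν)) / θ) := by
      rw [hC₂, ← mul_div_assoc, le_div_iff₀ hθ.1]
      have := mul_le_mul_of_nonneg_left h3 (by positivity : 0 ≤ Real.pi / 2)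
      calc b (Real.cos θ) * θ = Real.pi / 2 * (b (Real.cos θ) * (2 / Real.pi * θ)) := by
            field_simp
        _ ≤ _ := this
        _ = _ := by ring
    have h5 : θ ^ (-(1 + ν)) / θ ≤ θ ^ (2 * (β - 1)) := by
      rw [← Real.rpow_sub_one hθ.1.ne']
      exact Real.rpow_le_rpow_of_exponent_ge hθ.1 hθ1 (by linarith)
    calc b (Real.cos θ) ≤ C₂ * θ ^ (2 * (β - 1)) := h4.trans (by gcongr)
      _ ≤ (C₂ + C₃) * θ ^ (2 * (β - 1)) := by gcongr; linarith
  · have h2 : b (Real.cos θ) ≤ C₁ := hC₁ ⟨θ, ⟨hge, hθ.2⟩, rfl⟩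
    have h3 : Real.pi ^ (2 * (β - 1)) ≤ θ ^ (2 * (β - 1)) :=
      Real.rpow_le_rpow_of_nonpos hθ.1 hθ.2 (by linarith)
    calc b (Real.cos θ) ≤ |C₁| := h2.trans (le_abs_self _)
      _ = C₃ * Real.pi ^ (2 * (β - 1)) := by rw [hC₃]; field_simp
      _ ≤ C₃ * θ ^ (2 * (β - 1)) := by gcongr
      _ ≤ (C₂ + C₃) * θ ^ (2 * (β - 1)) := by gcongr; linarith

/-- Grad's angular cutoff: the angular factor is integrable on the sphere. In coordinates with the
third axis along `k`, the deviation angle satisfies `θ² ≥ sin² θ = σ₀² + σ₁² ≥ |σ₀ σ₁|`, so that the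
bound `C θ ^ (2 (β - 1))` is at most `C |σ₀ σ₁| ^ (β - 1)`. -/
theorem IsAngularFactor.exists_lintegral_le {b : ℝ → ℝ} {ν b₀ : ℝ} (hb : IsAngularFactor b ν b₀)
    (hν : ν < 0) : ∃ C : ℝ≥0∞, C < ∞ ∧ ∀ k : R3, ‖k‖ = 1 →
      ∫⁻ s : Metric.sphere (0 : R3) 1, ENNReal.ofReal (b (inner ℝ k s))
        ∂(volume : Measure R3).toSphere ≤ C := by
  obtain ⟨β, hβ, C, hC, H⟩ := hb.exists_power_bound hν
  obtain ⟨D, hD, HD⟩ := lintegral_sphere_coords_lt_top hβ.1 hβ.2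
  refine ⟨ENNReal.ofReal C * D, ENNReal.mul_lt_top ENNReal.ofReal_lt_top hD, fun k hk => ?_⟩
  obtain ⟨B, hB⟩ := exists_orthonormalBasis k hk
  refine le_trans ?_ (mul_le_mul_right (HD B) _)
  rw [← lintegral_const_mul' _ _ ENNReal.ofReal_ne_top]
  refine lintegral_mono fun s => ?_
  have hs1 : ‖(s : R3)‖ = 1 := by simp
  have hsum : (B.repr s 0) ^ 2 + (B.repr s 1) ^ 2 + (B.repr s 2) ^ 2 = 1 := by
    have := EuclideanSpace.norm_sq_eq (B.repr (s : R3))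
    rw [B.repr.norm_map, hs1, Fin.sum_univ_three] at this
    simpa using this.symm
  have h2 : inner ℝ k (s : R3) = B.repr s 2 := by rw [B.repr_apply_apply, hB]
  set p := B.repr s 0 with hp
  set q := B.repr s 1 with hq
  set z := B.repr s 2 with hz
  have hp1 : |p| ≤ 1 := by rw [← sq_le_one_iff_abs_le_one]; nlinarith
  have hq1 : |q| ≤ 1 := by rw [← sq_le_one_iff_abs_le_one]; nlinarith
  have hne : ∀ t : ℝ, |t| ≤ 1 → ENNReal.ofReal |t| ^ (β - 1) ≠ 0 := by
    intro t ht h0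
    have : (1 : ℝ≥0∞) ^ (β - 1) ≤ ENNReal.ofReal |t| ^ (β - 1) :=
      ennreal_rpow_anti (by linarith [hβ.2]) (by simpa using ht)
    rw [h0, ENNReal.one_rpow] at this
    exact absurd this (by simp)
  have hC0 : ENNReal.ofReal C ≠ 0 := by simpa using hC
  have hneg : β - 1 < 0 := by linarith [hβ.2]
  by_cases hp0 : p = 0
  · rw [hp0, abs_zero, ENNReal.ofReal_zero, ENNReal.zero_rpow_of_neg hneg,
      ENNReal.top_mul (hne q hq1), ENNReal.mul_top hC0]
    exact le_top
  by_cases hq0 : q = 0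
  · rw [hq0, abs_zero, ENNReal.ofReal_zero, ENNReal.zero_rpow_of_neg hneg,
      ENNReal.mul_top (hne p hp1), ENNReal.mul_top hC0]
    exact le_top
  have hpp : 0 < |p| := abs_pos.2 hp0
  have hqq : 0 < |q| := abs_pos.2 hq0
  rw [h2, ENNReal.ofReal_rpow_of_pos hpp, ENNReal.ofReal_rpow_of_pos hqq,
    ← ENNReal.ofReal_mul (by positivity), ← ENNReal.ofReal_mul hC.le]
  refine ENNReal.ofReal_le_ofReal ?_
  have hz1 : z ^ 2 < 1 := by nlinarith [sq_pos_of_pos hpp, sq_abs p, sq_nonneg q]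
  have hzabs := abs_lt.1 ((sq_lt_one_iff_abs_lt_one z).1 hz1)
  have hθ : Real.arccos z ∈ Ioc 0 Real.pi := ⟨Real.arccos_pos.2 hzabs.2, Real.arccos_le_pi z⟩
  have h3 := H _ hθ
  rw [Real.cos_arccos hzabs.1.le hzabs.2.le] at h3
  refine h3.trans (mul_le_mul_of_nonneg_left ?_ hC.le)
  have hsin : Real.sin (Real.arccos z) ^ 2 = p ^ 2 + q ^ 2 := by
    rw [Real.sin_arccos, Real.sq_sqrt (by linarith)]; linarith
  have hle : |p| * |q| ≤ Real.arccos z ^ 2 := by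
    have h5 : Real.sin (Real.arccos z) ^ 2 ≤ Real.arccos z ^ 2 :=
      pow_le_pow_left₀ (Real.sin_nonneg_of_nonneg_of_le_pi hθ.1.le hθ.2) (Real.sin_le hθ.1.le) 2
    nlinarith [sq_abs p, sq_abs q, sq_nonneg (|p| - |q|), mul_pos hpp hqq]
  rw [Real.rpow_mul hθ.1.le, ← Real.mul_rpow hpp.le hqq.le, Real.rpow_two]
  exact Real.rpow_le_rpow_of_nonpos (by positivity) hle hneg.le

/-- An upper bound for the kinetic factor `Φ(‖u‖)`, `u ≠ 0`: linear growth at infinity, and the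
singularity `‖u‖ ^ γ` at the origin for soft potentials. -/
def kinWeight (γ CΦ : ℝ) (u : R3) : ℝ≥0∞ :=
  ENNReal.ofReal CΦ * (ENNReal.ofReal (1 + ‖u‖) +
    (if γ < 0 then (Metric.ball (0 : R3) 1).indicator (fun u => ENNReal.ofReal (‖u‖ ^ γ)) u else 0))

theorem measurable_kinWeight (γ CΦ : ℝ) : Measurable (kinWeight γ CΦ) := by
  unfold kinWeight
  have h : Measurable ((Metric.ball (0 : R3) 1).indicator (fun u => ENNReal.ofReal (‖u‖ ^ γ))) :=
    Measurable.indicator (by fun_prop) measurableSet_ball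
  split_ifs
  · fun_prop
  · fun_prop

theorem IsKineticFactor.nonneg {Φ : ℝ → ℝ} {γ c C : ℝ} (h : IsKineticFactor Φ γ c C) (hc : 0 < c)
    {r : ℝ} (hr : 0 < r) : 0 ≤ Φ r := by
  rcases h.bounds with h | ⟨h1, h2⟩
  · exact le_trans (by positivity) (h r hr).1
  · rcases le_total 1 r with h3 | h3
    · exact le_trans (by positivity) (h1 r h3).1
    · exact hc.le.trans (h2 r ⟨hr.le, h3⟩).1

theorem IsKineticFactor.le_kinWeight {Φ : ℝ → ℝ} {γ c C : ℝ} (h : IsKineticFactor Φ γ c C)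
    (hC : 0 < C) (hγ : γ ≤ 1) {u : R3} (hu : u ≠ 0) :
    ENNReal.ofReal (Φ ‖u‖) ≤ kinWeight γ C u := by
  have hu0 : 0 < ‖u‖ := norm_pos_iff.2 hu
  have key1 : Φ ‖u‖ ≤ C * (1 + ‖u‖) → ENNReal.ofReal (Φ ‖u‖) ≤ kinWeight γ C u := by
    intro hle
    rw [kinWeight, mul_add, ← ENNReal.ofReal_mul hC.le]
    exact (ENNReal.ofReal_le_ofReal hle).trans le_self_add
  have key2 : 1 ≤ ‖u‖ → ‖u‖ ^ γ ≤ 1 + ‖u‖ := fun h1 => by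
    have := Real.rpow_le_rpow_of_exponent_le h1 hγ
    rw [Real.rpow_one] at this
    linarith
  rcases h.bounds with h | ⟨h1, h2⟩
  · have hb := (h ‖u‖ hu0).2
    rcases le_or_gt 1 ‖u‖ with h3 | h3
    · exact key1 (hb.trans (mul_le_mul_of_nonneg_left (key2 h3) hC.le))
    · rcases lt_or_ge γ 0 with h4 | h4
      · rw [kinWeight, if_pos h4, indicator_of_mem (by simpa using h3), mul_add,
          ← ENNReal.ofReal_mul hC.le (q := ‖u‖ ^ γ)]
        exact (ENNReal.ofReal_le_ofReal hb).trans le_add_self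
      · refine key1 (hb.trans (mul_le_mul_of_nonneg_left ?_ hC.le))
        linarith [Real.rpow_le_one hu0.le h3.le h4]
  · rcases le_total 1 ‖u‖ with h3 | h3
    · exact key1 ((h1 _ h3).2.trans (mul_le_mul_of_nonneg_left (key2 h3) hC.le))
    · refine key1 ((h2 _ ⟨hu0.le, h3⟩).2.trans ?_)
      nlinarith

/-- The angular integral of the collision frequency is carried out first. -/
theorem Lloss_le {Φ b : ℝ → ℝ} {γ c C : ℝ} (hΦ : IsKineticFactor Φ γ c C) (hc : 0 < c) (hC : 0 < C)
    (hγ : γ ≤ 1) {D : ℝ≥0∞} (hD : D < ∞) (hb : ∀ k : R3, ‖k‖ = 1 →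
      ∫⁻ s : Metric.sphere (0 : R3) 1, ENNReal.ofReal (b (inner ℝ k s))
        ∂(volume : Measure R3).toSphere ≤ D) {h : R3 → ℝ} (hh : ∀ w, 0 ≤ h w) (v : R3) :
    Lloss Φ b h v ≤ D * ∫⁻ w, kinWeight γ C (v - w) * ENNReal.ofReal (h w) := by
  rw [Lloss, ← lintegral_const_mul' _ _ hD.ne]
  refine (lintegral_prod_le _).trans (lintegral_mono_ae ?_)
  filter_upwards [Measure.ae_ne volume v] with w hw
  have hvw : v - w ≠ 0 := sub_ne_zero.2 hw.symm
  have hn : 0 < ‖v - w‖ := norm_pos_iff.2 hvw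
  have e : ∀ s : Metric.sphere (0 : R3) 1, ENNReal.ofReal (kernel Φ b v w s * h w) =
      ENNReal.ofReal (Φ ‖v - w‖ * h w) *
        ENNReal.ofReal (b (inner ℝ (‖v - w‖⁻¹ • (v - w)) (s : R3))) := by
    intro s
    rw [← ENNReal.ofReal_mul (mul_nonneg (hΦ.nonneg hc hn) (hh w)), kernel, inner_smul_left,
      div_eq_inv_mul]
    congr 1
    simp only [conj_trivial]
    ring
  simp_rw [e]
  rw [lintegral_const_mul' _ _ ENNReal.ofReal_ne_top, ENNReal.ofReal_mul (hΦ.nonneg hc hn),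
      mul_comm]
  refine mul_le_mul' (hb _ ?_) (mul_le_mul_left (hΦ.le_kinWeight hC hγ hvw) _)
  rw [norm_smul, norm_inv, norm_norm, inv_mul_cancel₀ hn.ne']

/-- The kinetic part of the collision frequency grows at most linearly in the velocity, for
densities with bounded energy, `L²` norm and (for soft potentials) `L^p` norm. The mass is
controlled by energy and `L²` norm through `h ≤ 1 + h²` on the unit ball and `h ≤ ‖w‖² h` outside;
the singular part by Young's inequality, as `‖u‖ ^ γ` is locally in the dual space of `L^p` if and
only if `p > 3 / (3 + γ)`. -/
theorem exists_lintegral_kinWeight_le {γ CΦ : ℝ} (hγ : -3 < γ) (E Λ p : ℝ)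
    (hp : γ < 0 → 3 / (3 + γ) < p) : ∃ C > 0, ∀ h : R3 → ℝ, AEMeasurable h → (∀ w, 0 ≤ h w) →
      ((∫⁻ w, ENNReal.ofReal (‖w‖ ^ 2 * h w)) + ∫⁻ w, ENNReal.ofReal (h w ^ 2)) ≤
        ENNReal.ofReal E →
      (γ < 0 → (∫⁻ w, ENNReal.ofReal (h w) ^ p) ^ (1 / p) ≤ ENNReal.ofReal Λ) →
      ∀ v, ∫⁻ w, kinWeight γ CΦ (v - w) * ENNReal.ofReal (h w) ≤
        ENNReal.ofReal (C * (1 + ‖v‖)) := by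
  set V : ℝ≥0∞ := volume (Metric.ball (0 : R3) 1) with hV
  have hVfin : V < ∞ := measure_ball_lt_top
  set A : ℝ≥0∞ := 2 * (V + ENNReal.ofReal E) + ENNReal.ofReal E with hA
  have hAfin : A < ∞ := by
    rw [hA]
    exact ENNReal.add_lt_top.2 ⟨ENNReal.mul_lt_top (by simp) (ENNReal.add_lt_top.2
      ⟨hVfin, ENNReal.ofReal_lt_top⟩), ENNReal.ofReal_lt_top⟩
  set q : ℝ := p / (p - 1) with hq
  set S : ℝ≥0∞ := if γ < 0 then
    (∫⁻ u in Metric.ball (0 : R3) 1, ENNReal.ofReal (‖u‖ ^ (γ * q))) + ENNReal.ofReal Λ ^ p else 0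
    with hS
  have hp1 : γ < 0 → 1 < p := fun h => by
    refine lt_trans ?_ (hp h)
    rw [lt_div_iff₀ (by linarith)]; linarith
  have hSfin : S < ∞ := by
    rw [hS]
    split_ifs with h
    · have h1 := hp1 h
      refine ENNReal.add_lt_top.2 ⟨lintegral_ball_rpow_lt_top volume ?_,
        ENNReal.rpow_lt_top_of_nonneg (by linarith) ENNReal.ofReal_ne_top⟩
      have h2 := hp h
      rw [div_lt_iff₀ (by linarith)] at h2
      simp only [finrank_euclideanSpace, Fintype.card_fin, Nat.cast_ofNat]
      rw [hq, ← mul_div_assoc, lt_div_iff₀ (by linarith)]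
      linarith
    · simp
  set K := (ENNReal.ofReal CΦ * (A + S)) with hK
  have hKfin : K ≠ ∞ :=
    (ENNReal.mul_lt_top ENNReal.ofReal_lt_top (ENNReal.add_lt_top.2 ⟨hAfin, hSfin⟩)).ne
  refine ⟨K.toReal + 1, by positivity, fun h hm h0 hE hΛ v => ?_⟩
  have hHm : AEMeasurable (fun w => ENNReal.ofReal (h w)) := hm.ennreal_ofReal
  have hE1 : ∫⁻ w, ENNReal.ofReal (‖w‖ ^ 2 * h w) ≤ ENNReal.ofReal E := le_self_add.trans hE
  have hm1 : AEMeasurable (fun w : R3 => ENNReal.ofReal (‖w‖ ^ 2 * h w)) := by fun_prop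
  have hm2 : AEMeasurable (fun w : R3 => ENNReal.ofReal (h w ^ 2)) := by fun_prop
  have hmass : ∫⁻ w, ENNReal.ofReal (h w) ≤ V + ENNReal.ofReal E := by
    calc ∫⁻ w, ENNReal.ofReal (h w) ≤ ∫⁻ w, ((Metric.ball (0 : R3) 1).indicator 1 w +
          (ENNReal.ofReal (‖w‖ ^ 2 * h w) + ENNReal.ofReal (h w ^ 2))) := by
          refine lintegral_mono fun w => ?_
          by_cases hw : w ∈ Metric.ball (0 : R3) 1
          · rw [indicator_of_mem hw, Pi.one_apply, ← ENNReal.ofReal_one,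
              ← ENNReal.ofReal_add (mul_nonneg (by positivity) (h0 w)) (by positivity),
              ← ENNReal.ofReal_add zero_le_one (by have := h0 w; positivity)]
            refine ENNReal.ofReal_le_ofReal ?_
            nlinarith [h0 w, sq_nonneg (h w - 1), mul_nonneg (sq_nonneg ‖w‖) (h0 w)]
          · refine le_trans (ENNReal.ofReal_le_ofReal ?_) (le_self_add.trans le_add_self)
            have hw1 : 1 ≤ ‖w‖ := by simpa using hw
            exact le_mul_of_one_le_left (h0 w) (one_le_pow₀ hw1)
      _ = V + ((∫⁻ w, ENNReal.ofReal (‖w‖ ^ 2 * h w)) + ∫⁻ w, ENNReal.ofReal (h w ^ 2)) := by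
          rw [lintegral_add_left (measurable_one.indicator measurableSet_ball),
            lintegral_add_left' hm1, lintegral_indicator_one measurableSet_ball]
      _ ≤ V + ENNReal.ofReal E := by gcongr
  have hlin : ∫⁻ w, ENNReal.ofReal (1 + ‖v - w‖) * ENNReal.ofReal (h w) ≤
      ENNReal.ofReal (1 + ‖v‖) * A := by
    calc ∫⁻ w, ENNReal.ofReal (1 + ‖v - w‖) * ENNReal.ofReal (h w)
        ≤ ∫⁻ w, ENNReal.ofReal (1 + ‖v‖) * ((2 * ENNReal.ofReal (h w)) +
            ENNReal.ofReal (‖w‖ ^ 2 * h w)) := by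
          refine lintegral_mono fun w => ?_
          have e2 : (2 : ℝ≥0∞) * ENNReal.ofReal (h w) = ENNReal.ofReal (2 * h w) := by
            rw [ENNReal.ofReal_mul (by norm_num)]; simp
          rw [e2, ← ENNReal.ofReal_mul (by positivity),
            ← ENNReal.ofReal_add (by have := h0 w; positivity) (by have := h0 w; positivity),
            ← ENNReal.ofReal_mul (by positivity)]
          refine ENNReal.ofReal_le_ofReal ?_
          have h1 := norm_sub_le v w
          have h2 : 1 + ‖v - w‖ ≤ (1 + ‖v‖) * (1 + ‖w‖) := by
            nlinarith [mul_nonneg (norm_nonneg v) (norm_nonneg w)]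
          have h3 : 1 + ‖w‖ ≤ 2 + ‖w‖ ^ 2 := by nlinarith [sq_nonneg (‖w‖ - 1)]
          calc (1 + ‖v - w‖) * h w ≤ ((1 + ‖v‖) * (2 + ‖w‖ ^ 2)) * h w :=
                mul_le_mul_of_nonneg_right (h2.trans (by gcongr)) (h0 w)
            _ = _ := by ring
      _ = ENNReal.ofReal (1 + ‖v‖) * (2 * (∫⁻ w, ENNReal.ofReal (h w)) +
            ∫⁻ w, ENNReal.ofReal (‖w‖ ^ 2 * h w)) := by
          rw [lintegral_const_mul' _ _ ENNReal.ofReal_ne_top, lintegral_add_right' _ hm1,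
            lintegral_const_mul' _ _ (by simp)]
      _ ≤ ENNReal.ofReal (1 + ‖v‖) * A := by rw [hA]; gcongr
  have hsing : ∫⁻ w, (if γ < 0 then (Metric.ball (0 : R3) 1).indicator
      (fun u => ENNReal.ofReal (‖u‖ ^ γ)) (v - w) else 0) * ENNReal.ofReal (h w) ≤ S := by
    rw [hS]
    split_ifs with hneg
    swap
    · simp
    have h1 := hp1 hneg
    have hconj : q.HolderConjugate p := (Real.HolderConjugate.conjExponent h1).symm
    have hq1 : 1 < q := hconj.lt
    set g : R3 → ℝ≥0∞ := (Metric.ball (0 : R3) 1).indicator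
      (fun u => ENNReal.ofReal (‖u‖ ^ (γ * q))) with hg
    have hgm : Measurable g := Measurable.indicator (by fun_prop) measurableSet_ball
    calc ∫⁻ w, (Metric.ball (0 : R3) 1).indicator
          (fun u => ENNReal.ofReal (‖u‖ ^ γ)) (v - w) * ENNReal.ofReal (h w)
        ≤ ∫⁻ w, (g (v - w) + ENNReal.ofReal (h w) ^ p) := by
          refine lintegral_mono fun w => ?_
          simp only
          by_cases hw : v - w ∈ Metric.ball (0 : R3) 1
          · rw [hg, indicator_of_mem hw, indicator_of_mem hw]
            refine (ENNReal.young_inequality _ _ hconj).trans (add_le_add ?_ ?_)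
            · rw [Real.rpow_mul (norm_nonneg _), ENNReal.ofReal_rpow_of_nonneg
                (by positivity) (by linarith)]
              exact ENNReal.div_le_of_le_mul (le_mul_of_one_le_right bot_le
                (by rw [← ENNReal.ofReal_one]; exact ENNReal.ofReal_le_ofReal hq1.le))
            · exact ENNReal.div_le_of_le_mul (le_mul_of_one_le_right bot_le
                (by rw [← ENNReal.ofReal_one]; exact ENNReal.ofReal_le_ofReal h1.le))
          · rw [indicator_of_notMem hw, zero_mul]
            exact bot_le
      _ = (∫⁻ w, g (v - w)) + ∫⁻ w, ENNReal.ofReal (h w) ^ p :=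
          lintegral_add_left (hgm.comp (measurable_const.sub measurable_id)) _
      _ ≤ _ := by
          refine add_le_add ?_ ?_
          · rw [lintegral_sub_left_eq_self, hg, lintegral_indicator measurableSet_ball]
          · have h2 := ENNReal.rpow_le_rpow (hΛ hneg) (show 0 ≤ p by linarith)
            rwa [← ENNReal.rpow_mul, one_div, inv_mul_cancel₀ (by linarith), ENNReal.rpow_one] at h2
  calc ∫⁻ w, kinWeight γ CΦ (v - w) * ENNReal.ofReal (h w)
      = ENNReal.ofReal CΦ * ((∫⁻ w, ENNReal.ofReal (1 + ‖v - w‖) * ENNReal.ofReal (h w)) +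
          ∫⁻ w, (if γ < 0 then (Metric.ball (0 : R3) 1).indicator
            (fun u => ENNReal.ofReal (‖u‖ ^ γ)) (v - w) else 0) * ENNReal.ofReal (h w)) := by
        rw [← lintegral_add_left' (by fun_prop), ← lintegral_const_mul' _ _ ENNReal.ofReal_ne_top]
        refine lintegral_congr fun w => ?_
        rw [kinWeight, mul_assoc, add_mul]
    _ ≤ ENNReal.ofReal CΦ * (ENNReal.ofReal (1 + ‖v‖) * A + ENNReal.ofReal (1 + ‖v‖) * S) := by
        gcongr
        refine hsing.trans (le_mul_of_one_le_left bot_le ?_)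
        rw [← ENNReal.ofReal_one]
        exact ENNReal.ofReal_le_ofReal (by linarith [norm_nonneg v])
    _ = K * ENNReal.ofReal (1 + ‖v‖) := by rw [hK]; ring
    _ ≤ ENNReal.ofReal ((K.toReal + 1) * (1 + ‖v‖)) := by
        rw [ENNReal.ofReal_mul (by positivity)]
        gcongr
        rw [← ENNReal.ofReal_toReal hKfin]
        exact ENNReal.ofReal_le_ofReal (by simp)

/-! ### Spreading of positivity by the gain operator -/

theorem IsAngularFactor.exists_lower {b : ℝ → ℝ} {ν b₀ : ℝ} (hb : IsAngularFactor b ν b₀) :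
    ∃ ε ∈ Ioc (0 : ℝ) 1, ∃ m > 0, ∀ z, |z| ≤ ε → m ≤ b z := by
  have hpi : Real.pi / 2 ∈ Ioo 0 Real.pi := ⟨by positivity, by linarith [Real.pi_pos]⟩
  have hc : ContinuousAt (fun θ => b (Real.cos θ)) (Real.pi / 2) :=
    hb.continuousOn.continuousAt (mem_of_superset (Ioo_mem_nhds hpi.1 hpi.2) Ioo_subset_Ioc_self)
  have h0 : 0 < b (Real.cos (Real.pi / 2)) := hb.pos_near.self_of_nhds
  set m := b (Real.cos (Real.pi / 2)) / 2 with hm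
  have h1 : ∀ᶠ θ in 𝓝 (Real.pi / 2), m < b (Real.cos θ) :=
    hc.eventually_const_lt (by simp only [hm]; linarith)
  have h2 : Tendsto Real.arccos (𝓝 0) (𝓝 (Real.pi / 2)) := by
    have := Real.continuous_arccos.tendsto 0
    rwa [Real.arccos_zero] at this
  obtain ⟨ε, hε, hsub⟩ := Metric.eventually_nhds_iff.1 (h2.eventually h1)
  refine ⟨min (ε / 2) 1, ⟨lt_min (by positivity) one_pos, min_le_right _ _⟩, m, by positivity,
    fun z hz => ?_⟩
  have hz1 := abs_le.1 (hz.trans (min_le_right _ _))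
  have := hsub (y := z) (by
    rw [dist_zero_right, Real.norm_eq_abs]
    linarith [hz.trans (min_le_left _ _)])
  rw [Real.cos_arccos hz1.1 hz1.2] at this
  exact this.le

/-- A lower bound for the kinetic factor in terms of a single rational function, for all admissible
`γ`. -/
theorem IsKineticFactor.lower {Φ : ℝ → ℝ} {γ c C : ℝ} (h : IsKineticFactor Φ γ c C) (hc : 0 < c)
    (hγ : γ ∈ Ioc (-3 : ℝ) 1) {r : ℝ} (hr : 0 < r) : c * (r / (1 + r) ^ 4) ≤ Φ r := by
  have hd : 1 ≤ (1 + r) ^ 4 := one_le_pow₀ (by linarith)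
  have h1 : r ≤ 1 → r / (1 + r) ^ 4 ≤ r ^ γ := fun hr1 => by
    have := Real.rpow_le_rpow_of_exponent_ge hr hr1 hγ.2
    rw [Real.rpow_one] at this
    exact (div_le_self hr.le hd).trans this
  have h2 : 1 ≤ r → r / (1 + r) ^ 4 ≤ r ^ γ := fun hr1 => by
    have h3 := Real.rpow_le_rpow_of_exponent_le hr1 hγ.1.le
    refine le_trans ?_ h3
    rw [Real.rpow_neg hr.le, div_le_iff₀ (by positivity)]
    have e : r ^ (3 : ℝ) = r ^ 3 := by norm_cast
    rw [e, inv_mul_eq_div, le_div_iff₀ (by positivity)]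
    calc r * r ^ 3 = r ^ 4 := by ring
      _ ≤ (1 + r) ^ 4 := by gcongr; linarith
  have h3 : r ≤ 1 → r / (1 + r) ^ 4 ≤ 1 := fun hr1 => (div_le_self hr.le hd).trans hr1
  rcases h.bounds with h | ⟨ha, hb⟩
  · refine le_trans (mul_le_mul_of_nonneg_left ?_ hc.le) (h r hr).1
    rcases le_total r 1 with h4 | h4
    · exact h1 h4
    · exact h2 h4
  · rcases le_total r 1 with h4 | h4
    · exact le_trans (mul_le_of_le_one_right hc.le (h3 h4)) (hb r ⟨hr.le, h4⟩).1
    · exact le_trans (mul_le_mul_of_nonneg_left (h2 h4) hc.le) (ha r h4).1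

set_option maxHeartbeats 1000000 in
/-- The geometry behind the spreading of positivity: collisions of particles of velocities `u` and
`us` relative to a centre, with `us` near `ξ r e` and `σ` near a direction orthogonal to both `u`
and `e`, produce velocities in the ball of radius `r`, with a deviation angle close to `π / 2`. In
the model case `us = ξ r e` the energy `‖u‖² + (ξ r)²` is shared equally by the two particles, which
explains the factor `√2`. -/
theorem spread_geometry {u e s₀ us σ : R3} {r ξ ε : ℝ} (hr : 0 < r) (hξ : 0 < ξ) (hξ1 : ξ ≤ 1 / 2)
    (hε : 0 < ε) (hε1 : ε ≤ 1) (hue : inner ℝ u e = 0) (hus : inner ℝ u s₀ = 0)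
    (hes : inner ℝ e s₀ = 0) (he : ‖e‖ = 1) (hs : ‖s₀‖ = 1) (hσ : ‖σ‖ = 1)
    (hu : ‖u‖ ≤ √2 * r * (1 - ξ)) (hb : ‖us - (ξ * r) • e‖ < ξ * r * ε / 8)
    (hc : ‖σ - s₀‖ < ξ * ε / 8) :
    ξ * r / 2 ≤ ‖u - us‖ ∧ ‖u - us‖ ≤ 3 * r ∧ |inner ℝ (u - us) σ / ‖u - us‖| ≤ ε ∧
      ‖(1 / 2 : ℝ) • (u + us) + (‖u - us‖ / 2) • σ‖ < r ∧
      ‖(1 / 2 : ℝ) • (u + us) - (‖u - us‖ / 2) • σ‖ < r := by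
  set w₀ : R3 := (ξ * r) • e with hw₀
  have hw₀n : ‖w₀‖ = ξ * r := by
    rw [hw₀, norm_smul, he, Real.norm_of_nonneg (by positivity), mul_one]
  have hξr : 0 < ξ * r := by positivity
  have hsq2 : √2 ≤ 3 / 2 := by
    rw [Real.sqrt_le_left (by norm_num)]; norm_num
  have huw : inner ℝ u w₀ = 0 := by rw [hw₀, inner_smul_right, hue, mul_zero]
  have hws : inner ℝ w₀ s₀ = 0 := by rw [hw₀, inner_smul_left, hes, mul_zero]
  have hd0 : ‖u - w₀‖ ^ 2 = ‖u‖ ^ 2 + (ξ * r) ^ 2 := by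
    rw [norm_sub_sq_real, huw, hw₀n]; ring
  have hp0 : ‖u + w₀‖ ^ 2 = ‖u‖ ^ 2 + (ξ * r) ^ 2 := by
    rw [norm_add_sq_real, huw, hw₀n]; ring
  have hδ : ξ * r * ε / 8 ≤ ξ * r / 8 := by
    have := mul_le_of_le_one_right hξr.le hε1
    linarith
  have hu2 : ‖u‖ ≤ 3 / 2 * r * (1 - ξ) :=
    hu.trans (by have : 0 ≤ 1 - ξ := by linarith
                 gcongr)
  have hd0le : ‖u - w₀‖ ≤ 2 * r := by
    have := norm_sub_le u w₀
    rw [hw₀n] at this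
    nlinarith [mul_pos hξ hr]
  have hd0ge : ξ * r ≤ ‖u - w₀‖ := by
    refine le_of_sq_le_sq ?_ (norm_nonneg _)
    rw [hd0]; nlinarith [sq_nonneg ‖u‖]
  have hdiff : |‖u - us‖ - ‖u - w₀‖| ≤ ‖us - w₀‖ := by
    have := abs_norm_sub_norm_le (u - us) (u - w₀)
    rwa [sub_sub_sub_cancel_left, norm_sub_rev w₀ us] at this
  have hdiff' := abs_le.1 hdiff
  have hge : ξ * r / 2 ≤ ‖u - us‖ := by linarith [hdiff'.1]
  have hξr1 : ξ * r ≤ 1 / 2 * r := mul_le_mul_of_nonneg_right hξ1 hr.le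
  have hle : ‖u - us‖ ≤ 3 * r := by linarith [hdiff'.2]
  have hpos : 0 < ‖u - us‖ := by linarith
  refine ⟨hge, hle, ?_, ?_⟩
  · rw [abs_div, abs_norm, div_le_iff₀ hpos]
    have e1 : inner ℝ (u - us) σ = inner ℝ (w₀ - us) s₀ + inner ℝ (u - us) (σ - s₀) := by
      rw [inner_sub_right (u - us) σ s₀, inner_sub_left w₀ us s₀, hws, inner_sub_left u us s₀, hus]
      ring
    rw [e1]
    calc |inner ℝ (w₀ - us) s₀ + inner ℝ (u - us) (σ - s₀)|
        ≤ |inner ℝ (w₀ - us) s₀| + |inner ℝ (u - us) (σ - s₀)| := abs_add_le _ _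
      _ ≤ ‖w₀ - us‖ * ‖s₀‖ + ‖u - us‖ * ‖σ - s₀‖ :=
          add_le_add (abs_real_inner_le_norm _ _) (abs_real_inner_le_norm _ _)
      _ ≤ ξ * r * ε / 8 + ‖u - us‖ * (ξ * ε / 8) := by
          rw [hs, mul_one, norm_sub_rev w₀ us]
          exact add_le_add hb.le (mul_le_mul_of_nonneg_left hc.le hpos.le)
      _ ≤ ε * ‖u - us‖ := by
          have k1 : ε * (ξ * r / 2) ≤ ε * ‖u - us‖ := mul_le_mul_of_nonneg_left hge hε.le
          have k2 : ξ * (ε * ‖u - us‖) ≤ 1 / 2 * (ε * ‖u - us‖) :=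
            mul_le_mul_of_nonneg_right hξ1 (mul_pos hε hpos).le
          linarith [mul_pos hε hpos]
  have hmain : ∀ τ : ℝ, τ ^ 2 = 1 → ‖(1 / 2 : ℝ) • (u + us) + (τ * (‖u - us‖ / 2)) • σ‖ < r := by
    intro τ hτ
    have hτa : |τ| = 1 := (sq_eq_sq₀ (abs_nonneg τ) zero_le_one).1 (by rw [sq_abs, hτ, one_pow])
    -- The post-collisional velocity in the model case.
    set P : R3 := (1 / 2 : ℝ) • (u + w₀) + (τ * (‖u - w₀‖ / 2)) • s₀ with hP
    have hPn : ‖P‖ ^ 2 = (‖u‖ ^ 2 + (ξ * r) ^ 2) / 2 := by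
      rw [hP, norm_add_sq_real, norm_smul, norm_smul, inner_smul_left, inner_smul_right,
        inner_add_left, hus, hws, hs, mul_pow, hp0, Real.norm_eq_abs (τ * _), abs_mul, hτa,
        abs_of_nonneg (by positivity : 0 ≤ ‖u - w₀‖ / 2), one_mul, mul_one, div_pow, hd0]
      norm_num
      ring
    have hPle : ‖P‖ ≤ r * (1 - ξ / 2) := by
      refine le_of_sq_le_sq ?_ (mul_nonneg hr.le (by linarith))
      rw [hPn]
      have h1 : ‖u‖ ^ 2 ≤ 2 * r ^ 2 * (1 - ξ) ^ 2 := by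
        have := pow_le_pow_left₀ (norm_nonneg _) hu 2
        rwa [mul_pow, mul_pow, Real.sq_sqrt (by norm_num)] at this
      have h2 : 0 ≤ r ^ 2 * ξ * (4 - 5 * ξ) :=
        mul_nonneg (by positivity) (by linarith)
      linarith [h2]
    have hdP : ‖(1 / 2 : ℝ) • (u + us) + (τ * (‖u - us‖ / 2)) • σ - P‖ ≤
        ξ * r / 4 := by
      have e2 : (1 / 2 : ℝ) • (u + us) + (τ * (‖u - us‖ / 2)) • σ - P =
          (1 / 2 : ℝ) • (us - w₀) + ((τ * ((‖u - us‖ - ‖u - w₀‖) / 2)) • σ +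
            (τ * (‖u - w₀‖ / 2)) • (σ - s₀)) := by
        rw [hP]; module
      rw [e2]
      calc _ ≤ ‖(1 / 2 : ℝ) • (us - w₀)‖ + (‖(τ * ((‖u - us‖ - ‖u - w₀‖) / 2)) • σ‖ +
            ‖(τ * (‖u - w₀‖ / 2)) • (σ - s₀)‖) :=
            (norm_add_le _ _).trans (add_le_add_right (norm_add_le _ _) _)
        _ = ‖us - w₀‖ / 2 + (|‖u - us‖ - ‖u - w₀‖| / 2 + ‖u - w₀‖ / 2 * ‖σ - s₀‖) := by
            rw [norm_smul, norm_smul, norm_smul, hσ, Real.norm_eq_abs, Real.norm_eq_abs,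
              Real.norm_eq_abs, abs_mul, abs_mul, hτa, abs_div, abs_div,
              abs_of_nonneg (by positivity : 0 ≤ ‖u - w₀‖ / 2)]
            norm_num
            ring
        _ ≤ (ξ * r / 8) / 2 + ((ξ * r / 8) / 2 + (2 * r) / 2 * (ξ / 8)) := by
            have h1 : ‖us - w₀‖ ≤ ξ * r / 8 := hb.le.trans hδ
            have h2 : ‖σ - s₀‖ ≤ ξ / 8 :=
              hc.le.trans (by linarith [mul_le_of_le_one_right hξ.le hε1])
            have h3 : ‖u - w₀‖ / 2 * ‖σ - s₀‖ ≤ (2 * r) / 2 * (ξ / 8) :=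
              mul_le_mul (by linarith) h2 (norm_nonneg _) (by positivity)
            linarith [hdiff.trans h1]
        _ = ξ * r / 4 := by ring
    have := norm_add_le ((1 / 2 : ℝ) • (u + us) + (τ * (‖u - us‖ / 2)) • σ - P) P
    rw [sub_add_cancel] at this
    linarith
  refine ⟨by simpa using hmain 1 (by norm_num), ?_⟩
  have := hmain (-1) (by norm_num)
  rwa [neg_one_mul, neg_smul, ← sub_eq_add_neg] at this

theorem exists_perp_pair (u : R3) : ∃ e s₀ : R3, inner ℝ u e = 0 ∧ inner ℝ u s₀ = 0 ∧
    inner ℝ e s₀ = 0 ∧ ‖e‖ = 1 ∧ ‖s₀‖ = 1 := by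
  obtain ⟨k, hk, c, hc⟩ : ∃ k : R3, ‖k‖ = 1 ∧ ∃ c : ℝ, u = c • k := by
    by_cases hu : u = 0
    · exact ⟨EuclideanSpace.single 0 1, by simp, 0, by simp [hu]⟩
    · have := norm_ne_zero_iff.2 hu
      refine ⟨‖u‖⁻¹ • u, by rw [norm_smul, norm_inv, norm_norm, inv_mul_cancel₀ this], ‖u‖, ?_⟩
      rw [smul_smul, mul_inv_cancel₀ this, one_smul]
  obtain ⟨B, hB⟩ := exists_orthonormalBasis k hk
  refine ⟨B 0, B 1, ?_, ?_, B.orthonormal.2 (by decide), B.orthonormal.1 0, B.orthonormal.1 1⟩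
  · rw [hc, inner_smul_left, ← hB, B.orthonormal.2 (by decide), mul_zero]
  · rw [hc, inner_smul_left, ← hB, B.orthonormal.2 (by decide), mul_zero]

/-- If `h ≥ a` on a ball of radius `r`, then `Q⁺[h, h]` is bounded below on the concentric ball of
radius `√2 r (1 - ξ)`. The integrand is bounded below on the product of a velocity ball of radius of
the order `ξ r` and a spherical cap of radius of the order `ξ`, on which `‖v - v_*‖ ≥ ξ r / 2`; this
gives the power `ξ ^ (3 + 3 + 1)`. -/
theorem exists_spread {b : ℝ → ℝ} {ν b₀ : ℝ} (hb : IsAngularFactor b ν b₀) {γ cΦ : ℝ}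
    (hγ : γ ∈ Ioc (-3 : ℝ) 1) (hcΦ : 0 < cΦ) : ∃ c > 0, ∀ (Φ : ℝ → ℝ) (CΦ : ℝ),
      IsKineticFactor Φ γ cΦ CΦ → ∀ (h : R3 → ℝ) (V : R3) (r a ξ : ℝ), 0 < r → 0 ≤ a → 0 < ξ →
      ξ ≤ 1 / 2 → (∀ w, ‖w - V‖ < r → a ≤ h w) → ∀ v, ‖v - V‖ ≤ √2 * r * (1 - ξ) →
      ENNReal.ofReal (c * a ^ 2 * ξ ^ 7 * (r ^ 4 / (1 + r) ^ 4)) ≤ Qplus Φ b h h v := by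
  obtain ⟨ε, hε, m, hm, hbm⟩ := hb.exists_lower
  set κ : ℝ := (volume (Metric.ball (0 : R3) 1)).toReal with hκ
  have hκfin : volume (Metric.ball (0 : R3) 1) ≠ ∞ := measure_ball_lt_top.ne
  have hκ0 : 0 < κ := ENNReal.toReal_pos (Metric.measure_ball_pos volume _ one_pos).ne' hκfin
  have hκe : volume (Metric.ball (0 : R3) 1) = ENNReal.ofReal κ :=
      (ENNReal.ofReal_toReal hκfin).symm
  refine ⟨m * cΦ / 162 * ((ε / 8) ^ 3 * κ) * (3 * (ε / 32) ^ 3 * κ), by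
    have := hε.1; positivity, ?_⟩
  intro Φ CΦ hΦ h V r a ξ hr ha hξ hξ1 hlow v hv
  have hε0 := hε.1
  obtain ⟨e, s₀, hue, hus, hes, he, hs⟩ := exists_perp_pair (v - V)
  set S₀ : Metric.sphere (0 : R3) 1 := ⟨s₀, by simpa using hs⟩ with hS₀
  set δ := ξ * r * ε / 8 with hδ
  set δ' := ξ * ε / 8 with hδ'
  have hδ0 : 0 < δ := by positivity
  have hδ'0 : 0 < δ' := by positivity
  set S : Set (R3 × Metric.sphere (0 : R3) 1) :=
    Metric.ball (V + (ξ * r) • e) δ ×ˢ Metric.ball S₀ δ' with hS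
  have hSm : MeasurableSet S := measurableSet_ball.prod measurableSet_ball
  set q := m * cΦ * (ξ * r / (162 * (1 + r) ^ 4)) * a ^ 2 with hq
  have hq0 : 0 ≤ q := by positivity
  have hpt : ∀ p ∈ S, ENNReal.ofReal q ≤ ENNReal.ofReal (kernel Φ b v p.1 p.2 *
      (h ((1 / 2 : ℝ) • (v + p.1) + (‖v - p.1‖ / 2) • (p.2 : R3)) *
       h ((1 / 2 : ℝ) • (v + p.1) - (‖v - p.1‖ / 2) • (p.2 : R3)))) := by
    rintro ⟨vs, σ⟩ ⟨hvs, hσ⟩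
    simp only at hvs hσ ⊢
    have hσ1 : ‖(σ : R3)‖ = 1 := by simp
    have hb1 : ‖vs - V - (ξ * r) • e‖ < ξ * r * ε / 8 := by
      rwa [Metric.mem_ball, dist_eq_norm, ← sub_sub] at hvs
    have hc1 : ‖(σ : R3) - s₀‖ < ξ * ε / 8 := by
      rwa [Metric.mem_ball, Subtype.dist_eq, dist_eq_norm] at hσ
    obtain ⟨g1, g2, g3, g4, g5⟩ := spread_geometry hr hξ hξ1 hε0 hε.2 hue hus hes he hs hσ1 hv hb1
        hc1
    rw [sub_sub_sub_cancel_right] at g1 g2 g3 g4 g5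
    have h4 : a ≤ h ((1 / 2 : ℝ) • (v + vs) + (‖v - vs‖ / 2) • (σ : R3)) := by
      refine hlow _ (lt_of_eq_of_lt (congrArg norm ?_) g4)
      module
    have h5 : a ≤ h ((1 / 2 : ℝ) • (v + vs) - (‖v - vs‖ / 2) • (σ : R3)) := by
      refine hlow _ (lt_of_eq_of_lt (congrArg norm ?_) g5)
      module
    have hpos : 0 < ‖v - vs‖ := lt_of_lt_of_le (by positivity) g1
    have hk : m * cΦ * (ξ * r / (162 * (1 + r) ^ 4)) ≤ kernel Φ b v vs σ := by
      have k1 := hΦ.lower hcΦ hγ hpos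
      have k2 := hbm _ g3
      have k3 : cΦ * (ξ * r / (162 * (1 + r) ^ 4)) ≤ Φ ‖v - vs‖ := by
        refine le_trans (mul_le_mul_of_nonneg_left ?_ hcΦ.le) k1
        calc ξ * r / (162 * (1 + r) ^ 4) = (ξ * r / 2) / (81 * (1 + r) ^ 4) := by
              field_simp; norm_num
          _ ≤ ‖v - vs‖ / (1 + ‖v - vs‖) ^ 4 := by
              refine div_le_div₀ hpos.le g1 (by positivity) ?_
              calc (1 + ‖v - vs‖) ^ 4 ≤ (3 * (1 + r)) ^ 4 := by gcongr; linarith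
                _ = 81 * (1 + r) ^ 4 := by ring
      calc m * cΦ * (ξ * r / (162 * (1 + r) ^ 4)) =
            cΦ * (ξ * r / (162 * (1 + r) ^ 4)) * m := by ring
        _ ≤ kernel Φ b v vs σ := mul_le_mul k3 k2 hm.le (le_trans (by positivity) k3)
    refine ENNReal.ofReal_le_ofReal ?_
    rw [hq]
    refine mul_le_mul hk ?_ (by positivity) (le_trans (by positivity) hk)
    rw [sq]
    exact mul_le_mul h4 h5 ha (ha.trans h4)
  have hcap : ENNReal.ofReal (3 * (ξ * ε / 32) ^ 3 * κ) ≤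
      (volume : Measure R3).toSphere (Metric.ball S₀ δ') := by
    refine le_trans (le_of_eq ?_)
      ((volume : Measure R3).toSphereBallBound_mul_measure_unitBall_le_toSphere_ball hδ'0 S₀)
    rw [hκe, ENNReal.ofReal_mul (by positivity)]
    congr 1
    have hmin : min δ'.toNNReal 2 = δ'.toNNReal := by
      refine min_eq_left ?_
      rw [Real.toNNReal_le_iff_le_coe]
      simp only [NNReal.coe_ofNat]
      nlinarith [mul_le_mul hξ1 hε.2 hε0.le (by norm_num)]
    unfold Measure.toSphereBallBound
    rw [if_pos ⟨by simp, hδ'0⟩, hmin]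
    rw [ENNReal.ofReal, ENNReal.coe_inj]
    apply NNReal.eq
    simp only [finrank_euclideanSpace, Fintype.card_fin, Nat.cast_ofNat, NNReal.coe_mul,
      NNReal.coe_pow, NNReal.coe_div, NNReal.coe_ofNat, Real.coe_toNNReal _ hδ'0.le]
    rw [Real.coe_toNNReal _ (by positivity), hδ']
    ring
  have hball : volume (Metric.ball (V + (ξ * r) • e) δ) = ENNReal.ofReal (δ ^ 3 * κ) := by
    rw [Measure.addHaar_ball volume _ hδ0.le, hκe, ← ENNReal.ofReal_mul (by positivity)]
    simp
  calc ENNReal.ofReal (m * cΦ / 162 * ((ε / 8) ^ 3 * κ) * (3 * (ε / 32) ^ 3 * κ) * a ^ 2 * ξ ^ 7 *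
        (r ^ 4 / (1 + r) ^ 4))
      = ENNReal.ofReal q * (ENNReal.ofReal (δ ^ 3 * κ) *
          ENNReal.ofReal (3 * (ξ * ε / 32) ^ 3 * κ)) := by
        rw [← ENNReal.ofReal_mul (by positivity), ← ENNReal.ofReal_mul hq0]
        congr 1
        rw [hq, hδ]
        field_simp
    _ ≤ ENNReal.ofReal q * ((volume : Measure R3).prod (volume : Measure R3).toSphere) S := by
        rw [hS, Measure.prod_prod, hball]
        gcongr
    _ = ∫⁻ p in S, ENNReal.ofReal q
          ∂((volume : Measure R3).prod (volume : Measure R3).toSphere) := by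
        rw [setLIntegral_const]
    _ ≤ _ := (setLIntegral_mono' hSm hpt).trans (setLIntegral_le_lintegral _ _)

/-! ### Almost everywhere continuity of solutions -/

section

variable {Ω : Set R3} {x v : R3} {T : ℝ}

/-- The first exit point of a backward ray that starts inside `Ω` lies on the boundary, and the ray
does not enter there. -/
theorem IsC2Domain.xB_mem (hΩ : IsC2Domain Ω)
    (h0 : ∀ᶠ s in 𝓝[>] (0 : ℝ), x - s • v ∈ Ω) (hfin : tB Ω x v ≠ ∞) :
    0 < (tB Ω x v).toReal ∧ xB Ω x v ∈ frontier Ω ∧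
      inner ℝ (outwardNormal Ω (xB Ω x v)) v ≤ 0 := by
  obtain ⟨δ, hδ, hsub⟩ := mem_nhdsGT_iff_exists_Ioo_subset.1 h0
  set σ := (tB Ω x v).toReal with hσ
  have hσ' : tB Ω x v = ENNReal.ofReal σ := (ENNReal.ofReal_toReal hfin).symm
  have hle : ∀ {t : ℝ}, 0 < t → (∀ s ∈ Ioo 0 t, x - s • v ∈ Ω) → t ≤ σ := by
    intro t ht h
    rw [← ENNReal.ofReal_le_ofReal_iff ENNReal.toReal_nonneg, ← hσ']
    exact le_iSup₂_of_le t ⟨ht, h⟩ le_rfl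
  have hσ0 : 0 < σ := lt_of_lt_of_le hδ (hle hδ fun s hs => hsub hs)
  have hin : ∀ s ∈ Ioo 0 σ, x - s • v ∈ Ω := by
    intro s hs
    have h1 : ENNReal.ofReal s < tB Ω x v := by
      rw [hσ']; exact (ENNReal.ofReal_lt_ofReal_iff hσ0).2 hs.2
    simp only [tB, lt_iSup_iff] at h1
    obtain ⟨t, ⟨ht0, ht⟩, hst⟩ := h1
    exact ht s ⟨hs.1, (ENNReal.ofReal_lt_ofReal_iff ht0).1 hst⟩
  have hxB : xB Ω x v = x - σ • v := rfl
  have hcl : x - σ • v ∈ closure Ω := by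
    have hc : IsClosed {r : ℝ | x - r • v ∈ closure Ω} := isClosed_closure.preimage (by fun_prop)
    have := hc.closure_subset_iff.2 (show Ioo 0 σ ⊆ _ from fun s hs => subset_closure (hin s hs))
    rw [closure_Ioo hσ0.ne] at this
    exact this ⟨hσ0.le, le_rfl⟩
  have hnot : x - σ • v ∉ Ω := by
    intro hmem
    have hc : Continuous (fun r : ℝ => x - r • v) := by fun_prop
    have hev := hc.continuousAt.eventually (hΩ.isOpen.mem_nhds hmem)
    obtain ⟨η, hη, hη'⟩ := Metric.eventually_nhds_iff.1 hev
    have := hle (t := σ + η) (by linarith) fun s hs => by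
      rcases lt_or_ge s σ with h | h
      · exact hin s ⟨hs.1, h⟩
      · refine hη' ?_
        rw [Real.dist_eq, abs_of_nonneg (by linarith)]
        linarith [hs.2]
    linarith
  have hf : x - σ • v ∈ frontier Ω := (hΩ.mem_or_mem_frontier hcl).resolve_left hnot
  refine ⟨hσ0, hf, ?_⟩
  rw [hxB]
  by_contra hcon
  push Not at hcon
  have h1 := hΩ.eventually_notMem_closure hf hcon
  have h2 : ∀ᶠ s in 𝓝[>] (0 : ℝ), s < σ :=
    (eventually_lt_nhds hσ0).filter_mono nhdsWithin_le_nhds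
  obtain ⟨s, h3, h4, h5⟩ := (h1.and (h2.and self_mem_nhdsWithin)).exists
  refine h3 (subset_closure ?_)
  have := hin (σ - s) ⟨by linarith, by have : 0 < s := h5; linarith⟩
  rwa [sub_smul, ← sub_add] at this

/-- From every point, almost all velocities lead to points of continuity, since grazing velocities
form a null set. -/
theorem IsC2Domain.ae_gammaConti (hΩ : IsC2Domain Ω) (hx : x ∈ closure Ω) (T : ℝ) :
    ∀ᵐ v : R3, ∀ t ∈ Ioo 0 T, (t, x, v) ∈ gammaConti Ω T := by
  have h1 : ∀ᵐ v : R3, v ∉ {v : R3 | ∃ s : ℝ, s > 0 ∧ x - s • v ∈ frontier Ω ∧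
      inner ℝ (outwardNormal Ω (x - s • v)) v = 0} :=
    measure_eq_zero_iff_ae_notMem.1 (hΩ.volume_grazing x)
  have h2 : ∀ᵐ v : R3, x ∈ frontier Ω → inner ℝ (outwardNormal Ω x) v ≠ 0 := by
    by_cases hxf : x ∈ frontier Ω
    · have hn : outwardNormal Ω x ≠ 0 := by
        rw [← norm_ne_zero_iff, hΩ.norm_outwardNormal hxf]; exact one_ne_zero
      filter_upwards [measure_eq_zero_iff_ae_notMem.1 (volume_hyperplane hn)] with v hv _ using hv
    · exact Eventually.of_forall fun v h => absurd h hxf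
  filter_upwards [h1, h2] with v hv1 hv2 t ht
  have key : (∀ᶠ s in 𝓝[>] (0 : ℝ), x - s • v ∈ Ω) → (ENNReal.ofReal t < tB Ω x v ∨
      (xB Ω x v, v) ∈ gammaMinus Ω ∪ gammaZeroMinus Ω) := by
    intro h0
    by_cases hlt : ENNReal.ofReal t < tB Ω x v
    · exact Or.inl hlt
    · have hfin : tB Ω x v ≠ ∞ := ne_top_of_le_ne_top ENNReal.ofReal_ne_top (not_lt.1 hlt)
      obtain ⟨h3, h4, h5⟩ := hΩ.xB_mem h0 hfin
      refine Or.inr (Or.inl ⟨h4, lt_of_le_of_ne h5 fun heq => hv1 ⟨_, h3, h4, heq⟩⟩)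
  rcases hΩ.mem_or_mem_frontier hx with hin | hf
  · refine Or.inr ⟨ht, Or.inl hin, key ?_⟩
    have : Continuous (fun s : ℝ => x - s • v) := by fun_prop
    have h1 : ∀ᶠ s in 𝓝 (0 : ℝ), x - s • v ∈ Ω :=
      this.continuousAt.eventually (hΩ.isOpen.mem_nhds (by simpa using hin))
    exact h1.filter_mono nhdsWithin_le_nhds
  · rcases lt_or_gt_of_ne (hv2 hf) with hneg | hpos
    · exact Or.inl (Or.inr ⟨ht, Or.inl ⟨hf, hneg⟩⟩)
    · exact Or.inr ⟨ht, Or.inr ⟨hf, hpos⟩, key (hΩ.eventually_mem hf hpos)⟩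

variable {Φ b : ℝ → ℝ} {α TB t : ℝ} {f₀ : R3 → R3 → ℝ} {f : ℝ → R3 → R3 → ℝ}

theorem IsContinuousMildSolution.aemeasurable (hf : IsContinuousMildSolution Ω Φ b α TB T f₀ f)
    (hΩ : IsC2Domain Ω) (ht : t ∈ Ioo 0 T) (hx : x ∈ closure Ω) : AEMeasurable (f t x) := by
  have hae := hΩ.ae_gammaConti hx T
  set N : Set R3 := toMeasurable volume {v | ¬ ∀ t ∈ Ioo 0 T, (t, x, v) ∈ gammaConti Ω T} with hN
  have hN0 : volume N = 0 := by rw [hN, measure_toMeasurable]; exact ae_iff.1 hae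
  have hNm : MeasurableSet Nᶜ := (measurableSet_toMeasurable _ _).compl
  have hsub : ∀ v ∈ Nᶜ, (t, x, v) ∈ gammaConti Ω T := by
    intro v hv
    by_contra hcon
    exact hv (subset_toMeasurable _ _ fun h => hcon (h t ht))
  have hc : ContinuousOn (f t x) Nᶜ := by
    have hp : ContinuousOn (fun v : R3 => ((t, x, v) : ℝ × R3 × R3)) Nᶜ := by fun_prop
    exact hf.continuous.comp hp hsub
  have h1 := hc.aemeasurable (μ := volume) hNm
  rwa [Measure.restrict_eq_self_of_ae_mem (by
    filter_upwards [measure_eq_zero_iff_ae_notMem.1 hN0] with v hv using hv)] at h1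

/-- A bound on the collision frequencies that is uniform up to the boundary, where the velocity
integrals are controlled only in the interior. -/
theorem exists_loss_bound (hΩ : IsC2Domain Ω) {γ cΦ CΦ : ℝ} (hγ : γ ∈ Ioc (-3 : ℝ) 1) (hcΦ : 0 < cΦ)
    (hCΦ : 0 < CΦ) {b : ℝ → ℝ} {ν b₀ : ℝ} (hν : ν < 0) (hb : IsAngularFactor b ν b₀)
    (E Λ p : ℝ) (hp : γ < 0 → 3 / (3 + γ) < p) (α TB T : ℝ) : ∃ C > 0, ∀ Φ f₀ f,
      IsKineticFactor Φ γ cΦ CΦ → IsContinuousMildSolution Ω Φ b α TB T f₀ f →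
      energyBound Ω T f ≤ ENNReal.ofReal E → (γ < 0 → lpBound Ω T p f ≤ ENNReal.ofReal Λ) →
      ∀ t ∈ Ioo 0 T, ∀ x ∈ closure Ω, ∀ v,
        Lloss Φ b (f t x) v ≤ ENNReal.ofReal (C * (1 + ‖v‖)) := by
  obtain ⟨D, hD, HD⟩ := hb.exists_lintegral_le hν
  obtain ⟨K, hK, HK⟩ := exists_lintegral_kinWeight_le (CΦ := CΦ) hγ.1 E Λ p hp
  refine ⟨(D.toReal + 1) * K, by positivity, fun Φ f₀ f hΦ hf hE hΛ t ht x hx v => ?_⟩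
  have ht' : t ∈ Ico 0 T := ⟨ht.1.le, ht.2⟩
  -- The interior bound.
  have hint : ∀ y ∈ Ω, ∫⁻ w, kinWeight γ CΦ (v - w) * ENNReal.ofReal (f t y w) ≤
      ENNReal.ofReal (K * (1 + ‖v‖)) := by
    intro y hy
    refine HK _ (hf.aemeasurable hΩ ht (subset_closure hy))
      (hf.nonneg t ht' y (subset_closure hy)) ?_ (fun hneg => ?_) v
    · refine le_trans ?_ hE
      exact le_trans (le_iSup₂_of_le (f := fun (y : R3) (_ : y ∈ Ω) =>
        ((∫⁻ v, ENNReal.ofReal (‖v‖ ^ 2 * f t y v)) + ∫⁻ v, ENNReal.ofReal (f t y v ^ 2))) y hy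
            le_rfl)
        (le_iSup₂_of_le (f := fun (t : ℝ) (_ : t ∈ Ico 0 T) => ⨆ y ∈ Ω,
        ((∫⁻ v, ENNReal.ofReal (‖v‖ ^ 2 * f t y v)) + ∫⁻ v, ENNReal.ofReal (f t y v ^ 2))) t ht'
            le_rfl)
    · refine le_trans ?_ (hΛ hneg)
      exact le_trans (le_iSup₂_of_le (f := fun (y : R3) (_ : y ∈ Ω) =>
        (∫⁻ v, ENNReal.ofReal (f t y v) ^ p) ^ (1 / p)) y hy le_rfl)
        (le_iSup₂_of_le (f := fun (t : ℝ) (_ : t ∈ Ico 0 T) => ⨆ y ∈ Ω,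
        (∫⁻ v, ENNReal.ofReal (f t y v) ^ p) ^ (1 / p)) t ht' le_rfl)
  -- At the boundary, Fatou's lemma along interior points, using a.e. continuity.
  have hbd : ∫⁻ w, kinWeight γ CΦ (v - w) * ENNReal.ofReal (f t x w) ≤
      ENNReal.ofReal (K * (1 + ‖v‖)) := by
    obtain ⟨y, hyΩ, hy⟩ := mem_closure_iff_seq_limit.1 hx
    have hae : ∀ᵐ w : R3, ∀ n, (t, y n, w) ∈ gammaConti Ω T := by
      rw [ae_all_iff]
      intro n
      filter_upwards [hΩ.ae_gammaConti (subset_closure (hyΩ n)) T] with w hw using hw t ht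
    have hlim : ∀ᵐ w : R3, Tendsto (fun n => f t (y n) w) atTop (𝓝 (f t x w)) := by
      filter_upwards [hae, hΩ.ae_gammaConti hx T] with w hw1 hw2
      have h1 : Tendsto (fun n => ((t, y n, w) : ℝ × R3 × R3)) atTop
          (𝓝[gammaConti Ω T] (t, x, w)) := by
        refine tendsto_nhdsWithin_iff.2 ⟨?_, Eventually.of_forall hw1⟩
        exact tendsto_const_nhds.prodMk_nhds (hy.prodMk_nhds tendsto_const_nhds)
      exact (hf.continuous _ (hw2 t ht)).tendsto.comp h1
    have hfin : ∀ᵐ w : R3, kinWeight γ CΦ (v - w) ≠ ∞ := Eventually.of_forall fun w => by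
      unfold kinWeight
      refine (ENNReal.mul_lt_top ENNReal.ofReal_lt_top
        (ENNReal.add_lt_top.2 ⟨ENNReal.ofReal_lt_top, ?_⟩)).ne
      split_ifs
      · by_cases h : v - w ∈ Metric.ball (0 : R3) 1
        · rw [indicator_of_mem h]; exact ENNReal.ofReal_lt_top
        · rw [indicator_of_notMem h]; simp
      · simp
    calc ∫⁻ w, kinWeight γ CΦ (v - w) * ENNReal.ofReal (f t x w)
        = ∫⁻ w, liminf (fun n => kinWeight γ CΦ (v - w) * ENNReal.ofReal (f t (y n) w)) atTop := by
          refine lintegral_congr_ae ?_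
          filter_upwards [hlim, hfin] with w hw1 hw2
          exact ((ENNReal.Tendsto.const_mul (ENNReal.tendsto_ofReal hw1)
              (Or.inr hw2)).liminf_eq).symm
      _ ≤ liminf (fun n => ∫⁻ w, kinWeight γ CΦ (v - w) * ENNReal.ofReal (f t (y n) w)) atTop := by
          refine lintegral_liminf_le' fun n => ?_
          exact ((measurable_kinWeight γ CΦ).comp (measurable_const.sub
              measurable_id)).aemeasurable.mul
            (hf.aemeasurable hΩ ht (subset_closure (hyΩ n))).ennreal_ofReal
      _ ≤ ENNReal.ofReal (K * (1 + ‖v‖)) := by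
          refine (liminf_le_liminf (v := fun _ => ENNReal.ofReal (K * (1 + ‖v‖)))
            (Eventually.of_forall fun n => hint _ (hyΩ n))).trans ?_
          rw [liminf_const]
  refine (Lloss_le hΦ hcΦ hCΦ hγ.2 hD HD (hf.nonneg t ht' x hx) v).trans ?_
  rw [mul_assoc, ENNReal.ofReal_mul (by positivity)]
  refine mul_le_mul' ?_ hbd
  rw [← ENNReal.ofReal_toReal hD.ne]
  exact ENNReal.ofReal_le_ofReal (by simp)

end

/-- A mild solution with a collision frequency that grows at most linearly in the velocity: the
setting in which positivity is propagated. -/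
structure IsControlledSolution (Ω : Set R3) (b : ℝ → ℝ) (α TB T γ cΦ CΦ CL : ℝ) (Φ : ℝ → ℝ)
    (f₀ : R3 → R3 → ℝ) (f : ℝ → R3 → R3 → ℝ) : Prop where
  kinetic : IsKineticFactor Φ γ cΦ CΦ
  mild : IsContinuousMildSolution Ω Φ b α TB T f₀ f
  loss : ∀ t ∈ Ioo 0 T, ∀ x ∈ closure Ω, ∀ v,
    Lloss Φ b (f t x) v ≤ ENNReal.ofReal (CL * (1 + ‖v‖))

/-! ### Localisation of the initial mass -/

section

variable {Ω : Set R3} {Φ b : ℝ → ℝ} {α TB T : ℝ} {f₀ : R3 → R3 → ℝ} {f : ℝ → R3 → R3 → ℝ}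

theorem IsContinuousMildSolution.eq_init (hf : IsContinuousMildSolution Ω Φ b α TB T f₀ f)
    (hT : 0 < T) {x : R3} (hx : x ∈ closure Ω) (v : R3) : f 0 x v = f₀ x v := by
  have h := hf.duhamel_initial 0 ⟨le_rfl, hT⟩ x hx v (by simp)
  rw [damping_self, gain_self, mul_one, add_zero] at h
  have e : ray 0 x v 0 = x := by simp [ray]
  rw [e, ENNReal.ofReal_eq_ofReal_iff (hf.nonneg 0 ⟨le_rfl, hT⟩ x hx v)
    (hf.init_nonneg x hx v)] at h
  exact h

/-- If the initial datum is small on `K × {|v| < R}`, then its mass is bounded by a quantity that is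
small when `K` exhausts `Ω` and `R` is large. -/
theorem totalMass_le (hΩ : IsC2Domain Ω) {g : R3 → R3 → ℝ} {K : Set R3} (hK : MeasurableSet K)
    (hg0 : ∀ x ∈ Ω, ∀ v, 0 ≤ g x v) (hgc : ∀ x ∈ Ω, Continuous (g x)) {κ R E : ℝ}
    (hR : 0 < R) (hE : ∀ x ∈ Ω, ((∫⁻ v, ENNReal.ofReal (‖v‖ ^ 2 * g x v)) +
      ∫⁻ v, ENNReal.ofReal (g x v ^ 2)) ≤ ENNReal.ofReal E)
    (hsmall : ∀ x ∈ K, ∀ v, ‖v‖ < R → g x v ≤ κ) :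
    totalMass Ω g ≤ ENNReal.ofReal κ * volume (Metric.ball (0 : R3) R) * volume Ω +
      (volume (Metric.ball (0 : R3) R) + ENNReal.ofReal E) * volume (Ω \ K) +
      ENNReal.ofReal (R ^ 2)⁻¹ * ENNReal.ofReal E * volume Ω := by
  set β := volume (Metric.ball (0 : R3) R) with hβ
  have hΩm : MeasurableSet Ω := hΩ.isOpen.measurableSet
  have hinner : ∀ x ∈ Ω, ∫⁻ v, ENNReal.ofReal (g x v) ≤ ENNReal.ofReal κ * β +
      ((Ω \ K).indicator (fun _ => β + ENNReal.ofReal E) x +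
        ENNReal.ofReal (R ^ 2)⁻¹ * ENNReal.ofReal E) := by
    intro x hx
    set χ : ℝ≥0∞ := (Ω \ K).indicator (fun _ => 1) x with hχ
    have hχfin : χ ≠ ∞ := by
      rw [hχ]; by_cases h : x ∈ Ω \ K
      · rw [indicator_of_mem h]; simp
      · rw [indicator_of_notMem h]; simp
    have hgm : Measurable (g x) := (hgc x hx).measurable
    calc ∫⁻ v, ENNReal.ofReal (g x v)
        ≤ ∫⁻ v, ((Metric.ball (0 : R3) R).indicator (fun _ => ENNReal.ofReal κ) v +
          (χ * ((Metric.ball (0 : R3) R).indicator (fun _ => 1) v + ENNReal.ofReal (g x v ^ 2)) +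
            ENNReal.ofReal (R ^ 2)⁻¹ * ENNReal.ofReal (‖v‖ ^ 2 * g x v))) := by
          refine lintegral_mono fun v => ?_
          by_cases hv : v ∈ Metric.ball (0 : R3) R
          · rw [indicator_of_mem hv, indicator_of_mem hv]
            have hv' : ‖v‖ < R := by simpa using hv
            by_cases hxK : x ∈ K
            · exact (ENNReal.ofReal_le_ofReal (hsmall x hxK v hv')).trans le_self_add
            · have : χ = 1 := by rw [hχ, indicator_of_mem (show x ∈ Ω \ K from ⟨hx, hxK⟩)]
              rw [this, one_mul]
              refine le_trans ?_ (le_self_add.trans le_add_self)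
              rw [← ENNReal.ofReal_one, ← ENNReal.ofReal_add zero_le_one (by positivity)]
              refine ENNReal.ofReal_le_ofReal ?_
              nlinarith [sq_nonneg (g x v - 1), hg0 x hx v]
          · refine le_trans ?_ (le_add_self.trans le_add_self)
            have hv' : R ≤ ‖v‖ := by simpa using hv
            rw [← ENNReal.ofReal_mul (by positivity)]
            refine ENNReal.ofReal_le_ofReal ?_
            rw [← mul_assoc]
            refine le_mul_of_one_le_left (hg0 x hx v) ?_
            rw [inv_mul_eq_div, one_le_div (by positivity)]
            gcongr
      _ = ENNReal.ofReal κ * β + (χ * (β + ∫⁻ v, ENNReal.ofReal (g x v ^ 2)) +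
            ENNReal.ofReal (R ^ 2)⁻¹ * ∫⁻ v, ENNReal.ofReal (‖v‖ ^ 2 * g x v)) := by
          rw [lintegral_add_left (measurable_const.indicator measurableSet_ball),
            lintegral_indicator_const measurableSet_ball,
            lintegral_add_right _ (by fun_prop), lintegral_const_mul' _ _ hχfin,
            lintegral_add_left (measurable_const.indicator measurableSet_ball),
            lintegral_indicator_const measurableSet_ball, one_mul,
            lintegral_const_mul' _ _ ENNReal.ofReal_ne_top]
      _ ≤ _ := by
          have e : (Ω \ K).indicator (fun _ => β + ENNReal.ofReal E) x =
              χ * (β + ENNReal.ofReal E) := by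
            rw [hχ]; by_cases h : x ∈ Ω \ K
            · rw [indicator_of_mem h, indicator_of_mem h, one_mul]
            · rw [indicator_of_notMem h, indicator_of_notMem h, zero_mul]
          rw [e]
          gcongr
          · exact le_add_self.trans (hE x hx)
          · exact le_self_add.trans (hE x hx)
  calc totalMass Ω g ≤ ∫⁻ x in Ω, ∫⁻ v, ENNReal.ofReal (g x v) := by
        rw [totalMass, Measure.volume_eq_prod, ← Measure.prod_restrict, Measure.restrict_univ]
        exact lintegral_prod_le _
    _ ≤ ∫⁻ x in Ω, (ENNReal.ofReal κ * β +
      ((Ω \ K).indicator (fun _ => β + ENNReal.ofReal E) x +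
        ENNReal.ofReal (R ^ 2)⁻¹ * ENNReal.ofReal E)) := setLIntegral_mono' hΩm hinner
    _ = _ := by
        rw [lintegral_add_left measurable_const,
          lintegral_add_left (measurable_const.indicator (hΩm.diff hK)),
          setLIntegral_const, setLIntegral_const, lintegral_indicator_const (hΩm.diff hK),
          Measure.restrict_apply (hΩm.diff hK), inter_eq_left.2 sdiff_subset, add_assoc]

/-- The initial datum is bounded below on a product of balls of fixed size, centred in a fixed
compact set. By `totalMass_le`, with `R` and `K` chosen so that at most half of the mass lies in
`{|v| ≥ R}` or above `Ω \ K`, the datum exceeds a fixed value at some point of `K × {|v| < R}`; the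
modulus of continuity extends this to a neighbourhood of fixed size. -/
theorem exists_initial_bump (hΩ : IsC2Domain Ω) {M : ℝ} (hM : 0 < M) (E : ℝ) {ω : ℝ → ℝ}
    (hω : Tendsto ω (𝓝[≥] 0) (𝓝 0)) : ∃ κ > 0, ∃ δ > 0, ∃ K, IsCompact K ∧ K ⊆ Ω ∧ ∃ R > 0,
      ∀ g : R3 → R3 → ℝ, (∀ x ∈ closure Ω, ∀ v, 0 ≤ g x v) →
      ContinuousOn (fun p : R3 × R3 => g p.1 p.2) (closure Ω ×ˢ univ) → HasModulus Ω ω g →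
      totalMass Ω g = ENNReal.ofReal M →
      (∀ x ∈ Ω, ((∫⁻ v, ENNReal.ofReal (‖v‖ ^ 2 * g x v)) +
        ∫⁻ v, ENNReal.ofReal (g x v ^ 2)) ≤ ENNReal.ofReal E) →
      ∃ x₁ ∈ K, ∃ v₁ : R3, ‖v₁‖ < R ∧ ∀ x ∈ closure Ω, ‖x - x₁‖ < δ → ∀ v, ‖v - v₁‖ < δ →
        κ ≤ g x v := by
  have hΩm : MeasurableSet Ω := hΩ.isOpen.measurableSet
  have hΩfin : volume Ω ≠ ∞ := hΩ.isBounded.measure_lt_top.ne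
  set W := (volume Ω).toReal with hW
  have hWe : volume Ω = ENNReal.ofReal W := (ENNReal.ofReal_toReal hΩfin).symm
  have hW0 : 0 ≤ W := ENNReal.toReal_nonneg
  set E' := max E 0 with hE'
  have hEE : ENNReal.ofReal E = ENNReal.ofReal E' := by
    rw [hE', ENNReal.ofReal_max, ENNReal.ofReal_zero, max_eq_left (zero_le)]
  have hE0 : 0 ≤ E' := le_max_right _ _
  obtain ⟨R, hR, hRle⟩ : ∃ R : ℝ, 0 < R ∧ (R ^ 2)⁻¹ * E' * W ≤ M / 4 := by
    refine ⟨√(4 * (E' * W + 1) / M), by positivity, ?_⟩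
    rw [Real.sq_sqrt (by positivity), inv_div, mul_assoc, div_mul_eq_mul_div,
      div_le_div_iff₀ (by positivity) (by norm_num)]
    nlinarith [mul_nonneg hE0 hW0]
  have hβfin : volume (Metric.ball (0 : R3) R) ≠ ∞ := measure_ball_lt_top.ne
  set β := (volume (Metric.ball (0 : R3) R)).toReal with hβ
  have hβe : volume (Metric.ball (0 : R3) R) = ENNReal.ofReal β :=
    (ENNReal.ofReal_toReal hβfin).symm
  have hβ0 : 0 ≤ β := ENNReal.toReal_nonneg
  obtain ⟨K, hKsub, hKc, hKlt⟩ := hΩm.exists_isCompact_sdiff_lt hΩfin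
    (ε := ENNReal.ofReal (M / (4 * (β + E' + 1)))) (by
      rw [ne_eq, ENNReal.ofReal_eq_zero, not_le]; positivity)
  obtain ⟨δ, hδ, hωδ⟩ : ∃ δ > 0, ∀ s, 0 ≤ s → s < δ → ω s ≤ M / (8 * (β * W + 1)) := by
    have h1 : ∀ᶠ s in 𝓝[≥] (0 : ℝ), ω s < M / (8 * (β * W + 1)) :=
      hω.eventually_lt_const (by positivity)
    obtain ⟨δ, hδ, hsub⟩ := mem_nhdsGE_iff_exists_Ico_subset.1 h1
    exact ⟨δ, hδ, fun s h0 h1 => (hsub ⟨h0, h1⟩).le⟩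
  refine ⟨M / (8 * (β * W + 1)), by positivity, δ / 2, by positivity, K, hKc, hKsub, R, hR, ?_⟩
  intro g hg0 hgc hmod hmass hE
  have hex : ∃ x ∈ K, ∃ v : R3, ‖v‖ < R ∧ M / (4 * (β * W + 1)) < g x v := by
    by_contra hcon
    push Not at hcon
    have h1 := totalMass_le hΩ hKc.measurableSet (fun x hx => hg0 x (subset_closure hx))
      (fun x hx => by
        have hp : Continuous (fun v : R3 => ((x, v) : R3 × R3)) := by fun_prop
        exact hgc.comp_continuous hp fun v => ⟨subset_closure hx, mem_univ _⟩)
      hR hE hcon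
    rw [hmass, hWe, hβe, hEE, ← ENNReal.ofReal_mul (by positivity),
      ← ENNReal.ofReal_mul (by positivity),
      ← ENNReal.ofReal_add hβ0 hE0, ← ENNReal.ofReal_mul (by positivity),
      ← ENNReal.ofReal_mul (by positivity)] at h1
    have h2 : ENNReal.ofReal (β + E') * volume (Ω \ K) ≤ ENNReal.ofReal (M / 4) := by
      refine (mul_le_mul_right hKlt.le _).trans ?_
      rw [← ENNReal.ofReal_mul (by positivity)]
      refine ENNReal.ofReal_le_ofReal ?_
      rw [mul_div_assoc', div_le_div_iff₀ (by positivity) (by norm_num)]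
      nlinarith
    have h3 : ENNReal.ofReal (M / (4 * (β * W + 1)) * β * W) ≤ ENNReal.ofReal (M / 4) := by
      refine ENNReal.ofReal_le_ofReal ?_
      rw [mul_assoc, div_mul_eq_mul_div, div_le_div_iff₀ (by positivity) (by norm_num)]
      nlinarith [mul_nonneg hβ0 hW0]
    have h4 := h1.trans (add_le_add (add_le_add h3 h2) (ENNReal.ofReal_le_ofReal hRle))
    rw [← ENNReal.ofReal_add (by positivity) (by positivity),
      ← ENNReal.ofReal_add (by positivity) (by positivity),
      ENNReal.ofReal_le_ofReal_iff (by positivity)] at h4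
    linarith
  obtain ⟨x₁, hx₁, v₁, hv₁, hlt⟩ := hex
  refine ⟨x₁, hx₁, v₁, hv₁, fun x hx hxx v hvv => ?_⟩
  have h1 := hmod x₁ (subset_closure (hKsub hx₁)) x hx v₁ v
  have h2 := hωδ (‖x₁ - x‖ + ‖v₁ - v‖) (by positivity) (by
    rw [norm_sub_rev x₁, norm_sub_rev v₁]; linarith)
  have h3 := (abs_le.1 (h1.trans h2)).2
  have h4 : M / (4 * (β * W + 1)) = 2 * (M / (8 * (β * W + 1))) := by field_simp; norm_num
  linarith

end

/-! ### Propagation of positivity in the interior -/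

section

variable {Ω : Set R3} {b : ℝ → ℝ} {α TB T γ cΦ CΦ CL : ℝ}

section

variable {Φ : ℝ → ℝ} {f₀ : R3 → R3 → ℝ} {f : ℝ → R3 → R3 → ℝ}

/-- The lower bound given by Duhamel's formula along a ray inside `closure Ω`. -/
theorem IsControlledSolution.lower (hF : IsControlledSolution Ω b α TB T γ cΦ CΦ CL Φ f₀ f)
    (hCL : 0 < CL) {a t : ℝ} {x v : R3} (ha : 0 ≤ a) (hat : a ≤ t) (ht : t < T)
    (hx : x ∈ closure Ω) (hray : ∀ r ∈ Icc 0 (t - a), x - r • v ∈ closure Ω) {q : ℝ} (hq : 0 ≤ q)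
    (hQ : ∀ r ∈ Ioc a t, ENNReal.ofReal q ≤
      Qplus Φ b (f r (ray t x v r)) (f r (ray t x v r)) v) :
    Real.exp (-(CL * (1 + ‖v‖) * (t - a))) * (f a (ray t x v a) v + q * (t - a)) ≤ f t x v := by
  refine hF.mild.lower_of_ray ⟨ha.trans hat, ht⟩ hx ha hat hray (by positivity) hq
    (fun r hr => hF.loss r ⟨ha.trans_lt hr.1, hr.2.trans_lt ht⟩ _ ?_ v) hQ
  exact hray (t - r) ⟨by linarith [hr.2], by linarith [hr.1]⟩

/-- Free transport along a ray inside `closure Ω`, with damping. -/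
theorem IsControlledSolution.transport (hF : IsControlledSolution Ω b α TB T γ cΦ CΦ CL Φ f₀ f)
    (hCL : 0 < CL) {a t : ℝ} {x v : R3} (ha : 0 ≤ a) (hat : a ≤ t) (ht : t < T)
    (hx : x ∈ closure Ω) (hray : ∀ r ∈ Icc 0 (t - a), x - r • v ∈ closure Ω) :
    Real.exp (-(CL * (1 + ‖v‖) * (t - a))) * f a (ray t x v a) v ≤ f t x v := by
  simpa using hF.lower hCL ha hat ht hx hray le_rfl (by simp)

end

variable {ι : Type*} {Φ : ι → ℝ → ℝ} {f₀ : ι → R3 → R3 → ℝ} {f : ι → ℝ → R3 → R3 → ℝ} {ν b₀ : ℝ}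

/-- One collision enlarges the ball of velocities on which a family of solutions is bounded below,
at the expense of a slightly smaller ball of positions and a slightly later time. -/
theorem spread_step (hF : ∀ i, IsControlledSolution Ω b α TB T γ cΦ CΦ CL (Φ i) (f₀ i) (f i))
    (hCL : 0 < CL) (hb : IsAngularFactor b ν b₀) (hγ : γ ∈ Ioc (-3 : ℝ) 1) (hcΦ : 0 < cΦ)
    {s₁ s₂ s₁' ρ ρ' r a : ℝ} {x₀ V : R3} (hs₁ : 0 ≤ s₁) (hs₂ : s₂ ≤ T) (hs : s₁ < s₁') (hρ : ρ' < ρ)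
    (hr : 0 < r) (ha : 0 < a) (hball : Metric.ball x₀ ρ ⊆ closure Ω)
    (h : ∀ i, ∀ t ∈ Ioo s₁ s₂, ∀ x ∈ Metric.ball x₀ ρ, ∀ v, ‖v - V‖ < r → a ≤ f i t x v) :
    ∃ a' > 0, ∀ i, ∀ t ∈ Ioo s₁' s₂, ∀ x ∈ Metric.ball x₀ ρ', ∀ v, ‖v - V‖ < 5 / 4 * r →
      a' ≤ f i t x v := by
  obtain ⟨c, hc, H⟩ := exists_spread hb hγ hcΦ
  set q := c * a ^ 2 * (1 / 10) ^ 7 * (r ^ 4 / (1 + r) ^ 4) with hq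
  have hq0 : 0 < q := by positivity
  set m := ‖V‖ + 2 * r with hm
  have hm0 : 0 < m := by positivity
  set d := min (s₁' - s₁) ((ρ - ρ') / m) / 2 with hd
  have hρ0 : 0 < ρ - ρ' := by linarith
  have hs0 : 0 < s₁' - s₁ := by linarith
  have hmin : 0 < min (s₁' - s₁) ((ρ - ρ') / m) := lt_min hs0 (by positivity)
  have hd0 : 0 < d := by positivity
  have hd1 : d < s₁' - s₁ := by
    have := min_le_left (s₁' - s₁) ((ρ - ρ') / m)
    simp only [hd]; linarith
  have hd2 : d * m < ρ - ρ' := by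
    have := min_le_right (s₁' - s₁) ((ρ - ρ') / m)
    rw [← lt_div_iff₀ hm0]
    have : 0 < (ρ - ρ') / m := by positivity
    simp only [hd]; linarith
  refine ⟨Real.exp (-(CL * (1 + m) * d)) * (q * d), by positivity, fun i t ht x hx v hv => ?_⟩
  have hvm : ‖v‖ ≤ m := by
    have := norm_le_norm_add_norm_sub' v V
    simp only [hm]; linarith
  have hin : ∀ s ∈ Icc 0 d, x - s • v ∈ Metric.ball x₀ ρ := by
    intro s hs
    rw [Metric.mem_ball] at hx ⊢
    have h1 : dist (x - s • v) x ≤ d * m := by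
      rw [dist_eq_norm, sub_sub_cancel_left, norm_neg, norm_smul, Real.norm_of_nonneg hs.1]
      exact mul_le_mul hs.2 hvm (norm_nonneg _) hd0.le
    linarith [dist_triangle (x - s • v) x x₀]
  have hQ : ∀ s ∈ Ioc (t - d) t, ENNReal.ofReal q ≤
      Qplus (Φ i) b (f i s (ray t x v s)) (f i s (ray t x v s)) v := by
    intro s hs
    refine H (Φ i) CΦ (hF i).kinetic _ V r a (1 / 10) hr ha.le (by norm_num) (by norm_num) ?_ v ?_
    · exact fun w hw => h i s ⟨by linarith [ht.1, hs.1], by linarith [ht.2, hs.2]⟩ _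
        (hin (t - s) ⟨by linarith [hs.2], by linarith [hs.1]⟩) w hw
    · have : (139 / 100 : ℝ) ≤ √2 := Real.le_sqrt_of_sq_le (by norm_num)
      nlinarith [mul_le_mul_of_nonneg_right this hr.le]
  have h1 := (hF i).lower hCL (a := t - d) (by linarith [ht.1]) (by linarith) (by linarith [ht.2])
    (hball (by simpa using hin 0 ⟨le_rfl, hd0.le⟩))
    (fun s hs => hball (hin s (by rwa [sub_sub_cancel] at hs))) hq0.le hQ
  refine le_trans ?_ h1
  rw [sub_sub_cancel]
  refine mul_le_mul (Real.exp_le_exp.2 (by gcongr)) ?_ (by positivity) (Real.exp_pos _).le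
  refine le_add_of_nonneg_left ((hF i).mild.nonneg _ ⟨by linarith [ht.1], by linarith [ht.2]⟩ _
    (hball ?_) _)
  rw [ray, sub_sub_cancel]
  exact hin d ⟨hd0.le, le_rfl⟩

/-- Repeated collisions fill any ball of velocities. -/
theorem spread_all (hF : ∀ i, IsControlledSolution Ω b α TB T γ cΦ CΦ CL (Φ i) (f₀ i) (f i))
    (hCL : 0 < CL) (hb : IsAngularFactor b ν b₀) (hγ : γ ∈ Ioc (-3 : ℝ) 1) (hcΦ : 0 < cΦ)
    {s₁ s₂ s₁' ρ ρ' r a : ℝ} {x₀ V : R3} (hs₁ : 0 ≤ s₁) (hs₂ : s₂ ≤ T) (hs : s₁ < s₁') (hρ : ρ' < ρ)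
    (hr : 0 < r) (ha : 0 < a) (hball : Metric.ball x₀ ρ ⊆ closure Ω)
    (h : ∀ i, ∀ t ∈ Ioo s₁ s₂, ∀ x ∈ Metric.ball x₀ ρ, ∀ v, ‖v - V‖ < r → a ≤ f i t x v) (R : ℝ) :
    ∃ a' > 0, ∀ i, ∀ t ∈ Ioo s₁' s₂, ∀ x ∈ Metric.ball x₀ ρ', ∀ v, ‖v‖ ≤ R → a' ≤ f i t x v := by
  have key : ∀ n : ℕ, ∀ s ρ'', s₁ < s → ρ'' < ρ → ∃ a' > 0, ∀ i, ∀ t ∈ Ioo s s₂,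
      ∀ x ∈ Metric.ball x₀ ρ'', ∀ v, ‖v - V‖ < (5 / 4) ^ n * r → a' ≤ f i t x v := by
    intro n
    induction n with
    | zero =>
      intro s ρ'' hs hρ
      refine ⟨a, ha, fun i t ht x hx v hv => h i t ⟨hs.trans ht.1, ht.2⟩ x
        (Metric.ball_subset_ball hρ.le hx) v (by simpa using hv)⟩
    | succ n ih =>
      intro s ρ'' hs hρ
      obtain ⟨a', ha', h'⟩ := ih ((s₁ + s) / 2) ((ρ + ρ'') / 2) (by linarith) (by linarith)
      obtain ⟨a'', ha'', h''⟩ := spread_step hF hCL hb hγ hcΦ (s₁' := s) (ρ' := ρ'') (by linarith)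
          hs₂
        (by linarith) (by linarith) (by positivity : 0 < (5 / 4) ^ n * r) ha'
        ((Metric.ball_subset_ball (by linarith)).trans hball) h'
      refine ⟨a'', ha'', fun i t ht x hx v hv => h'' i t ht x hx v ?_⟩
      rw [pow_succ] at hv
      linarith
  obtain ⟨n, hn⟩ := pow_unbounded_of_one_lt ((R + ‖V‖) / r) (by norm_num : (1 : ℝ) < 5 / 4)
  obtain ⟨a', ha', h'⟩ := key n s₁' ρ' hs hρ
  refine ⟨a', ha', fun i t ht x hx v hv => h' i t ht x hx v ?_⟩
  rw [div_lt_iff₀ hr] at hn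
  linarith [norm_sub_le v V]

/-- Slow particles hardly move: a lower bound for all velocities on a short time interval persists,
after one more use of collisions, up to the final time. -/
theorem persist (hF : ∀ i, IsControlledSolution Ω b α TB T γ cΦ CΦ CL (Φ i) (f₀ i) (f i))
    (hCL : 0 < CL) (hT : 0 < T) (hb : IsAngularFactor b ν b₀) (hγ : γ ∈ Ioc (-3 : ℝ) 1)
    (hcΦ : 0 < cΦ)
    {s₁ s₂ s₁' ρ r a : ℝ} {x₀ V : R3} (hs₁ : 0 ≤ s₁) (hs₁₂ : s₁ < s₂) (hs₂ : s₂ ≤ T) (hs : s₁ < s₁')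
    (hρ : 0 < ρ) (hr : 0 < r) (ha : 0 < a) (hball : Metric.ball x₀ ρ ⊆ closure Ω)
    (h : ∀ i, ∀ t ∈ Ioo s₁ s₂, ∀ x ∈ Metric.ball x₀ ρ, ∀ v, ‖v - V‖ < r → a ≤ f i t x v) (R : ℝ) :
    ∃ a' > 0, ∀ i, ∀ t ∈ Ioo s₁' T, ∀ x ∈ Metric.ball x₀ (ρ / 5), ∀ v, ‖v‖ ≤ R →
      a' ≤ f i t x v := by
  set e := min (s₂ - s₁) (s₁' - s₁) with he
  have he0 : 0 < e := lt_min (by linarith) (by linarith)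
  have he1 : e ≤ s₂ - s₁ := min_le_left _ _
  have he2 : e ≤ s₁' - s₁ := min_le_right _ _
  set η := ρ / (5 * T) with hη
  have hη0 : 0 < η := by positivity
  -- Particles slower than `η` move by less than `ρ / 5` until the time `T`.
  obtain ⟨a', ha', h'⟩ := spread_all hF hCL hb hγ hcΦ (s₁' := s₁ + e / 3) (ρ' := 3 / 5 * ρ)
    hs₁ hs₂ (by linarith) (by linarith) hr ha hball h η
  set m := CL * (1 + η) * T with hm
  have h1 : ∀ i, ∀ t ∈ Ioo (s₁ + e / 2) T, ∀ x ∈ Metric.ball x₀ (2 / 5 * ρ), ∀ v, ‖v - 0‖ < η →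
      Real.exp (-m) * a' ≤ f i t x v := by
    intro i t ht x hx v hv
    rw [sub_zero] at hv
    have hin : ∀ s ∈ Icc 0 (t - (s₁ + e / 2)), x - s • v ∈ Metric.ball x₀ (3 / 5 * ρ) := by
      intro s hs
      rw [Metric.mem_ball] at hx ⊢
      have h1 : dist (x - s • v) x ≤ T * η := by
        rw [dist_eq_norm, sub_sub_cancel_left, norm_neg, norm_smul, Real.norm_of_nonneg hs.1]
        exact mul_le_mul (by linarith [hs.2, ht.2]) hv.le (norm_nonneg _) hT.le
      have h2 : T * η = 1 / 5 * ρ := by rw [hη]; field_simp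
      linarith [dist_triangle (x - s • v) x x₀]
    have hsub : Metric.ball x₀ (3 / 5 * ρ) ⊆ closure Ω :=
      (Metric.ball_subset_ball (by linarith)).trans hball
    refine le_trans ?_ ((hF i).transport hCL (a := s₁ + e / 2) (by linarith) ht.1.le ht.2
      (hsub (by simpa using hin 0 ⟨le_rfl, by linarith [ht.1]⟩)) fun s hs => hsub (hin s hs))
    refine mul_le_mul (Real.exp_le_exp.2 (neg_le_neg ?_)) ?_ ha'.le (Real.exp_pos _).le
    · rw [hm]
      have : t - (s₁ + e / 2) ≤ T := by linarith [ht.2]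
      have : 0 ≤ t - (s₁ + e / 2) := by linarith [ht.1]
      gcongr
    · exact h' i _ ⟨by linarith, by linarith⟩ _ (hin _ ⟨by linarith [ht.1], le_rfl⟩) v hv.le
  exact spread_all hF hCL hb hγ hcΦ (by linarith) le_rfl (by linarith)
    (by linarith) hη0 (by positivity) ((Metric.ball_subset_ball (by linarith)).trans hball) h1 R

/-- A family of solutions is uniformly positive near `x₀` at positive times: for all times after any
given `s > 0` and velocities in any given ball, with bounds independent of the member of the
family. -/
def IsPositiveNear (T : ℝ) (f : ι → ℝ → R3 → R3 → ℝ) (x₀ : R3) : Prop :=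
  ∀ s > 0, ∀ R : ℝ, ∃ ρ > 0, ∃ a > 0, ∀ i, ∀ t ∈ Ioo s T, ∀ x ∈ Metric.ball x₀ ρ, ∀ v, ‖v‖ ≤ R →
    a ≤ f i t x v

/-- A bump of the initial data survives for a short time, and then spreads and persists. -/
theorem isPositiveNear_of_initial
    (hF : ∀ i, IsControlledSolution Ω b α TB T γ cΦ CΦ CL (Φ i) (f₀ i) (f i))
    (hCL : 0 < CL) (hT : 0 < T) (hb : IsAngularFactor b ν b₀) (hγ : γ ∈ Ioc (-3 : ℝ) 1)
    (hcΦ : 0 < cΦ)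
    {x₁ v₁ : R3} {δ κ : ℝ} (hδ : 0 < δ) (hκ : 0 < κ) (hball : Metric.ball x₁ δ ⊆ closure Ω)
    (h : ∀ i, ∀ x ∈ Metric.ball x₁ δ, ∀ v, ‖v - v₁‖ < δ → κ ≤ f i 0 x v) :
    IsPositiveNear T f x₁ := by
  intro s hs R
  set m := ‖v₁‖ + δ with hm
  have hm0 : 0 < m := by positivity
  set t₁ := min T (δ / (2 * m)) with ht₁
  have ht₁0 : 0 < t₁ := lt_min hT (by positivity)
  have h1 : ∀ i, ∀ t ∈ Ioo 0 t₁, ∀ x ∈ Metric.ball x₁ (δ / 2), ∀ v, ‖v - v₁‖ < δ →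
      Real.exp (-(CL * (1 + m) * T)) * κ ≤ f i t x v := by
    intro i t ht x hx v hv
    have hvm : ‖v‖ ≤ m := by
      have := norm_le_norm_add_norm_sub' v v₁
      simp only [hm]; linarith
    have htT : t < T := ht.2.trans_le (min_le_left _ _)
    have hin : ∀ s ∈ Icc 0 (t - 0), x - s • v ∈ Metric.ball x₁ δ := by
      intro s hs
      rw [Metric.mem_ball] at hx ⊢
      have h1 : dist (x - s • v) x ≤ δ / (2 * m) * m := by
        rw [dist_eq_norm, sub_sub_cancel_left, norm_neg, norm_smul, Real.norm_of_nonneg hs.1]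
        refine mul_le_mul ?_ hvm (norm_nonneg _) (by positivity)
        linarith [hs.2, ht.2, min_le_right T (δ / (2 * m))]
      have h2 : δ / (2 * m) * m = δ / 2 := by field_simp
      linarith [dist_triangle (x - s • v) x x₁]
    refine le_trans ?_ ((hF i).transport hCL (a := 0) le_rfl ht.1.le htT
      (hball (by simpa using hin 0 ⟨le_rfl, by linarith [ht.1]⟩)) fun s hs => hball (hin s hs))
    refine mul_le_mul (Real.exp_le_exp.2 (neg_le_neg ?_)) ?_ hκ.le (Real.exp_pos _).le
    · have h0 := ht.1
      have : t - 0 ≤ T := by linarith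
      gcongr
    · exact h i _ (hin _ ⟨by linarith [ht.1], le_rfl⟩) v hv
  obtain ⟨a', ha', h'⟩ := persist hF hCL hT hb hγ hcΦ le_rfl ht₁0 (min_le_left _ _) hs
    (half_pos hδ) hδ (by positivity) ((Metric.ball_subset_ball (by linarith)).trans hball) h1 R
  exact ⟨_, by positivity, a', ha', h'⟩

/-- Positivity is transported along a segment in a ball contained in the domain, by particles of the
velocity `(y - x) / k` which cover the segment in the time `k`; `persist` makes the positivity at
`y` permanent. -/
theorem IsPositiveNear.transport
    (hF : ∀ i, IsControlledSolution Ω b α TB T γ cΦ CΦ CL (Φ i) (f₀ i) (f i))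
    (hCL : 0 < CL) (hT : 0 < T) (hb : IsAngularFactor b ν b₀) (hγ : γ ∈ Ioc (-3 : ℝ) 1)
    (hcΦ : 0 < cΦ)
    {x y z : R3} {d : ℝ} (hball : Metric.ball z d ⊆ closure Ω) (hx : x ∈ Metric.ball z d)
    (hy : y ∈ Metric.ball z d) (h : IsPositiveNear T f x) : IsPositiveNear T f y := by
  intro s hs R
  rcases le_or_gt T s with hsT | hsT
  · exact ⟨1, one_pos, 1, one_pos, fun i t ht => absurd (ht.1.trans ht.2) (not_lt.2 hsT)⟩
  set k := s / 4 with hk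
  have hk0 : 0 < k := by positivity
  set V := k⁻¹ • (y - x) with hV
  obtain ⟨ρ, hρ, a, ha, H⟩ := h k hk0 (‖V‖ + 1)
  obtain ⟨ρ₁, hρ₁, hρ₁'⟩ := Metric.isOpen_iff.1 Metric.isOpen_ball x hx
  obtain ⟨ρ₂, hρ₂, hρ₂'⟩ := Metric.isOpen_iff.1 Metric.isOpen_ball y hy
  set r := min ρ₂ (min ρ ρ₁ / 2) with hr
  have hr0 : 0 < r := lt_min hρ₂ (half_pos (lt_min hρ hρ₁))
  set η := min 1 (min ρ ρ₁ / (2 * k)) with hη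
  have hη0 : 0 < η := lt_min one_pos (by have := lt_min hρ hρ₁; positivity)
  have h1 : ∀ i, ∀ t ∈ Ioo (2 * k) T, ∀ y' ∈ Metric.ball y r, ∀ v, ‖v - V‖ < η →
      Real.exp (-(CL * (1 + (‖V‖ + 1)) * k)) * a ≤ f i t y' v := by
    intro i t ht y' hy' v hv
    have hvm : ‖v‖ ≤ ‖V‖ + 1 := by
      have := norm_le_norm_add_norm_sub' v V
      linarith [min_le_left (1 : ℝ) (min ρ ρ₁ / (2 * k))]
    have hend : dist (y' - k • v) x < min ρ ρ₁ := by
      have e : y' - k • v - x = (y' - y) - k • (v - V) := by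
        rw [smul_sub, hV, smul_smul, mul_inv_cancel₀ hk0.ne']; module
      rw [dist_eq_norm, e]
      have e1 : ‖y' - y‖ < min ρ ρ₁ / 2 := by
        rw [← dist_eq_norm]; exact (Metric.mem_ball.1 hy').trans_le (min_le_right _ _)
      have e2 : ‖k • (v - V)‖ ≤ min ρ ρ₁ / 2 := by
        rw [norm_smul, Real.norm_of_nonneg hk0.le]
        have : ‖v - V‖ ≤ min ρ ρ₁ / (2 * k) := hv.le.trans (min_le_right _ _)
        calc k * ‖v - V‖ ≤ k * (min ρ ρ₁ / (2 * k)) := by gcongr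
          _ = min ρ ρ₁ / 2 := by field_simp
      linarith [norm_sub_le (y' - y) (k • (v - V))]
    have hy'z : y' ∈ Metric.ball z d :=
      hρ₂' (Metric.ball_subset_ball (min_le_left _ _) hy')
    have hez : y' - k • v ∈ Metric.ball z d :=
      hρ₁' (Metric.mem_ball.2 (hend.trans_le (min_le_right _ _)))
    have hin : ∀ s ∈ Icc 0 (t - (t - k)), y' - s • v ∈ Metric.ball z d := by
      intro s hs
      rw [sub_sub_cancel] at hs
      have hc := (convex_ball z d) hy'z hez (a := 1 - s / k) (b := s / k)
        (by rw [sub_nonneg, div_le_one hk0]; exact hs.2) (div_nonneg hs.1 hk0.le) (by ring)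
      convert hc using 1
      rw [smul_sub, smul_smul, div_mul_cancel₀ _ hk0.ne']
      module
    refine le_trans ?_ ((hF i).transport hCL (a := t - k) (by linarith [ht.1]) (by linarith) ht.2
      (hball hy'z) fun s hs => hball (hin s hs))
    rw [sub_sub_cancel]
    refine mul_le_mul (Real.exp_le_exp.2 (by gcongr)) ?_ ha.le (Real.exp_pos _).le
    refine H i _ ⟨by linarith [ht.1], by linarith [ht.2]⟩ _ ?_ v hvm
    rw [ray, sub_sub_cancel]
    exact hend.trans_le (min_le_left _ _)
  obtain ⟨a', ha', h'⟩ := persist hF hCL hT hb hγ hcΦ (s₁' := s) (by positivity)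
    (by linarith : 2 * k < T) le_rfl (by linarith) hr0 hη0 (by positivity)
    ((Metric.ball_subset_ball (min_le_left _ _)).trans (hρ₂'.trans hball)) h1 R
  exact ⟨_, by positivity, a', ha', h'⟩

/-- Positivity near one point of the (connected) domain implies positivity near all of them. -/
theorem IsPositiveNear.forall_mem (hΩ : IsC2Domain Ω)
    (hF : ∀ i, IsControlledSolution Ω b α TB T γ cΦ CΦ CL (Φ i) (f₀ i) (f i))
    (hCL : 0 < CL) (hT : 0 < T) (hb : IsAngularFactor b ν b₀) (hγ : γ ∈ Ioc (-3 : ℝ) 1)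
    (hcΦ : 0 < cΦ)
    {x₁ : R3} (hx₁ : x₁ ∈ Ω) (h : IsPositiveNear T f x₁) : ∀ x ∈ Ω, IsPositiveNear T f x := by
  have hloc : ∀ x ∈ Ω, ∃ d > 0, Metric.ball x d ⊆ Ω ∧ ∀ y ∈ Metric.ball x d, ∀ z ∈ Metric.ball x d,
      IsPositiveNear T f y → IsPositiveNear T f z := by
    intro x hx
    obtain ⟨d, hd, hsub⟩ := Metric.isOpen_iff.1 hΩ.isOpen x hx
    exact ⟨d, hd, hsub, fun y hy z hz hpos =>
      hpos.transport hF hCL hT hb hγ hcΦ (hsub.trans subset_closure) hy hz⟩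
  have hopen : ∀ P : R3 → Prop, (∀ x ∈ Ω, P x → ∃ d > 0, ∀ y ∈ Metric.ball x d, y ∈ Ω ∧ P y) →
      IsOpen {x | x ∈ Ω ∧ P x} := by
    intro P hP
    rw [Metric.isOpen_iff]
    rintro x ⟨hx, hPx⟩
    obtain ⟨d, hd, H⟩ := hP x hx hPx
    exact ⟨d, hd, H⟩
  have h1 : IsOpen {x | x ∈ Ω ∧ IsPositiveNear T f x} := hopen _ fun x hx hPx => by
    obtain ⟨d, hd, hsub, H⟩ := hloc x hx
    exact ⟨d, hd, fun y hy => ⟨hsub hy, H x (Metric.mem_ball_self hd) y hy hPx⟩⟩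
  have h2 : IsOpen {x | x ∈ Ω ∧ ¬ IsPositiveNear T f x} := hopen _ fun x hx hPx => by
    obtain ⟨d, hd, hsub, H⟩ := hloc x hx
    exact ⟨d, hd, fun y hy => ⟨hsub hy, fun hy' => hPx (H y hy x (Metric.mem_ball_self hd) hy')⟩⟩
  have h3 := hΩ.isConnected.isPreconnected.subset_left_of_subset_union h1 h2
    (disjoint_left.2 fun x hx hx' => hx'.2 hx.2) (fun x hx => by
      by_cases hP : IsPositiveNear T f x
      · exact Or.inl ⟨hx, hP⟩
      · exact Or.inr ⟨hx, hP⟩) ⟨x₁, hx₁, hx₁, h⟩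
  exact fun x hx => (h3 hx).2

end

/-! ### Positivity up to the boundary -/

section

variable {Ω : Set R3} {b : ℝ → ℝ} {α TB T γ cΦ CΦ CL : ℝ} {ι : Type*} {Φ : ι → ℝ → ℝ}
  {f₀ : ι → R3 → R3 → ℝ} {f : ι → ℝ → R3 → R3 → ℝ} {ν b₀ : ℝ}

/-- Positivity near the points of a compact set is uniform. -/
theorem exists_uniform_of_isPositiveNear {K : Set R3} (hK : IsCompact K)
    (h : ∀ x ∈ K, IsPositiveNear T f x) {s : ℝ} (hs : 0 < s) (R : ℝ) :
    ∃ a > 0, ∀ i, ∀ t ∈ Ioo s T, ∀ x ∈ K, ∀ v, ‖v‖ ≤ R → a ≤ f i t x v := by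
  refine hK.induction_on (p := fun S => ∃ a > 0, ∀ i, ∀ t ∈ Ioo s T, ∀ x ∈ S, ∀ v, ‖v‖ ≤ R →
    a ≤ f i t x v) ⟨1, one_pos, by simp⟩ ?_ ?_ ?_
  · rintro S S' hSS ⟨a, ha, H⟩
    exact ⟨a, ha, fun i t ht x hx => H i t ht x (hSS hx)⟩
  · rintro S S' ⟨a, ha, H⟩ ⟨a', ha', H'⟩
    refine ⟨min a a', lt_min ha ha', fun i t ht x hx v hv => ?_⟩
    rcases hx with hx | hx
    · exact (min_le_left _ _).trans (H i t ht x hx v hv)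
    · exact (min_le_right _ _).trans (H' i t ht x hx v hv)
  · intro x hx
    obtain ⟨ρ, hρ, a, ha, H⟩ := h x hx s hs R
    exact ⟨_, mem_nhdsWithin_of_mem_nhds (Metric.ball_mem_nhds x hρ), a, ha, H⟩

/-- Near a boundary point, solutions are positive at velocities close to the outward normal: the
backward rays with these velocities enter the interior. -/
theorem exists_cone_lower (hΩ : IsC2Domain Ω)
    (hF : ∀ i, IsControlledSolution Ω b α TB T γ cΦ CΦ CL (Φ i) (f₀ i) (f i)) (hCL : 0 < CL)
    (hpos : ∀ x ∈ Ω, IsPositiveNear T f x) {x : R3} (hx : x ∈ frontier Ω) {s : ℝ} (hs : 0 < s) :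
    ∃ ρ > 0, ∃ a > 0, ∀ i, ∀ t ∈ Ioo s T, ∀ y ∈ closure Ω, ‖y - x‖ < ρ → ∀ v,
      ‖v - outwardNormal Ω x‖ ≤ 4 / 5 → a ≤ f i t y v := by
  obtain ⟨ε, hε, H⟩ := hΩ.exists_cone hx
  set d := min ε s / 2 with hd
  have hmin : 0 < min ε s := lt_min hε hs
  have hd0 : 0 < d := by positivity
  have hdε : d < ε := by linarith [min_le_left ε s]
  have hds : d < s := by linarith [min_le_right ε s]
  set K : Set R3 := (fun p : R3 × R3 => p.1 - d • p.2) ''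
    ((closure Ω ∩ Metric.closedBall x (ε / 2)) ×ˢ Metric.closedBall (outwardNormal Ω x) (4 / 5))
    with hK
  have hKc : IsCompact K := by
    refine IsCompact.image ?_ (by fun_prop)
    exact (hΩ.isCompact_closure.inter_right Metric.isClosed_closedBall).prod
      (isCompact_closedBall _ _)
  have hKsub : K ⊆ Ω := by
    rintro _ ⟨⟨y, v⟩, ⟨⟨hy, hyx⟩, hv⟩, rfl⟩
    rw [Metric.mem_closedBall, dist_eq_norm] at hyx hv
    exact H y hy (by simp only at hyx; linarith) v hv d ⟨hd0, hdε⟩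
  obtain ⟨a, ha, Ha⟩ := exists_uniform_of_isPositiveNear hKc (fun y hy => hpos y (hKsub hy))
    (s := s - d) (by linarith) 2
  refine ⟨ε / 2, by positivity, Real.exp (-(CL * 3 * d)) * a, by positivity,
    fun i t ht y hy hyx v hv => ?_⟩
  have hv2 : ‖v‖ ≤ 2 := by
    have := norm_le_norm_add_norm_sub' v (outwardNormal Ω x)
    rw [hΩ.norm_outwardNormal hx] at this
    linarith
  have hray : ∀ r ∈ Icc 0 (t - (t - d)), y - r • v ∈ closure Ω := by
    intro r hr
    rw [sub_sub_cancel] at hr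
    rcases hr.1.eq_or_lt with rfl | h0
    · simpa using hy
    · exact subset_closure (H y hy (by linarith) v hv r ⟨h0, hr.2.trans_lt hdε⟩)
  refine le_trans ?_ ((hF i).transport hCL (a := t - d) (by linarith [ht.1]) (by linarith) ht.2 hy
      hray)
  rw [sub_sub_cancel]
  refine mul_le_mul (Real.exp_le_exp.2 ?_) ?_ ha.le (Real.exp_pos _).le
  · have : 1 + ‖v‖ ≤ 3 := by linarith
    gcongr
  · refine Ha i _ ⟨by linarith [ht.1], by linarith [ht.2]⟩ _ ⟨(y, v), ⟨⟨hy, ?_⟩, ?_⟩, ?_⟩ v hv2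
    · rw [Metric.mem_closedBall, dist_eq_norm]; exact hyx.le
    · rwa [Metric.mem_closedBall, dist_eq_norm]
    · simp [ray]

/-- The gain term at small velocities and the outgoing flux are bounded below, uniformly up to the
boundary. Near a boundary point this follows from positivity on the ball of radius `4 / 5` around
the normal `n`: the gain operator enlarges the ball by a factor close to `√2`, and `4 √2 / 5 > 1`,
so that the origin is reached. -/
theorem exists_gain_flux_lower (hΩ : IsC2Domain Ω)
    (hF : ∀ i, IsControlledSolution Ω b α TB T γ cΦ CΦ CL (Φ i) (f₀ i) (f i)) (hCL : 0 < CL)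
    (hb : IsAngularFactor b ν b₀) (hγ : γ ∈ Ioc (-3 : ℝ) 1) (hcΦ : 0 < cΦ)
    (hpos : ∀ x ∈ Ω, IsPositiveNear T f x) {s : ℝ} (hs : 0 < s) :
    ∃ q > 0, ∃ c > 0, ∀ i, ∀ t ∈ Ioo s T, ∀ y ∈ closure Ω,
      (∀ v, ‖v‖ ≤ 1 / 20 → ENNReal.ofReal q ≤ Qplus (Φ i) b (f i t y) (f i t y) v) ∧
      (y ∈ frontier Ω → ENNReal.ofReal c ≤ outflux Ω y (f i t y)) := by
  obtain ⟨c₀, hc₀, H⟩ := exists_spread hb hγ hcΦ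
  have hsq : (140 / 100 : ℝ) ≤ √2 := Real.le_sqrt_of_sq_le (by norm_num)
  have hQ : ∀ a > 0, ∀ V : R3, ‖V‖ ≤ 1 → ∀ i t y, (∀ w, ‖w - V‖ < 4 / 5 → a ≤ f i t y w) →
      ∀ v, ‖v‖ ≤ 1 / 20 → ENNReal.ofReal (c₀ * a ^ 2 * (1 / 20) ^ 7 *
          ((4 / 5) ^ 4 / (1 + 4 / 5) ^ 4)) ≤
        Qplus (Φ i) b (f i t y) (f i t y) v := by
    intro a ha V hV i t y hlow v hv
    refine H (Φ i) CΦ (hF i).kinetic _ V (4 / 5) a (1 / 20) (by norm_num) ha.le (by norm_num)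
      (by norm_num) hlow v ?_
    linarith [norm_sub_le v V]
  refine hΩ.isCompact_closure.induction_on (p := fun S => ∃ q > 0, ∃ c > 0, ∀ i, ∀ t ∈ Ioo s T,
    ∀ y ∈ S, (∀ v, ‖v‖ ≤ 1 / 20 → ENNReal.ofReal q ≤ Qplus (Φ i) b (f i t y) (f i t y) v) ∧
      (y ∈ frontier Ω → ENNReal.ofReal c ≤ outflux Ω y (f i t y)))
    ⟨1, one_pos, 1, one_pos, by simp⟩ ?_ ?_ ?_
  · rintro S S' hSS ⟨q, hq, c, hc, H⟩
    exact ⟨q, hq, c, hc, fun i t ht x hx => H i t ht x (hSS hx)⟩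
  · rintro S S' ⟨q, hq, c, hc, H⟩ ⟨q', hq', c', hc', H'⟩
    refine ⟨min q q', lt_min hq hq', min c c', lt_min hc hc', fun i t ht y hy => ?_⟩
    rcases hy with hy | hy
    · exact ⟨fun v hv => (ENNReal.ofReal_le_ofReal (min_le_left _ _)).trans
        ((H i t ht y hy).1 v hv),
        fun h => (ENNReal.ofReal_le_ofReal (min_le_left _ _)).trans ((H i t ht y hy).2 h)⟩
    · exact ⟨fun v hv => (ENNReal.ofReal_le_ofReal (min_le_right _ _)).trans
          ((H' i t ht y hy).1 v hv),
        fun h => (ENNReal.ofReal_le_ofReal (min_le_right _ _)).trans ((H' i t ht y hy).2 h)⟩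
  · intro x hx
    rcases hΩ.mem_or_mem_frontier hx with hin | hfr
    · obtain ⟨ρ, hρ, a, ha, Ha⟩ := hpos x hin s hs 1
      have hU : Ω ∩ Metric.ball x ρ ∈ 𝓝[closure Ω] x := mem_nhdsWithin_of_mem_nhds
        (inter_mem (hΩ.isOpen.mem_nhds hin) (Metric.ball_mem_nhds x hρ))
      refine ⟨_, hU, c₀ * a ^ 2 * (1 / 20) ^ 7 * ((4 / 5) ^ 4 / (1 + 4 / 5) ^ 4), by positivity,
        1, one_pos, fun i t ht y hy => ⟨?_, fun h => ?_⟩⟩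
      · refine hQ a ha 0 (by simp) i t y fun w hw => Ha i t ht y hy.2 w ?_
        rw [sub_zero] at hw; linarith
      · exact absurd hy.1 (by rw [frontier, hΩ.isOpen.interior_eq] at h; exact h.2)
    · obtain ⟨ρ, hρ, a, ha, Ha⟩ := exists_cone_lower hΩ hF hCL hpos hfr hs
      obtain ⟨ε, hε, C, hC, HC⟩ := hΩ.exists_lipschitz_normal
      have hn := hΩ.norm_outwardNormal hfr
      set n := outwardNormal Ω x with hn_def
      set r := min ρ (min ε (1 / (4 * C))) with hr
      have hr0 : 0 < r := lt_min hρ (lt_min hε (by positivity))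
      have hU : closure Ω ∩ Metric.ball x r ∈ 𝓝[closure Ω] x :=
        inter_mem self_mem_nhdsWithin (mem_nhdsWithin_of_mem_nhds (Metric.ball_mem_nhds x hr0))
      set β := (volume (Metric.ball n (1 / 4))).toReal with hβ
      have hβ0 : 0 < β := ENNReal.toReal_pos (Metric.measure_ball_pos volume _ (by norm_num)).ne'
        measure_ball_lt_top.ne
      refine ⟨_, hU, c₀ * a ^ 2 * (1 / 20) ^ 7 * ((4 / 5) ^ 4 / (1 + 4 / 5) ^ 4), by positivity,
        a * (1 / 2) * β, by positivity, fun i t ht y hy => ?_⟩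
      have hyx : ‖y - x‖ < r := by rw [← dist_eq_norm]; exact hy.2
      have hyρ : ‖y - x‖ < ρ := hyx.trans_le (min_le_left _ _)
      refine ⟨hQ a ha n hn.le i t y fun w hw => Ha i t ht y hy.1 hyρ w hw.le, fun hyf => ?_⟩
      have h1 : ‖outwardNormal Ω y - n‖ ≤ 1 / 4 := by
        refine (HC y hyf x hfr (hyx.trans_le ((min_le_right _ _).trans (min_le_left _ _)))).trans ?_
        have : ‖y - x‖ ≤ 1 / (4 * C) :=
          hyx.le.trans ((min_le_right _ _).trans (min_le_right _ _))
        calc C * ‖y - x‖ ≤ C * (1 / (4 * C)) := by gcongr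
          _ = 1 / 4 := by field_simp
      have h2 : ∀ w ∈ Metric.ball n (1 / 4), 1 / 2 ≤ inner ℝ w (outwardNormal Ω y) := by
        intro w hw
        rw [Metric.mem_ball, dist_eq_norm] at hw
        have e : inner ℝ w (outwardNormal Ω y) = inner ℝ n n + inner ℝ n (outwardNormal Ω y - n) +
            inner ℝ (w - n) (outwardNormal Ω y) := by
          rw [inner_sub_right, inner_sub_left]; ring
        have e1 := abs_le.1 (abs_real_inner_le_norm n (outwardNormal Ω y - n))
        have e2 := abs_le.1 (abs_real_inner_le_norm (w - n) (outwardNormal Ω y))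
        rw [hn, one_mul] at e1
        rw [hΩ.norm_outwardNormal hyf, mul_one] at e2
        rw [e, real_inner_self_eq_norm_sq, hn]
        linarith [e1.1, e2.1]
      calc ENNReal.ofReal (a * (1 / 2) * β)
          = ∫⁻ _ in Metric.ball n (1 / 4), ENNReal.ofReal (a * (1 / 2)) := by
            rw [setLIntegral_const, ENNReal.ofReal_mul (by positivity), hβ,
              ENNReal.ofReal_toReal measure_ball_lt_top.ne]
        _ ≤ ∫⁻ w in Metric.ball n (1 / 4),
              ENNReal.ofReal (f i t y w * inner ℝ w (outwardNormal Ω y)) := by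
            refine setLIntegral_mono' measurableSet_ball fun w hw => ENNReal.ofReal_le_ofReal ?_
            have h3 := h2 w hw
            have h4 : a ≤ f i t y w := Ha i t ht y hy.1 hyρ w (by
              rw [Metric.mem_ball, dist_eq_norm] at hw; linarith)
            exact mul_le_mul h4 h3 (by norm_num) (ha.le.trans h4)
        _ ≤ outflux Ω y (f i t y) := by
            refine lintegral_mono_set fun w hw => ?_
            have := h2 w hw
            simp only [mem_ofPred_eq]
            linarith

end

/-! ### The set of nearly grazing bounces -/

section

variable {Ω : Set R3}

/-- The volume of the set of velocities in a ball that are almost orthogonal to a given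
direction. -/
theorem volume_strip_le {n : R3} (hn : ‖n‖ = 1) (r δ : ℝ) :
    volume {v : R3 | ‖v‖ ≤ r ∧ |inner ℝ n v| ≤ δ} ≤ ENNReal.ofReal (8 * r ^ 2 * δ) := by
  rcases lt_or_ge r 0 with hr | hr
  · have : {v : R3 | ‖v‖ ≤ r ∧ |inner ℝ n v| ≤ δ} = ∅ := by
      ext v
      simp only [mem_ofPred_eq, mem_empty_iff_false, iff_false, not_and]
      intro h
      linarith [norm_nonneg v]
    rw [this]; simp
  obtain ⟨B, hB⟩ := exists_orthonormalBasis n hn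
  set S : Set (Fin 3 → ℝ) := Set.pi univ (fun i => Icc (-(![r, r, δ] i)) (![r, r, δ] i)) with hS
  have hSm : MeasurableSet S := MeasurableSet.univ_pi fun i => measurableSet_Icc
  have hsub : {v : R3 | ‖v‖ ≤ r ∧ |inner ℝ n v| ≤ δ} ⊆
      (fun x : R3 => (fun i => B.repr x i)) ⁻¹' S := by
    rintro v ⟨h1, h2⟩
    have h3 : ∀ i, |B.repr v i| ≤ ‖v‖ := fun i => by
      rw [B.repr_apply_apply]
      simpa using abs_real_inner_le_norm (B i) v
    intro i _
    rw [mem_Icc, ← abs_le]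
    fin_cases i
    · exact (h3 0).trans h1
    · exact (h3 1).trans h1
    · change |B.repr v 2| ≤ δ
      rwa [B.repr_apply_apply, hB]
  refine (measure_mono hsub).trans ?_
  rw [(volume_map_coords B).measure_preimage hSm.nullMeasurableSet, hS, volume_pi_pi]
  simp only [Real.volume_Icc, Fin.prod_univ_three]
  rw [← ENNReal.ofReal_mul (by simp; linarith), ← ENNReal.ofReal_mul (by simp; positivity)]
  refine ENNReal.ofReal_le_ofReal (le_of_eq ?_)
  simp
  ring

/-- Phase space points within distance `h r` of a boundary point at which their velocity is almost
tangential. -/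
def nearGrazing (Ω : Set R3) (C r h : ℝ) : Set (R3 × R3) :=
  {z | ‖z.2‖ ≤ r ∧ ∃ y ∈ frontier Ω, ‖z.1 - y‖ ≤ h * r ∧ |inner ℝ (outwardNormal Ω y) z.2| ≤ C * h}

theorem isClosed_nearGrazing (hΩ : IsC2Domain Ω) (C r h : ℝ) : IsClosed (nearGrazing Ω C r h) := by
  have hK : IsCompact ((frontier Ω ×ˢ Metric.closedBall (0 : R3) (h * r)) ×ˢ
      Metric.closedBall (0 : R3) r) :=
    (hΩ.isCompact_frontier.prod (isCompact_closedBall _ _)).prod (isCompact_closedBall _ _)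
  set S : Set ((R3 × R3) × R3) := ((frontier Ω ×ˢ Metric.closedBall (0 : R3) (h * r)) ×ˢ
      Metric.closedBall (0 : R3) r) ∩ (fun p => |inner ℝ (outwardNormal Ω p.1.1) p.2|) ⁻¹'
        Iic (C * h) with hS
  have hc : ContinuousOn (fun p : (R3 × R3) × R3 => |(inner ℝ (outwardNormal Ω p.1.1) p.2 : ℝ)|)
      ((frontier Ω ×ˢ Metric.closedBall (0 : R3) (h * r)) ×ˢ Metric.closedBall (0 : R3) r) := by
    have h1 : ContinuousOn (fun p : (R3 × R3) × R3 => outwardNormal Ω p.1.1)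
        ((frontier Ω ×ˢ Metric.closedBall (0 : R3) (h * r)) ×ˢ Metric.closedBall (0 : R3) r) :=
      hΩ.continuousOn_outwardNormal.comp (by fun_prop) fun p hp => hp.1.1
    exact (h1.inner continuousOn_snd).abs
  have hSc : IsCompact S := hK.of_isClosed_subset
    (hc.preimage_isClosed_of_isClosed hK.isClosed isClosed_Iic) inter_subset_left
  have himg : nearGrazing Ω C r h = (fun p : (R3 × R3) × R3 => (p.1.1 + p.1.2, p.2)) '' S := by
    ext ⟨x, v⟩
    constructor
    · rintro ⟨h1, y, hy, h2, h3⟩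
      exact ⟨((y, x - y), v), ⟨⟨⟨hy, by simpa using h2⟩, by simpa using h1⟩, h3⟩, by simp⟩
    · rintro ⟨⟨⟨y, d⟩, w⟩, ⟨⟨⟨hy, hd⟩, hw⟩, h3⟩, he⟩
      simp only [Prod.mk.injEq] at he
      obtain ⟨rfl, rfl⟩ := he
      exact ⟨by simpa using hw, y, hy, by simpa using hd, h3⟩
  rw [himg]
  exact (hSc.image (by fun_prop)).isClosed

/-- The set of nearly grazing bounces during a time `h` has measure `o(h)`: the positions range over
a neighbourhood of the boundary, whose volume tends to `0`, and for each of them the velocities lie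
in a strip of width `O(h)`, since the normal is Lipschitz. -/
theorem eventually_volume_nearGrazing (hΩ : IsC2Domain Ω) {C r : ℝ} (hC : 0 ≤ C) (hr : 0 < r)
    {ε : ℝ}
    (hε : 0 < ε) :
    ∀ᶠ h in 𝓝[>] (0 : ℝ), volume (nearGrazing Ω C r h) ≤ ENNReal.ofReal (ε * h) := by
  obtain ⟨δ, hδ, D, hD, H⟩ := hΩ.exists_lipschitz_normal
  set A : ℝ := 8 * r ^ 2 * (C + 2 * D * r * r) with hA
  have hA0 : 0 < A := by positivity
  have hnull : Tendsto (fun h => volume (Metric.cthickening (h * r) (frontier Ω))) (𝓝[>] 0)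
      (𝓝 0) := by
    have h1 := tendsto_measure_cthickening_of_isCompact (μ := (volume : Measure R3))
      hΩ.isCompact_frontier
    rw [hΩ.volume_frontier] at h1
    have h2 : Tendsto (fun h : ℝ => h * r) (𝓝[>] 0) (𝓝 0) := by
      have : Continuous (fun h : ℝ => h * r) := by fun_prop
      simpa using (this.tendsto 0).mono_left nhdsWithin_le_nhds
    exact h1.comp h2
  have hev1 : ∀ᶠ h in 𝓝[>] (0 : ℝ), volume (Metric.cthickening (h * r) (frontier Ω)) <
      ENNReal.ofReal (ε / A) := hnull.eventually_lt_const (by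
    rw [ENNReal.ofReal_pos]; positivity)
  have hev2 : ∀ᶠ h in 𝓝[>] (0 : ℝ), h < δ / (2 * r) :=
    (eventually_lt_nhds (by positivity)).filter_mono nhdsWithin_le_nhds
  filter_upwards [hev1, hev2, self_mem_nhdsWithin] with h h1 h2 h0
  have h0' : 0 < h := h0
  rw [lt_div_iff₀ (by positivity)] at h2
  have hslice : ∀ x : R3, volume (Prod.mk x ⁻¹' nearGrazing Ω C r h) ≤
      (Metric.cthickening (h * r) (frontier Ω)).indicator (fun _ => ENNReal.ofReal (A * h)) x := by
    intro x
    by_cases hex : ∃ y ∈ frontier Ω, ‖x - y‖ ≤ h * r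
    · obtain ⟨y₀, hy₀, hxy₀⟩ := hex
      have hmem : x ∈ Metric.cthickening (h * r) (frontier Ω) :=
        Metric.mem_cthickening_of_dist_le x y₀ _ _ hy₀ (by rwa [dist_eq_norm])
      rw [indicator_of_mem hmem]
      have hsub : Prod.mk x ⁻¹' nearGrazing Ω C r h ⊆ {v : R3 | ‖v‖ ≤ r ∧
          |inner ℝ (outwardNormal Ω y₀) v| ≤ (C + 2 * D * r * r) * h} := by
        rintro v ⟨hv, y, hy, hxy, hyv⟩
        refine ⟨hv, ?_⟩
        simp only at hv hxy hyv
        have hyy : ‖y₀ - y‖ ≤ 2 * (h * r) := by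
          have := norm_sub_le_norm_sub_add_norm_sub y₀ x y
          rw [norm_sub_rev y₀ x] at this
          linarith
        have hn := H y₀ hy₀ y hy (by linarith)
        have e : inner ℝ (outwardNormal Ω y₀) v = inner ℝ (outwardNormal Ω y) v +
            inner ℝ (outwardNormal Ω y₀ - outwardNormal Ω y) v := by rw [inner_sub_left]; ring
        rw [e]
        calc _ ≤ _ := abs_add_le _ _
          _ ≤ C * h + (D * (2 * (h * r))) * r := by
              refine add_le_add hyv ((abs_real_inner_le_norm _ _).trans ?_)
              exact mul_le_mul (hn.trans (by gcongr)) hv (norm_nonneg _) (by positivity)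
          _ = _ := by ring
      refine (measure_mono hsub).trans ((volume_strip_le (hΩ.norm_outwardNormal hy₀) r
        _).trans (le_of_eq ?_))
      rw [hA]; ring_nf
    · have : Prod.mk x ⁻¹' nearGrazing Ω C r h = ∅ := by
        ext v
        simp only [mem_preimage, mem_empty_iff_false, iff_false]
        rintro ⟨_, y, hy, hxy, _⟩
        exact hex ⟨y, hy, hxy⟩
      rw [this]; simp
  rw [Measure.volume_eq_prod, Measure.prod_apply (isClosed_nearGrazing hΩ C r h).measurableSet]
  refine (lintegral_mono hslice).trans ?_
  rw [lintegral_indicator_const Metric.isClosed_cthickening.measurableSet]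
  refine (mul_le_mul_right h1.le _).trans ?_
  rw [← ENNReal.ofReal_mul (by positivity)]
  refine ENNReal.ofReal_le_ofReal (le_of_eq ?_)
  field_simp

end

/-! ### Lower bounds along specularly reflected characteristics -/

section

variable {Ω : Set R3} {b : ℝ → ℝ} {TB T γ cΦ CΦ CL : ℝ} {Φ : ℝ → ℝ} {f₀ : R3 → R3 → ℝ}
  {f : ℝ → R3 → R3 → ℝ}

/-- The lower bound `q (t - t₀) e^{-l (t - t₀)}` produced by a gain term `≥ q` and a collision
frequency `≤ l` acting since the time `t₀`. -/
def gainProfile (q l t₀ t : ℝ) : ℝ := q * (t - t₀) * Real.exp (-(l * (t - t₀)))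

/-- The profile is a subsolution of Duhamel's formula. -/
theorem gainProfile_le {q l t₀ a t g : ℝ} (hq : 0 ≤ q) (hl : 0 ≤ l) (h0 : t₀ ≤ a) (hat : a ≤ t)
    (hg : gainProfile q l t₀ a ≤ g) :
    gainProfile q l t₀ t ≤ Real.exp (-(l * (t - a))) * (g + q * (t - a)) := by
  have e : Real.exp (-(l * (t - t₀))) =
      Real.exp (-(l * (t - a))) * Real.exp (-(l * (a - t₀))) := by
    rw [← Real.exp_add]; ring_nf
  have h1 : Real.exp (-(l * (a - t₀))) ≤ 1 :=
    Real.exp_le_one_iff.2 (by have := mul_nonneg hl (sub_nonneg.2 h0); linarith)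
  rw [gainProfile] at hg ⊢
  rw [e, mul_left_comm]
  refine mul_le_mul_of_nonneg_left ?_ (Real.exp_pos _).le
  have h2 : q * (t - a) * Real.exp (-(l * (a - t₀))) ≤ q * (t - a) :=
    mul_le_of_le_one_right (mul_nonneg hq (by linarith)) h1
  calc q * (t - t₀) * Real.exp (-(l * (a - t₀))) = q * (a - t₀) * Real.exp (-(l * (a - t₀))) +
        q * (t - a) * Real.exp (-(l * (a - t₀))) := by ring
    _ ≤ g + q * (t - a) := add_le_add hg h2

section

variable (Ω CL f) in
/-- The points of phase space, with speed less than `r`, at which the lower bound fails at time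
`t`. -/
def failSet (q r t₀ t : ℝ) : Set (R3 × R3) :=
  {z | z.1 ∈ closure Ω ∧ ‖z.2‖ < r ∧ f t z.1 z.2 < gainProfile q (CL * (1 + r)) t₀ t}

variable {q r t₀ t a h : ℝ} {x v : R3}

/-- The lower bound is propagated along backward rays. -/
theorem IsControlledSolution.gainProfile_of_ray
    (hF : IsControlledSolution Ω b 1 TB T γ cΦ CΦ CL Φ f₀ f) (hCL : 0 < CL) (hq : 0 ≤ q)
    (hr : 0 < r) (ht₀ : 0 ≤ t₀)
    (hQ : ∀ s ∈ Ioo t₀ T, ∀ y ∈ closure Ω, ∀ v, ‖v‖ < r →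
      ENNReal.ofReal q ≤ Qplus Φ b (f s y) (f s y) v)
    (h0 : t₀ ≤ a) (hat : a ≤ t) (ht : t < T) (hx : x ∈ closure Ω) (hv : ‖v‖ < r)
    (hray : ∀ s ∈ Icc 0 (t - a), x - s • v ∈ closure Ω)
    (hg : gainProfile q (CL * (1 + r)) t₀ a ≤ f a (ray t x v a) v) :
    gainProfile q (CL * (1 + r)) t₀ t ≤ f t x v := by
  refine (gainProfile_le hq (by positivity) h0 hat hg).trans ?_
  refine hF.mild.lower_of_ray ⟨(ht₀.trans h0).trans hat, ht⟩ hx (ht₀.trans h0) hat hray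
    (by positivity) hq (fun s hs => ?_) (fun s hs => ?_)
  · refine (hF.loss s ⟨(ht₀.trans h0).trans_lt hs.1, hs.2.trans_lt ht⟩ _ (hray (t - s)
      ⟨by linarith [hs.2], by linarith [hs.1]⟩) v).trans (ENNReal.ofReal_le_ofReal ?_)
    gcongr
  · exact hQ s ⟨h0.trans_lt hs.1, hs.2.trans_lt ht⟩ _ (hray (t - s)
      ⟨by linarith [hs.2], by linarith [hs.1]⟩) v hv

/-- The lower bound holds at the stop set, where the characteristic is at rest. -/
theorem IsControlledSolution.gainProfile_of_mem_stopSet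
    (hF : IsControlledSolution Ω b 1 TB T γ cΦ CΦ CL Φ f₀ f) (hCL : 0 < CL) (hq : 0 ≤ q)
    (hr : 0 < r) (ht₀ : 0 ≤ t₀)
    (hQ : ∀ s ∈ Ioo t₀ T, ∀ y ∈ closure Ω, ∀ v, ‖v‖ < r →
      ENNReal.ofReal q ≤ Qplus Φ b (f s y) (f s y) v)
    (hat : t₀ ≤ t) (ht : t < T) (hx : (x, v) ∈ stopSet Ω) (hv : ‖v‖ < r) :
    gainProfile q (CL * (1 + r)) t₀ t ≤ f t x v := by
  have hxc : x ∈ closure Ω := frontier_subset_closure hx.1.1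
  have := hF.mild.lower_of_mem_stopSet ⟨ht₀.trans hat, ht⟩ hx ht₀ hat (l := CL * (1 + r)) (q := q)
    (by positivity) hq (fun s hs => ?_) (fun s hs => ?_)
  · rw [gainProfile, mul_comm]; exact this
  · refine (hF.loss s ⟨ht₀.trans_lt hs.1, hs.2.trans_lt ht⟩ _ hxc v).trans
      (ENNReal.ofReal_le_ofReal ?_)
    gcongr
  · exact hQ s ⟨hs.1, hs.2.trans_lt ht⟩ _ hxc v hv

/-- During a short time, the failure of the lower bound is transported backwards along
characteristics with at most one bounce, apart from nearly grazing ones. -/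
theorem exists_failSet_subset (hΩ : IsC2Domain Ω) (hr : 0 < r) :
    ∃ ε > 0, ∃ C > 0, ∀ {Φ f₀ f} {t₀ t h q : ℝ},
      IsControlledSolution Ω b 1 TB T γ cΦ CΦ CL Φ f₀ f → 0 < CL → 0 ≤ q → 0 ≤ t₀ →
      (∀ s ∈ Ioo t₀ T, ∀ y ∈ closure Ω, ∀ v, ‖v‖ < r →
        ENNReal.ofReal q ≤ Qplus Φ b (f s y) (f s y) v) →
      t₀ ≤ t → 0 < h → h < ε → t + h < T →
      failSet Ω CL f q r t₀ (t + h) ⊆ (frontier Ω ×ˢ univ ∪ nearGrazing Ω C r h) ∪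
        (shear h ⁻¹' (failSet Ω CL f q r t₀ t ∩ {z | (z.1, h • z.2) ∈ segSet Ω}) ∪
        preBounce '' bounceSet Ω h (frontier Ω) (failSet Ω CL f q r t₀ t)) := by
  obtain ⟨ε, hε, C, hC, H⟩ := hΩ.exists_short_chord
  refine ⟨ε / r, by positivity, C * r ^ 2, by positivity, ?_⟩
  rintro Φ f₀ f t₀ t h q hF hCL hq ht₀ hQ h0 hh hhε hT ⟨x, v⟩ ⟨hx, hv, hlt⟩
  simp only at hx hv hlt
  rw [lt_div_iff₀ hr] at hhε
  by_cases hseg : ∀ s ∈ Icc 0 h, x - s • v ∈ closure Ω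
  · refine Or.inr (Or.inl ⟨⟨hseg h ⟨hh.le, le_rfl⟩, hv, ?_⟩, ?_⟩)
    · by_contra hcon
      refine not_lt.2 (hF.gainProfile_of_ray hCL hq hr ht₀ hQ h0 (by linarith) hT hx hv
        (by rwa [add_sub_cancel_left]) ?_) hlt
      simpa [shear, ray] using hcon
    · intro l hl
      have := hseg (h - l * h) ⟨by nlinarith [hl.2], by nlinarith [hl.1]⟩
      simp only [shear]
      rwa [sub_smul, ← sub_add, mul_smul] at this
  have hex : ¬ ENNReal.ofReal h ≤ tBoundary Ω x v := fun h' =>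
    hseg ((le_tBoundary_iff hx hh.le).1 h')
  push Not at hex
  set σ := (tBoundary Ω x v).toReal with hσ
  have hσ' : tBoundary Ω x v = ENNReal.ofReal σ := (ENNReal.ofReal_toReal hex.ne_top).symm
  have hσ0 : 0 ≤ σ := ENNReal.toReal_nonneg
  have hσh : σ < h := by
    rw [hσ'] at hex
    exact (ENNReal.ofReal_lt_ofReal_iff hh).1 hex
  have hin : ∀ s ∈ Icc 0 σ, x - s • v ∈ closure Ω := (le_tBoundary_iff hx hσ0).1 hσ'.ge
  rcases hσ0.eq_or_lt with h00 | hσpos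
  · obtain ⟨hy, -, -⟩ := hΩ.exit_point hx hσ0 hσ'
    rw [← h00, zero_smul, sub_zero] at hy
    exact Or.inl (Or.inl ⟨hy, mem_univ _⟩)
  obtain ⟨hy, hty, hor⟩ := hΩ.exit_point hx hσ0 hσ'
  set y := x - σ • v with hydef
  have hyc : y ∈ closure Ω := frontier_subset_closure hy
  have hyt : f (t + h - σ) y v < gainProfile q (CL * (1 + r)) t₀ (t + h - σ) := by
    by_contra hcon
    refine not_lt.2 (hF.gainProfile_of_ray hCL hq hr ht₀ hQ (a := t + h - σ) (by linarith)
      (by linarith) hT hx hv (by rwa [sub_sub_cancel]) ?_) hlt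
    rw [ray, sub_sub_cancel]
    exact not_lt.1 hcon
  rcases hor with hneg | hgraze
  swap
  · exact absurd hyt (not_lt.2 (hF.gainProfile_of_mem_stopSet hCL hq hr ht₀ hQ (by linarith)
      (by linarith)
      hgraze hv))
  set u := reflect Ω y v with hu
  have hun : ‖u‖ = ‖v‖ := norm_reflect hΩ hy v
  have hinner : inner ℝ (outwardNormal Ω y) u = -inner ℝ (outwardNormal Ω y) v :=
    inner_reflect hΩ hy v
  by_cases hchord : ∀ s ∈ Icc 0 (h - σ), y - s • u ∈ closure Ω
  · refine Or.inr (Or.inr ⟨(σ, y, v), ⟨⟨hσpos, hσh⟩, hy, ?_, ?_, ?_, ?_⟩, ?_⟩)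
    · rwa [normalExt_of_mem hy]
    · intro l hl
      have := hin (σ - l * σ) ⟨by nlinarith [hl.2], by nlinarith [hl.1]⟩
      rwa [sub_smul, ← sub_add, mul_smul] at this
    · simp only
      rw [mirror_normalExt hy]
      intro l hl
      have := hchord (l * (h - σ)) ⟨mul_nonneg hl.1 (by linarith),
        mul_le_of_le_one_left (by linarith) hl.2⟩
      rwa [mul_smul, sub_eq_add_neg, ← smul_neg] at this
    · simp only
      rw [mirror_normalExt hy]
      refine ⟨hchord (h - σ) ⟨by linarith, le_rfl⟩, by simpa only [← hu, hun] using hv, ?_⟩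
      by_contra hcon
      rw [hF.mild.eq_reflect ⟨by linarith, by linarith⟩ hy hty] at hyt
      have e : t + h - σ - t = h - σ := by ring
      refine not_lt.2 (hF.gainProfile_of_ray hCL hq hr ht₀ hQ h0 (by linarith) (by linarith) hyc
        (hun ▸ hv) (by rwa [e]) ?_) hyt
      rw [ray, e]
      exact not_lt.1 hcon
    · simp [preBounce, hydef]
  · refine Or.inl (Or.inr ⟨hv.le, y, hy, ?_, ?_⟩)
    · simp only [hydef, sub_sub_cancel, norm_smul, Real.norm_of_nonneg hσ0]
      exact mul_le_mul hσh.le hv.le (norm_nonneg _) hh.le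
    · simp only
      by_contra hcon
      rw [abs_of_neg hneg] at hcon
      push Not at hcon
      refine hchord fun s hs => H y hy u h hh ?_ ?_ s ⟨hs.1, by linarith [hs.2]⟩
      · rw [hun]; exact (mul_le_mul_of_nonneg_left hv.le hh.le).trans hhε.le
      · rw [hinner, hun]
        refine lt_of_le_of_lt ?_ hcon
        rw [mul_right_comm]
        gcongr

end

end

section

variable {Ω : Set R3} {b : ℝ → ℝ} {TB T γ cΦ CΦ CL q r t₀ t : ℝ} {Φ : ℝ → ℝ} {f₀ : R3 → R3 → ℝ}
  {f : ℝ → R3 → R3 → ℝ}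

/-- The lower bound fails at most on a null set: since the billiard flow preserves Lebesgue measure,
the measure of the set of failure grows in each short time step at most by the measure of the nearly
grazing set, which is of higher order. -/
theorem volume_failSet (hΩ : IsC2Domain Ω) (hF : IsControlledSolution Ω b 1 TB T γ cΦ CΦ CL Φ f₀ f)
    (hCL : 0 < CL) (hq : 0 ≤ q) (hr : 0 < r) (ht₀ : 0 ≤ t₀)
    (hQ : ∀ s ∈ Ioo t₀ T, ∀ y ∈ closure Ω, ∀ v, ‖v‖ < r →
      ENNReal.ofReal q ≤ Qplus Φ b (f s y) (f s y) v)
    (ht : t ∈ Ico t₀ T) : volume (failSet Ω CL f q r t₀ t) = 0 := by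
  have hbase : failSet Ω CL f q r t₀ t₀ = ∅ := by
    ext ⟨x, v⟩
    simp only [mem_empty_iff_false, iff_false]
    rintro ⟨hx, -, hlt⟩
    simp only [gainProfile, sub_self, mul_zero, zero_mul] at hlt
    exact not_lt.2 (hF.mild.nonneg t₀ ⟨ht₀, ht.1.trans_lt ht.2⟩ x hx v) hlt
  rcases ht.1.eq_or_lt with rfl | htt
  · rw [hbase, measure_empty]
  obtain ⟨ε, hε, C, hC, H⟩ := exists_failSet_subset (T := T) (TB := TB) (γ := γ) (cΦ := cΦ)
    (CΦ := CΦ) (CL := CL) (b := b) hΩ hr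
  have hfr : volume (frontier Ω ×ˢ (univ : Set R3)) = 0 := by
    rw [Measure.volume_eq_prod, Measure.prod_prod, hΩ.volume_frontier, zero_mul]
  have hstep : ∀ s h, t₀ ≤ s → 0 < h → h < ε → s + h < T →
      volume (failSet Ω CL f q r t₀ (s + h)) ≤
        volume (nearGrazing Ω C r h) + volume (failSet Ω CL f q r t₀ s) := by
    intro s h h0 hh hhε hT
    -- The solution is not known to be measurable off `Γ_conti`, so the set of failure is replaced
    -- by a measurable hull.
    set A := toMeasurable volume (failSet Ω CL f q r t₀ s) with hA
    have hAm : MeasurableSet A := measurableSet_toMeasurable _ _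
    have hsub : failSet Ω CL f q r t₀ s ⊆ A := subset_toMeasurable _ _
    set S : Set (R3 × R3) := {z | (z.1, h • z.2) ∈ segSet Ω} with hS
    have hSm : MeasurableSet S :=
      (isClosed_segSet.preimage (by fun_prop :
        Continuous fun z : R3 × R3 => (z.1, h • z.2))).measurableSet
    refine (measure_mono (H hF hCL hq ht₀ hQ h0 hh hhε hT)).trans ?_
    refine (measure_union_le _ _).trans (add_le_add ?_ ?_)
    · refine (measure_union_le _ _).trans ?_
      rw [hfr, zero_add]
    · calc volume (shear h ⁻¹' (failSet Ω CL f q r t₀ s ∩ S) ∪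
            preBounce '' bounceSet Ω h (frontier Ω) (failSet Ω CL f q r t₀ s))
          ≤ volume (shear h ⁻¹' (A ∩ S)) + volume (preBounce '' bounceSet Ω h (frontier Ω) A) := by
            refine (measure_union_le _ _).trans (add_le_add (measure_mono ?_) (measure_mono ?_))
            · exact preimage_mono (inter_subset_inter_left _ hsub)
            · refine image_mono fun z hz => ?_
              exact ⟨hz.1, hz.2.1, hz.2.2.1, hz.2.2.2.1, hz.2.2.2.2.1, hsub hz.2.2.2.2.2⟩
        _ ≤ volume (A ∩ S) + volume (A \ S) := by
            rw [(measurePreserving_shear h).measure_preimage (hAm.inter hSm).nullMeasurableSet]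
            exact add_le_add le_rfl (hΩ.volume_bounce_le h hAm)
        _ = volume (failSet Ω CL f q r t₀ s) := by
            rw [measure_inter_add_sdiff _ hSm, hA, measure_toMeasurable]
  refine le_antisymm (ENNReal.le_of_forall_pos_le_add fun δ hδ _ => ?_) bot_le
  rw [zero_add]
  have hL : 0 < t - t₀ := by linarith
  have hev : ∀ᶠ h in 𝓝[>] (0 : ℝ), h < ε ∧ volume (nearGrazing Ω C r h) ≤
      ENNReal.ofReal (δ / (t - t₀) * h) :=
    ((eventually_lt_nhds hε).filter_mono nhdsWithin_le_nhds).and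
      (eventually_volume_nearGrazing hΩ hC.le hr (by positivity))
  have hseq : Tendsto (fun n : ℕ => (t - t₀) / n) atTop (𝓝[>] 0) := by
    refine tendsto_nhdsWithin_iff.2 ⟨tendsto_const_div_atTop_nhds_zero_nat _, ?_⟩
    filter_upwards [eventually_gt_atTop 0] with n hn
    exact div_pos hL (Nat.cast_pos.2 hn)
  obtain ⟨n, ⟨h1, h2⟩, hn⟩ := ((hseq.eventually hev).and (eventually_gt_atTop 0)).exists
  have hn' : (0 : ℝ) < n := Nat.cast_pos.2 hn
  set h := (t - t₀) / n with hh
  have hh0 : 0 < h := by positivity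
  have hnh : n * h = t - t₀ := by rw [hh]; field_simp
  -- The `o(h)` contributions of the `n = (t - t₀) / h` time steps add up to at most `δ`.
  have hind : ∀ k : ℕ, k ≤ n → volume (failSet Ω CL f q r t₀ (t₀ + k * h)) ≤
      k * ENNReal.ofReal (δ / (t - t₀) * h) := by
    intro k
    induction k with
    | zero => intro _; simp [hbase]
    | succ k ih =>
      intro hk
      have hk' : ((k : ℝ) + 1) * h ≤ n * h := by
        have : ((k + 1 : ℕ) : ℝ) ≤ n := Nat.cast_le.2 hk
        push_cast at this
        gcongr
      have e : t₀ + ((k + 1 : ℕ) : ℝ) * h = t₀ + k * h + h := by push_cast; ring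
      rw [e, Nat.cast_add, Nat.cast_one, add_mul, one_mul, add_comm (_ * _)]
      refine (hstep _ h (by have : 0 ≤ (k : ℝ) * h := by positivity
                            linarith) hh0 h1 (by linarith [ht.2])).trans
        (add_le_add h2 (ih (by omega)))
  have := hind n le_rfl
  rw [hnh, add_sub_cancel] at this
  refine this.trans (le_of_eq ?_)
  rw [← ENNReal.ofReal_natCast, ← ENNReal.ofReal_mul hn'.le, mul_left_comm, hnh,
    div_mul_cancel₀ _ hL.ne', ENNReal.ofReal_coe_nnreal]

/-- The lower bound holds at the points of continuity, which are approximated by points at which it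
does not fail. -/
theorem gainProfile_le_of_mem_gammaConti (hΩ : IsC2Domain Ω)
    (hF : IsControlledSolution Ω b 1 TB T γ cΦ CΦ CL Φ f₀ f)
    (hnull : volume (failSet Ω CL f q r t₀ t) = 0) (ht : t ∈ Ioo 0 T) {x v : R3}
    (hx : x ∈ closure Ω) (hv : ‖v‖ < r) (hc : (t, x, v) ∈ gammaConti Ω T) :
    gainProfile q (CL * (1 + r)) t₀ t ≤ f t x v := by
  by_contra hcon
  push Not at hcon
  have h1 := (hF.mild.continuous _ hc).eventually_lt_const hcon
  rw [eventually_nhdsWithin_iff] at h1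
  have h2 : ContinuousAt (fun p : R3 × R3 => ((t, p.1, p.2) : ℝ × R3 × R3)) (x, v) := by fun_prop
  obtain ⟨U, hU, V, hV, hUV⟩ := mem_nhds_prod_iff.1 (h2.eventually h1)
  obtain ⟨U', hU'U, hU'o, hxU'⟩ := mem_nhds_iff.1 hU
  obtain ⟨V', hV'V, hV'o, hvV'⟩ := mem_nhds_iff.1 hV
  rw [Measure.volume_eq_prod] at hnull
  have h3 := Measure.measure_ae_null_of_prod_null hnull
  have hpos : 0 < volume (U' ∩ Ω) := by
    refine (hU'o.inter hΩ.isOpen).measure_pos _ ?_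
    exact mem_closure_iff.1 hx U' hU'o hxU'
  have h4 : ∃ᶠ y in ae volume, y ∈ U' ∩ Ω := frequently_ae_mem_iff.2 hpos.ne'
  obtain ⟨y, ⟨hyU, hyΩ⟩, hy⟩ := (h4.and_eventually h3).exists
  have hpos' : 0 < volume (V' ∩ Metric.ball (0 : R3) r) :=
    (hV'o.inter Metric.isOpen_ball).measure_pos _ ⟨v, hvV', by simpa using hv⟩
  have h5 : ∃ᶠ w in ae volume, w ∈ V' ∩ Metric.ball (0 : R3) r :=
    frequently_ae_mem_iff.2 hpos'.ne'
  have h6 : ∀ᵐ w : R3, w ∉ Prod.mk y ⁻¹' failSet Ω CL f q r t₀ t :=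
    measure_eq_zero_iff_ae_notMem.1 hy
  obtain ⟨w, ⟨⟨hwV, hwr⟩, hw⟩, hwc⟩ :=
    ((h5.and_eventually h6).and_eventually (hΩ.ae_gammaConti (subset_closure hyΩ) T)).exists
  have h7 := hUV (mk_mem_prod (hU'U hyU) (hV'V hwV)) (hwc t ht)
  exact hw ⟨subset_closure hyΩ, by simpa using hwr, h7⟩

/-- For specular reflection, a lower bound for the gain term at all small velocities turns into a
lower bound for the solution at the same velocities. -/
theorem gainProfile_le_solution (hΩ : IsC2Domain Ω)
    (hF : IsControlledSolution Ω b 1 TB T γ cΦ CΦ CL Φ f₀ f) (hCL : 0 < CL) (hq : 0 ≤ q)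
    (hr : 0 < r) (ht₀ : 0 ≤ t₀)
    (hQ : ∀ s ∈ Ioo t₀ T, ∀ y ∈ closure Ω, ∀ v, ‖v‖ < r →
      ENNReal.ofReal q ≤ Qplus Φ b (f s y) (f s y) v)
    (ht : t ∈ Ico t₀ T) {x v : R3} (hx : x ∈ closure Ω) (hv : ‖v‖ < r) :
    gainProfile q (CL * (1 + r)) t₀ t ≤ f t x v := by
  have h00 : ∀ {y w}, y ∈ closure Ω → gainProfile q (CL * (1 + r)) t₀ t₀ ≤ f t₀ y w := by
    intro y w hy
    simp only [gainProfile, sub_self, mul_zero, zero_mul]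
    exact hF.mild.nonneg t₀ ⟨ht₀, ht.1.trans_lt ht.2⟩ y hy w
  by_cases hseg : ∀ s ∈ Icc 0 (t - t₀), x - s • v ∈ closure Ω
  · exact hF.gainProfile_of_ray hCL hq hr ht₀ hQ le_rfl ht.1 ht.2 hx hv hseg
      (h00 (hseg (t - t₀) ⟨by linarith [ht.1], le_rfl⟩))
  have hL : 0 ≤ t - t₀ := by linarith [ht.1]
  have hex : ¬ ENNReal.ofReal (t - t₀) ≤ tBoundary Ω x v := fun h' =>
    hseg ((le_tBoundary_iff hx hL).1 h')
  push Not at hex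
  set σ := (tBoundary Ω x v).toReal with hσ
  have hσ' : tBoundary Ω x v = ENNReal.ofReal σ := (ENNReal.ofReal_toReal hex.ne_top).symm
  have hσ0 : 0 ≤ σ := ENNReal.toReal_nonneg
  have hσh : σ < t - t₀ := by
    rw [hσ'] at hex
    exact (ENNReal.ofReal_lt_ofReal_iff_of_nonneg hσ0).1 hex
  have hin : ∀ s ∈ Icc 0 σ, x - s • v ∈ closure Ω := (le_tBoundary_iff hx hσ0).1 hσ'.ge
  obtain ⟨hy, hty, hor⟩ := hΩ.exit_point hx hσ0 hσ'
  have hyc := frontier_subset_closure hy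
  refine hF.gainProfile_of_ray hCL hq hr ht₀ hQ (a := t - σ) (by linarith) (by linarith) ht.2 hx hv
    (by rwa [sub_sub_cancel]) ?_
  rw [ray, sub_sub_cancel]
  rcases hor with hneg | hgraze
  · have ht' : t - σ ∈ Ioo 0 T := ⟨by linarith, by linarith [ht.2]⟩
    exact gainProfile_le_of_mem_gammaConti hΩ hF
      (volume_failSet hΩ hF hCL hq hr ht₀ hQ ⟨by linarith, by linarith [ht.2]⟩) ht' hyc hv
      (Or.inl (Or.inr ⟨ht', Or.inl ⟨hy, hneg⟩⟩))
  · exact hF.gainProfile_of_mem_stopSet hCL hq hr ht₀ hQ (by linarith) (by linarith [ht.2]) hgraze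
      hv

end

/-! ### Maxwellian lower bounds: specular reflection -/

section

theorem exp_neg_abs_log_le {a : ℝ} (ha : 0 < a) : Real.exp (-|Real.log a|) ≤ a := by
  calc Real.exp (-|Real.log a|) ≤ Real.exp (Real.log a) := Real.exp_le_exp.2 (neg_abs_le _)
    _ = a := Real.exp_log ha

variable {Ω : Set R3} {b : ℝ → ℝ} {α TB T γ cΦ CΦ CL : ℝ} {ι : Type*} {Φ : ι → ℝ → ℝ}
  {f₀ : ι → R3 → R3 → ℝ} {f : ι → ℝ → R3 → R3 → ℝ} {ν b₀ : ℝ}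

/-- The profile after the time `d`. -/
theorem le_gainProfile {q l t₀ t d : ℝ} (hq : 0 ≤ q) (hl : 0 ≤ l) (ht₀ : 0 ≤ t₀) (hd : 0 ≤ d)
    (h : t₀ + d ≤ t) (ht : t ≤ T) : q * d * Real.exp (-(l * T)) ≤ gainProfile q l t₀ t := by
  rw [gainProfile]
  have h1 : d ≤ t - t₀ := by linarith
  have h2 : t - t₀ ≤ T := by linarith
  refine mul_le_mul (mul_le_mul_of_nonneg_left h1 hq) (Real.exp_le_exp.2 ?_) (Real.exp_pos _).le
    (mul_nonneg hq (hd.trans h1))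
  have := mul_le_mul_of_nonneg_left h2 hl
  linarith

/-- The radii `r_n` of the balls of velocities reached after `n` collisions. They satisfy
`r_{n+1} ≤ √2 (1 - ξ_n) r_n` with the summable losses `ξ_n = 2^{-n} / 4`, so that `r_n` still grows
like `√2 ^ n`. -/
def spreadRadius (n : ℕ) : ℝ := √2 ^ n * (1 + (1 / 2) ^ n) / 40

theorem spreadRadius_pos (n : ℕ) : 0 < spreadRadius n := by unfold spreadRadius; positivity

theorem spreadRadius_succ_le (n : ℕ) :
    spreadRadius (n + 1) ≤ √2 * spreadRadius n * (1 - (1 / 2) ^ n / 4) := by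
  unfold spreadRadius
  have h1 : (1 / 2 : ℝ) ^ n ≤ 1 := pow_le_one₀ (by norm_num) (by norm_num)
  have h0 : (0 : ℝ) < (1 / 2) ^ n := by positivity
  have h2 : 1 + (1 / 2 : ℝ) ^ (n + 1) ≤ (1 + (1 / 2) ^ n) * (1 - (1 / 2) ^ n / 4) := by
    rw [pow_succ]; nlinarith
  calc √2 ^ (n + 1) * (1 + (1 / 2) ^ (n + 1)) / 40
      ≤ √2 ^ (n + 1) * ((1 + (1 / 2) ^ n) * (1 - (1 / 2) ^ n / 4)) / 40 := by gcongr
    _ = _ := by rw [pow_succ]; ring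

theorem le_spreadRadius (n : ℕ) : √2 ^ n / 40 ≤ spreadRadius n := by
  unfold spreadRadius
  have h0 : (0 : ℝ) < (1 / 2) ^ n := by positivity
  have : √2 ^ n * 1 ≤ √2 ^ n * (1 + (1 / 2) ^ n) := by gcongr; linarith
  linarith

theorem spreadRadius_le (n : ℕ) : spreadRadius n ≤ (3 / 2) ^ n := by
  unfold spreadRadius
  have h1 : (1 / 2 : ℝ) ^ n ≤ 1 := pow_le_one₀ (by norm_num) (by norm_num)
  have hsq2 : √2 ≤ 3 / 2 := by rw [Real.sqrt_le_left (by norm_num)]; norm_num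
  have h2 : √2 ^ n ≤ (3 / 2) ^ n := by gcongr
  have h3 : √2 ^ n * (1 + (1 / 2) ^ n) ≤ (3 / 2) ^ n * 2 := by gcongr; linarith
  have h4 : (0 : ℝ) < (3 / 2) ^ n := by positivity
  linarith

/-- The losses in one step of the iteration, in which the collisions act for the time
`τ / 2 ^ (n + 2)`, are at least of the order `exp (-K (3/2) ^ n)`. The damping at the radius
`r_{n+1} ≤ (3/2) ^ (n + 1)` is decisive; all other factors decay only geometrically. -/
theorem exists_step_constant {c l τ : ℝ} (hc : 0 < c) (hl : 0 ≤ l) (hτ : 0 < τ) : ∃ K > 0, ∀ n : ℕ,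
    Real.exp (-(K * (3 / 2) ^ n)) ≤ c * ((1 / 2) ^ n / 4) ^ 7 *
      (spreadRadius n ^ 4 / (1 + spreadRadius n) ^ 4) * (τ / 2 ^ (n + 2)) *
        Real.exp (-(l * (1 + spreadRadius (n + 1)) )) := by
  set k := c * (1 / 4) ^ 7 * (1 / 41) ^ 4 * (τ / 4) with hk
  have hk0 : 0 < k := by positivity
  refine ⟨|Real.log k| + 16 + 3 * l, by positivity, fun n => ?_⟩
  have hp1 : (1 : ℝ) ≤ (3 / 2) ^ n := one_le_pow₀ (by norm_num)
  have hnp : (n : ℝ) ≤ 2 * (3 / 2) ^ n := by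
    have := one_add_mul_le_pow (a := (1 / 2 : ℝ)) (by norm_num) n
    norm_num at this ⊢
    linarith
  have h8 : Real.exp (-(16 * (3 / 2) ^ n)) ≤ ((1 / 2 : ℝ) ^ n) ^ 8 := by
    have e : (1 / 2 : ℝ) = Real.exp (-Real.log 2) := by
      rw [Real.exp_neg, Real.exp_log (by norm_num)]; norm_num
    have hlog : Real.log 2 ≤ 1 := by linarith [Real.log_two_lt_d9]
    have hlog0 : 0 ≤ Real.log 2 := Real.log_nonneg (by norm_num)
    rw [e, ← Real.exp_nat_mul, ← Real.exp_nat_mul]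
    refine Real.exp_le_exp.2 ?_
    push_cast
    nlinarith [mul_le_mul_of_nonneg_left hlog (Nat.cast_nonneg (α := ℝ) n)]
  have hr : (1 / 41 : ℝ) ^ 4 ≤ spreadRadius n ^ 4 / (1 + spreadRadius n) ^ 4 := by
    rw [← div_pow]
    have h0 := spreadRadius_pos n
    have h1 : 1 / 40 ≤ spreadRadius n := by
      refine le_trans ?_ (le_spreadRadius n)
      have : 1 ≤ √2 ^ n := one_le_pow₀ (Real.one_le_sqrt.2 (by norm_num))
      linarith
    have h2 : 1 / 41 ≤ spreadRadius n / (1 + spreadRadius n) := by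
      rw [div_le_div_iff₀ (by norm_num) (by linarith)]; linarith
    gcongr
  have hexp : Real.exp (-(3 * l * (3 / 2) ^ n)) ≤ Real.exp (-(l * (1 + spreadRadius (n + 1)))) := by
    refine Real.exp_le_exp.2 (neg_le_neg ?_)
    have := spreadRadius_le (n + 1)
    rw [pow_succ] at this
    have h3 : 1 + spreadRadius (n + 1) ≤ 3 * (3 / 2) ^ n := by linarith
    calc l * (1 + spreadRadius (n + 1)) ≤ l * (3 * (3 / 2) ^ n) := by gcongr
      _ = _ := by ring
  have hlogk : Real.exp (-(|Real.log k| * (3 / 2) ^ n)) ≤ k :=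
    (Real.exp_le_exp.2 (neg_le_neg (le_mul_of_one_le_right (abs_nonneg _) hp1))).trans
      (exp_neg_abs_log_le hk0)
  calc Real.exp (-((|Real.log k| + 16 + 3 * l) * (3 / 2) ^ n))
      = Real.exp (-(|Real.log k| * (3 / 2) ^ n)) * Real.exp (-(16 * (3 / 2) ^ n)) *
          Real.exp (-(3 * l * (3 / 2) ^ n)) := by
        rw [← Real.exp_add, ← Real.exp_add]; ring_nf
    _ ≤ k * ((1 / 2 : ℝ) ^ n) ^ 8 * Real.exp (-(l * (1 + spreadRadius (n + 1)))) := by gcongr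
    _ = c * ((1 / 2) ^ n / 4) ^ 7 * (1 / 41) ^ 4 * (τ / 2 ^ (n + 2)) *
          Real.exp (-(l * (1 + spreadRadius (n + 1)))) := by
        rw [hk, one_div_pow (2 : ℝ) n, pow_add]
        field_simp
        norm_num
    _ ≤ _ := by gcongr

/-- Iteration of `exists_spread` and `gainProfile_le_solution`. After `n` steps the solution is at
least `a_n` for `‖v‖ < r_n ≈ √2 ^ n`, where `a_{n+1} ≥ a_n ^ 2 exp (-K (3/2) ^ n)`. As `3/2 < 2`,
this gives `a_n ≥ exp (-A 2 ^ n)`, and `2 ^ n ≈ r_n ^ 2` turns the bound into a Maxwellian. -/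
theorem exists_maxwellian_specular (hΩ : IsC2Domain Ω)
    (hF : ∀ i, IsControlledSolution Ω b 1 TB T γ cΦ CΦ CL (Φ i) (f₀ i) (f i)) (hCL : 0 < CL)
    (hb : IsAngularFactor b ν b₀) (hγ : γ ∈ Ioc (-3 : ℝ) 1) (hcΦ : 0 < cΦ) {τ q : ℝ} (hτ : 0 < τ)
    (hτT : τ < T) (hq : 0 < q)
    (hQ : ∀ i, ∀ t ∈ Ioo (τ / 4) T, ∀ y ∈ closure Ω, ∀ v, ‖v‖ ≤ 1 / 20 →
      ENNReal.ofReal q ≤ Qplus (Φ i) b (f i t y) (f i t y) v) :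
    ∃ A > 0, ∀ i, ∀ t ∈ Ico τ T, ∀ x ∈ closure Ω, ∀ v,
      Real.exp (-(A * (1 + ‖v‖ ^ 2))) ≤ f i t x v := by
  have hT : 0 < T := hτ.trans hτT
  obtain ⟨c, hc, H⟩ := exists_spread hb hγ hcΦ
  obtain ⟨K, hK, HK⟩ := exists_step_constant hc (by positivity : 0 ≤ CL * T) hτ
  set a₀ := q * (τ / 4) * Real.exp (-(CL * (1 + spreadRadius 0) * T)) with ha₀
  have ha₀0 : 0 < a₀ := by positivity
  set A := 2 * K + |Real.log a₀| with hA
  have hA0 : 0 < A := by positivity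
  -- The term `2 K (3/2) ^ n` absorbs the losses:
  -- `2 (2 K (3/2) ^ n) - K (3/2) ^ n = 2 K (3/2) ^ (n + 1)`.
  have key : ∀ n : ℕ, ∀ i, ∀ t ∈ Ioo (τ - τ / 2 ^ (n + 1)) T, ∀ x ∈ closure Ω, ∀ v,
      ‖v‖ < spreadRadius n → Real.exp (-(A * 2 ^ n - 2 * K * (3 / 2) ^ n)) ≤ f i t x v := by
    intro n
    induction n with
    | zero =>
      intro i t ht x hx v hv
      have ht1 : τ / 2 < t := by have := ht.1; norm_num at this; linarith
      have h0 : spreadRadius 0 = 1 / 20 := by norm_num [spreadRadius]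
      have h1 := gainProfile_le_solution hΩ (hF i) hCL hq.le (spreadRadius_pos 0)
        (t₀ := τ / 4) (by positivity) (fun s hs y hy v hv => hQ i s hs y hy v (h0 ▸ hv.le))
        ⟨by linarith, ht.2⟩ hx hv
      refine le_trans ?_ h1
      refine le_trans ?_ (le_gainProfile hq.le (by have := spreadRadius_pos 0; positivity)
        (by positivity) (by positivity : 0 ≤ τ / 4) (by linarith) ht.2.le)
      refine le_trans (Real.exp_le_exp.2 ?_) (exp_neg_abs_log_le ha₀0)
      simp only [hA, pow_zero]
      linarith
    | succ n ih =>
      intro i t ht x hx v hv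
      set a := Real.exp (-(A * 2 ^ n - 2 * K * (3 / 2) ^ n)) with ha
      set s := τ - τ / 2 ^ (n + 1) with hs
      have hs0 : 0 ≤ s := by
        rw [hs, sub_nonneg]
        exact div_le_self hτ.le (one_le_pow₀ (by norm_num))
      have hst : s + τ / 2 ^ (n + 2) ≤ t := by
        have := ht.1
        have e : τ / 2 ^ (n + 1) = 2 * (τ / 2 ^ (n + 2)) := by
          rw [pow_succ 2 (n + 1)]; field_simp
        have e' : τ - τ / 2 ^ (n + 1 + 1) < t := this
        rw [hs, e]
        linarith
      have hp0 := spreadRadius_pos n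
      set q' := c * a ^ 2 * ((1 / 2) ^ n / 4) ^ 7 *
        (spreadRadius n ^ 4 / (1 + spreadRadius n) ^ 4) with hq'
      have hq'0 : 0 ≤ q' := by positivity
      have h2n : (1 / 2 : ℝ) ^ n ≤ 1 := pow_le_one₀ (by norm_num) (by norm_num)
      have hQ' : ∀ s' ∈ Ioo s T, ∀ y ∈ closure Ω, ∀ v, ‖v‖ < spreadRadius (n + 1) →
          ENNReal.ofReal q' ≤ Qplus (Φ i) b (f i s' y) (f i s' y) v := by
        intro s' hs' y hy v hv
        refine H (Φ i) CΦ (hF i).kinetic _ 0 (spreadRadius n) a ((1 / 2) ^ n / 4) hp0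
          (Real.exp_pos _).le (by positivity) (by linarith) ?_ v ?_
        · intro w hw
          rw [sub_zero] at hw
          exact ih i s' hs' y hy w hw
        · rw [sub_zero]
          exact hv.le.trans (spreadRadius_succ_le n)
      have hd : 0 ≤ τ / 2 ^ (n + 2) := by positivity
      have h1 := gainProfile_le_solution hΩ (hF i) hCL hq'0 (spreadRadius_pos (n + 1)) hs0 hQ'
        (t := t) ⟨by linarith, ht.2⟩ hx hv
      refine le_trans ?_ h1
      refine le_trans ?_ (le_gainProfile hq'0 (by have := spreadRadius_pos (n + 1); positivity) hs0
        hd hst ht.2.le)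
      calc Real.exp (-(A * 2 ^ (n + 1) - 2 * K * (3 / 2) ^ (n + 1)))
          = a ^ 2 * Real.exp (-(K * (3 / 2) ^ n)) := by
            rw [ha, ← Real.exp_nat_mul, ← Real.exp_add]
            congr 1
            push_cast
            ring
        _ ≤ a ^ 2 * (c * ((1 / 2) ^ n / 4) ^ 7 * (spreadRadius n ^ 4 / (1 + spreadRadius n) ^ 4) *
              (τ / 2 ^ (n + 2)) * Real.exp (-(CL * T * (1 + spreadRadius (n + 1))))) := by
            gcongr
            exact HK n
        _ = _ := by
            rw [hq', mul_right_comm CL T]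
            ring
  refine ⟨3200 * A, by positivity, fun i t ht x hx v => ?_⟩
  -- Choose `n` so that `‖v‖ < r_n` while `2 ^ n` is at most of the order `1 + ‖v‖ ^ 2`.
  obtain ⟨n, hn1, hn2⟩ := exists_nat_pow_near (x := 1 + 1600 * ‖v‖ ^ 2) (y := 2)
    (by have := sq_nonneg ‖v‖; linarith) one_lt_two
  have hvr : ‖v‖ < spreadRadius (n + 1) := by
    refine lt_of_lt_of_le ?_ (le_spreadRadius (n + 1))
    rw [lt_div_iff₀ (by norm_num)]
    refine lt_of_pow_lt_pow_left₀ 2 (by positivity) ?_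
    rw [← pow_mul, mul_comm (n + 1) 2, pow_mul, Real.sq_sqrt (by norm_num)]
    linarith [mul_pow ‖v‖ 40 2]
  have h1 : τ - τ / 2 ^ (n + 1 + 1) < t := by
    have : 0 < τ / 2 ^ (n + 1 + 1) := by positivity
    linarith [ht.1]
  refine le_trans (Real.exp_le_exp.2 ?_) (key (n + 1) i t ⟨h1, ht.2⟩ x hx v hvr)
  have h2 : A * 2 ^ (n + 1) ≤ A * (3200 * (1 + ‖v‖ ^ 2)) := by
    refine mul_le_mul_of_nonneg_left ?_ hA0.le
    rw [pow_succ]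
    linarith
  have h3 : 0 ≤ 2 * K * (3 / 2) ^ (n + 1) := by positivity
  linarith

end

/-! ### Maxwellian lower bounds: partially diffuse reflection -/

section

variable {Ω : Set R3} {b : ℝ → ℝ} {α TB T γ cΦ CΦ CL : ℝ}

/-- A backward ray either stays in `closure Ω` for the time `h`, or leaves it before. -/
theorem ray_dichotomy (hΩ : IsC2Domain Ω) {x v : R3} {h : ℝ} (hx : x ∈ closure Ω) (hh : 0 ≤ h) :
    (∀ s ∈ Icc 0 h, x - s • v ∈ closure Ω) ∨ ∃ σ, 0 ≤ σ ∧ σ < h ∧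
      (∀ s ∈ Icc 0 σ, x - s • v ∈ closure Ω) ∧ x - σ • v ∈ frontier Ω ∧
      tBoundary Ω (x - σ • v) v = 0 := by
  by_cases hle : ENNReal.ofReal h ≤ tBoundary Ω x v
  · exact Or.inl ((le_tBoundary_iff hx hh).1 hle)
  · push Not at hle
    have hσ : tBoundary Ω x v = ENNReal.ofReal (tBoundary Ω x v).toReal :=
      (ENNReal.ofReal_toReal hle.ne_top).symm
    have h0 : 0 ≤ (tBoundary Ω x v).toReal := ENNReal.toReal_nonneg
    obtain ⟨hy, hty, -⟩ := hΩ.exit_point hx h0 hσ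
    refine Or.inr ⟨_, h0, ?_, (le_tBoundary_iff hx h0).1 hσ.ge, hy, hty⟩
    rw [hσ] at hle
    exact (ENNReal.ofReal_lt_ofReal_iff_of_nonneg h0).1 hle

theorem wallMaxwellian_pos (hTB : 0 < TB) (v : R3) : 0 < wallMaxwellian TB v := by
  unfold wallMaxwellian; positivity

theorem wallMaxwellian_anti (hTB : 0 < TB) {v : R3} {r : ℝ} (hv : ‖v‖ ≤ r) :
    1 / (2 * Real.pi * TB ^ 2) * Real.exp (-r ^ 2 / (2 * TB)) ≤ wallMaxwellian TB v := by
  unfold wallMaxwellian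
  gcongr

/-- The diffuse part of the boundary condition, transported along a ray issued from the boundary. -/
theorem IsControlledSolution.diffuse_lower {Φ : ℝ → ℝ} {f₀ : R3 → R3 → ℝ} {f : ℝ → R3 → R3 → ℝ}
    (hF : IsControlledSolution Ω b α TB T γ cΦ CΦ CL Φ f₀ f) (hCL : 0 < CL) (hα : α < 1)
    (hTB : 0 < TB) {c s t σ : ℝ} {x v : R3} (hc : 0 ≤ c) (hs : 0 ≤ s)
    (hflux : ∀ t ∈ Ioo s T, ∀ y ∈ frontier Ω, ENNReal.ofReal c ≤ outflux Ω y (f t y))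
    (hσ : 0 ≤ σ) (hσt : s < t - σ) (ht : t < T) (hx : x ∈ closure Ω)
    (hray : ∀ r ∈ Icc 0 σ, x - r • v ∈ closure Ω) (hy : x - σ • v ∈ frontier Ω)
    (hty : tBoundary Ω (x - σ • v) v = 0) :
    Real.exp (-(CL * (1 + ‖v‖) * T)) * ((1 - α) * c * wallMaxwellian TB v) ≤ f t x v := by
  have hM := wallMaxwellian_pos hTB v
  have ha : t - σ ∈ Ioo s T := ⟨hσt, by linarith⟩
  have h1 : (1 - α) * c * wallMaxwellian TB v ≤ f (t - σ) (x - σ • v) v := by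
    have h2 := hF.mild.diffuse_le (t := t - σ) ⟨by linarith, ha.2⟩ hy hty
    rw [← ENNReal.ofReal_le_ofReal_iff (hF.mild.nonneg _ ⟨by linarith, ha.2⟩ _
      (frontier_subset_closure hy) v)]
    refine le_trans ?_ h2
    rw [ENNReal.ofReal_mul (mul_nonneg (by linarith) hc), ENNReal.ofReal_mul (by linarith)]
    gcongr
    exact hflux _ ha _ hy
  have h3 := hF.transport hCL (a := t - σ) (t := t) (v := v) (by linarith) (by linarith) ht hx
    (by rwa [sub_sub_cancel])
  rw [sub_sub_cancel, ray, sub_sub_cancel] at h3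
  refine le_trans ?_ h3
  refine mul_le_mul (Real.exp_le_exp.2 ?_) h1
    (mul_nonneg (mul_nonneg (by linarith) hc) hM.le) (Real.exp_pos _).le
  have : σ ≤ T := by linarith
  gcongr

variable {ι : Type*} {Φ : ι → ℝ → ℝ} {f₀ : ι → R3 → R3 → ℝ} {f : ι → ℝ → R3 → R3 → ℝ} {ν b₀ : ℝ}

/-- With diffuse reflection, a lower bound for the gain term at small velocities turns into a lower
bound for the solution: backward rays meet the boundary, where the wall emits a Maxwellian, or stay
inside long enough for the gain term to act. -/
theorem exists_lower_of_gain_diffuse (hΩ : IsC2Domain Ω)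
    (hF : ∀ i, IsControlledSolution Ω b α TB T γ cΦ CΦ CL (Φ i) (f₀ i) (f i)) (hCL : 0 < CL)
    (hT : 0 < T) (hα : α < 1) (hTB : 0 < TB) {c s s' q r : ℝ} (hc : 0 < c) (hs : 0 ≤ s)
    (hss : s < s')
    (hq : 0 < q)
    (hflux : ∀ i, ∀ t ∈ Ioo s T, ∀ y ∈ frontier Ω, ENNReal.ofReal c ≤ outflux Ω y (f i t y))
    (hQ : ∀ i, ∀ t ∈ Ioo s T, ∀ y ∈ closure Ω, ∀ v, ‖v‖ < r →
      ENNReal.ofReal q ≤ Qplus (Φ i) b (f i t y) (f i t y) v) :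
    ∃ a > 0, ∀ i, ∀ t ∈ Ioo s' T, ∀ x ∈ closure Ω, ∀ v, ‖v‖ < r → a ≤ f i t x v := by
  set E := Real.exp (-(CL * (1 + r) * T)) with hE
  set m := 1 / (2 * Real.pi * TB ^ 2) * Real.exp (-r ^ 2 / (2 * TB)) with hm
  have hm0 : 0 < m := by positivity
  have hα' : 0 < 1 - α := by linarith
  set h := s' - s with hh
  have hh0 : 0 < h := by linarith
  refine ⟨E * min (q * h) ((1 - α) * c * m), mul_pos (Real.exp_pos _)
    (lt_min (by positivity) (by positivity)), fun i t ht x hx v hv => ?_⟩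
  have hEv : ∀ d ≤ T, E ≤ Real.exp (-(CL * (1 + ‖v‖) * d)) := by
    intro d hd
    rw [hE]
    refine Real.exp_le_exp.2 (neg_le_neg ?_)
    calc CL * (1 + ‖v‖) * d ≤ CL * (1 + ‖v‖) * T := by gcongr
      _ ≤ CL * (1 + r) * T := by gcongr
  rcases ray_dichotomy (v := v) hΩ hx hh0.le with hray | ⟨σ, h0, hσ, hray, hy, hty⟩
  · have h1 := (hF i).lower hCL (a := t - h) (t := t) (x := x) (v := v) (by linarith [ht.1])
      (by linarith) ht.2 hx (by rwa [sub_sub_cancel]) hq.le (fun r hr => hQ i r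
        ⟨by linarith [ht.1, hr.1], by linarith [ht.2, hr.2]⟩ _ (hray (t - r)
        ⟨by linarith [hr.2], by linarith [hr.1]⟩) v hv)
    refine le_trans ?_ h1
    rw [sub_sub_cancel]
    refine mul_le_mul (hEv h (by linarith [ht.1, ht.2])) ((min_le_left _ _).trans ?_)
      (le_min (by positivity) (by positivity)) (Real.exp_pos _).le
    refine le_add_of_nonneg_left ((hF i).mild.nonneg _ ⟨by linarith [ht.1], by linarith [ht.2]⟩ _
      ?_ v)
    rw [ray, sub_sub_cancel]
    exact hray h ⟨hh0.le, le_rfl⟩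
  · refine le_trans ?_ ((hF i).diffuse_lower hCL hα hTB hc.le hs (hflux i) h0
      (by linarith [ht.1]) ht.2 hx hray hy hty)
    refine mul_le_mul (hEv T le_rfl) ((min_le_right _ _).trans ?_)
      (le_min (by positivity) (by positivity)) (Real.exp_pos _).le
    have := wallMaxwellian_anti hTB hv.le
    gcongr

/-- For velocities in a fixed ball, finitely many collision steps suffice. Faster particles have
crossed the domain within the time `τ / 4`, so they come from the wall, which emits a Maxwellian. -/
theorem exists_maxwellian_diffuse (hΩ : IsC2Domain Ω)
    (hF : ∀ i, IsControlledSolution Ω b α TB T γ cΦ CΦ CL (Φ i) (f₀ i) (f i)) (hCL : 0 < CL)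
    (hα : α < 1) (hTB : 0 < TB) (hb : IsAngularFactor b ν b₀) (hγ : γ ∈ Ioc (-3 : ℝ) 1)
    (hcΦ : 0 < cΦ) {τ q c : ℝ} (hτ : 0 < τ) (hτT : τ < T) (hq : 0 < q) (hc : 0 < c)
    (hflux : ∀ i, ∀ t ∈ Ioo (τ / 4) T, ∀ y ∈ frontier Ω, ENNReal.ofReal c ≤ outflux Ω y (f i t y))
    (hQ : ∀ i, ∀ t ∈ Ioo (τ / 4) T, ∀ y ∈ closure Ω, ∀ v, ‖v‖ ≤ 1 / 20 →
      ENNReal.ofReal q ≤ Qplus (Φ i) b (f i t y) (f i t y) v) :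
    ∃ A > 0, ∀ i, ∀ t ∈ Ico τ T, ∀ x ∈ closure Ω, ∀ v,
      Real.exp (-(A * (1 + ‖v‖ ^ 2))) ≤ f i t x v := by
  have hT : 0 < T := hτ.trans hτT
  obtain ⟨k, hk, H⟩ := exists_spread hb hγ hcΦ
  have hsq : (139 / 100 : ℝ) ≤ √2 := Real.le_sqrt_of_sq_le (by norm_num)
  have key : ∀ n : ℕ, ∀ s > τ / 4, ∃ a > 0, ∀ i, ∀ t ∈ Ioo s T, ∀ x ∈ closure Ω, ∀ v,
      ‖v‖ < (5 / 4) ^ n * (1 / 20) → a ≤ f i t x v := by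
    intro n
    induction n with
    | zero =>
      intro s hs
      exact exists_lower_of_gain_diffuse hΩ hF hCL hT hα hTB hc (by positivity) hs hq hflux
        fun i t ht y hy v hv => hQ i t ht y hy v (by linarith)
    | succ n ih =>
      intro s hs
      obtain ⟨a, ha, Ha⟩ := ih ((τ / 4 + s) / 2) (by linarith)
      set r : ℝ := (5 / 4) ^ n * (1 / 20) with hr
      have hr0 : 0 < r := by positivity
      refine exists_lower_of_gain_diffuse hΩ hF hCL hT hα hTB hc (s := (τ / 4 + s) / 2)
        (q := k * a ^ 2 * (1 / 10) ^ 7 * (r ^ 4 / (1 + r) ^ 4)) (by linarith)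
        (by linarith) (by positivity)
        (fun i t ht y hy => hflux i t ⟨by linarith [ht.1], ht.2⟩ y hy) fun i t ht y hy v hv => ?_
      refine H (Φ i) CΦ (hF i).kinetic _ 0 r a (1 / 10) hr0 ha.le (by norm_num) (by norm_num) ?_
          v ?_
      · intro w hw
        rw [sub_zero] at hw
        exact Ha i t ht y hy w hw
      · rw [sub_zero]
        have hv' : ‖v‖ < 5 / 4 * r := by rw [hr]; rw [pow_succ] at hv; linarith
        nlinarith [mul_le_mul_of_nonneg_right hsq hr0.le]
  obtain ⟨D, hD0, hD⟩ := hΩ.isBounded.closure.exists_pos_norm_le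
  -- Faster particles cross the whole domain during a time less than `τ / 4`.
  set R := 8 * D / τ + 1 with hR
  obtain ⟨n, hn⟩ := pow_unbounded_of_one_lt (R * 20) (by norm_num : (1 : ℝ) < 5 / 4)
  obtain ⟨a, ha, Ha⟩ := key n (τ / 2) (by linarith)
  set m := (1 - α) * c * (1 / (2 * Real.pi * TB ^ 2)) with hm
  have hα' : 0 < 1 - α := by linarith
  have hm0 : 0 < m := by positivity
  refine ⟨|Real.log a| + |Real.log m| + 1 / (2 * TB) + 2 * (CL * T), by positivity,
    fun i t ht x hx v => ?_⟩
  have hv1 : 1 ≤ 1 + ‖v‖ ^ 2 := by have := sq_nonneg ‖v‖; linarith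
  have hla : |Real.log a| ≤ |Real.log a| * (1 + ‖v‖ ^ 2) :=
    le_mul_of_one_le_right (abs_nonneg _) hv1
  have hlm : |Real.log m| ≤ |Real.log m| * (1 + ‖v‖ ^ 2) :=
    le_mul_of_one_le_right (abs_nonneg _) hv1
  have hTBpos : 0 ≤ 1 / (2 * TB) := by positivity
  have hCT : 0 ≤ CL * T := by positivity
  rcases le_or_gt ‖v‖ R with hvR | hvR
  · refine le_trans (le_trans (Real.exp_le_exp.2 ?_) (exp_neg_abs_log_le ha))
      (Ha i t ⟨by linarith [ht.1], ht.2⟩ x hx v (by linarith))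
    have h1 : 0 ≤ 1 / (2 * TB) * (1 + ‖v‖ ^ 2) := by positivity
    have h2 : 0 ≤ CL * T * (1 + ‖v‖ ^ 2) := by positivity
    linarith [abs_nonneg (Real.log m)]
  · rcases ray_dichotomy (v := v) (h := τ / 4) hΩ hx (by positivity) with
      hray | ⟨σ, h0, hσ, hray, hy, hty⟩
    · exfalso
      have h1 := hD _ (hray (τ / 4) ⟨by positivity, le_rfl⟩)
      have h2 := hD _ hx
      have h3 : τ / 4 * ‖v‖ ≤ 2 * D := by
        calc τ / 4 * ‖v‖ = ‖(τ / 4) • v‖ := by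
              rw [norm_smul, Real.norm_of_nonneg (by positivity)]
          _ = ‖x - (x - (τ / 4) • v)‖ := by rw [sub_sub_cancel]
          _ ≤ 2 * D := (norm_sub_le _ _).trans (by linarith)
      have h4 : 8 * D / τ < ‖v‖ := by linarith
      rw [div_lt_iff₀ hτ] at h4
      linarith
    · refine le_trans ?_ ((hF i).diffuse_lower hCL hα hTB hc.le (by positivity) (hflux i) h0
        (by linarith [ht.1]) ht.2 hx hray hy hty)
      have e : (1 - α) * c * wallMaxwellian TB v = m * Real.exp (-‖v‖ ^ 2 / (2 * TB)) := by
        rw [wallMaxwellian, hm]; ring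
      rw [e]
      calc Real.exp (-((|Real.log a| + |Real.log m| + 1 / (2 * TB) + 2 * (CL * T)) *
            (1 + ‖v‖ ^ 2)))
          ≤ Real.exp (-(CL * (1 + ‖v‖) * T) + (-|Real.log m| + -‖v‖ ^ 2 / (2 * TB))) := by
            refine Real.exp_le_exp.2 ?_
            have h1 : CL * T * (1 + ‖v‖) ≤ CL * T * (2 * (1 + ‖v‖ ^ 2)) :=
              mul_le_mul_of_nonneg_left (by nlinarith [sq_nonneg (‖v‖ - 1)]) hCT
            have h2 : -‖v‖ ^ 2 / (2 * TB) = -(1 / (2 * TB) * ‖v‖ ^ 2) := by ring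
            have h3 := abs_nonneg (Real.log a)
            rw [h2]
            linarith
        _ = Real.exp (-(CL * (1 + ‖v‖) * T)) * (Real.exp (-|Real.log m|) *
              Real.exp (-‖v‖ ^ 2 / (2 * TB))) := by rw [Real.exp_add, Real.exp_add]
        _ ≤ _ := by
            gcongr
            exact exp_neg_abs_log_le hm0

/-- The Maxwellian lower bound for a family of solutions whose initial data are bounded below on a
fixed product of balls. -/
theorem exists_maxwellian_of_bump (hΩ : IsC2Domain Ω) (hα : α ≤ 1) (hTB : 0 < TB)
    (hF : ∀ i, IsControlledSolution Ω b α TB T γ cΦ CΦ CL (Φ i) (f₀ i) (f i)) (hCL : 0 < CL)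
    (hb : IsAngularFactor b ν b₀) (hγ : γ ∈ Ioc (-3 : ℝ) 1) (hcΦ : 0 < cΦ) {τ : ℝ} (hτ : 0 < τ)
    (hτT : τ < T) {x₁ v₁ : R3} {δ κ : ℝ} (hx₁ : x₁ ∈ Ω) (hδ : 0 < δ) (hκ : 0 < κ)
    (h : ∀ i, ∀ x ∈ closure Ω, ‖x - x₁‖ < δ → ∀ v, ‖v - v₁‖ < δ → κ ≤ f i 0 x v) :
    ∃ A > 0, ∀ i, ∀ t ∈ Ico τ T, ∀ x ∈ closure Ω, ∀ v,
      Real.exp (-(A * (1 + ‖v‖ ^ 2))) ≤ f i t x v := by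
  have hT : 0 < T := hτ.trans hτT
  obtain ⟨d, hd, hsub⟩ := Metric.isOpen_iff.1 hΩ.isOpen x₁ hx₁
  have hpos : IsPositiveNear T f x₁ := by
    refine isPositiveNear_of_initial hF hCL hT hb hγ hcΦ (v₁ := v₁) (lt_min hδ hd) hκ
      (((Metric.ball_subset_ball (min_le_right _ _)).trans hsub).trans subset_closure) ?_
    intro i x hx v hv
    refine h i x (subset_closure (hsub (Metric.ball_subset_ball (min_le_right _ _) hx))) ?_ v
      (hv.trans_le (min_le_left _ _))
    rw [← dist_eq_norm]
    exact hx.trans_le (min_le_left _ _)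
  obtain ⟨q, hq, c, hc, H⟩ := exists_gain_flux_lower hΩ hF hCL hb hγ hcΦ
    (hpos.forall_mem hΩ hF hCL hT hb hγ hcΦ hx₁) (by positivity : 0 < τ / 4)
  rcases hα.eq_or_lt with rfl | hα1
  · exact exists_maxwellian_specular hΩ hF hCL hb hγ hcΦ hτ hτT hq
      fun i t ht y hy => (H i t ht y hy).1
  · exact exists_maxwellian_diffuse hΩ hF hCL hα1 hTB hb hγ hcΦ hτ hτT hq hc
      (fun i t ht y hy => (H i t ht y (frontier_subset_closure hy)).2 hy)
      fun i t ht y hy => (H i t ht y hy).1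

end

/-! ### Uniformity over the initial data -/

section

/-- The Maxwellian lower bound, in the form `exp (-A (1 + ‖v‖²))`, with a constant that depends only
on the given bounds. -/
theorem exists_maxwellian (Ω : Set R3) (hΩ : IsC2Domain Ω)
    (γ cΦ CΦ : ℝ) (hγ : γ ∈ Ioc (-3 : ℝ) 1) (hcΦ : 0 < cΦ) (hCΦ : 0 < CΦ)
    (b : ℝ → ℝ) (ν b₀ : ℝ) (hν : ν < 0) (hb : IsAngularFactor b ν b₀)
    (α : ℝ) (hα : α ≤ 1) (TB : ℝ) (hTB : 0 < TB) (T τ : ℝ) (hτ : τ ∈ Ioo 0 T)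
    (M E Λ p : ℝ) (hM : 0 < M) (hp : γ < 0 → 3 / (3 + γ) < p)
    (ω : ℝ → ℝ) (hω : Tendsto ω (𝓝[≥] 0) (𝓝 0)) :
    ∃ A > 0, ∀ (Φ : ℝ → ℝ) (f₀ : R3 → R3 → ℝ) (f : ℝ → R3 → R3 → ℝ),
      IsKineticFactor Φ γ cΦ CΦ → IsContinuousMildSolution Ω Φ b α TB T f₀ f →
      HasModulus Ω ω f₀ → totalMass Ω (f 0) = ENNReal.ofReal M →
      energyBound Ω T f ≤ ENNReal.ofReal E →
      (γ < 0 → lpBound Ω T p f ≤ ENNReal.ofReal Λ) →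
      ∀ t ∈ Ico τ T, ∀ x ∈ closure Ω, ∀ v, Real.exp (-(A * (1 + ‖v‖ ^ 2))) ≤ f t x v := by
  have hT : 0 < T := hτ.1.trans hτ.2
  obtain ⟨CL, hCL, HL⟩ := exists_loss_bound hΩ hγ hcΦ hCΦ hν hb E Λ p hp α TB T
  obtain ⟨κ, hκ, δ, hδ, K, hK, hKsub, R, hR, Hbump⟩ := exists_initial_bump hΩ hM E hω
  -- Solutions are classified by the position of a bump of their initial datum, which ranges over a
  -- compact set.
  have hcomp : IsCompact (K ×ˢ Metric.closedBall (0 : R3) R) := hK.prod (isCompact_closedBall _ _)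
  have hmain : ∃ A > 0, ∀ (Φ : ℝ → ℝ) (f₀ : R3 → R3 → ℝ) (f : ℝ → R3 → R3 → ℝ),
      IsControlledSolution Ω b α TB T γ cΦ CΦ CL Φ f₀ f →
      (∃ z ∈ K ×ˢ Metric.closedBall (0 : R3) R, ∀ x ∈ closure Ω, ‖x - z.1‖ < δ → ∀ v,
        ‖v - z.2‖ < δ → κ ≤ f 0 x v) →
      ∀ t ∈ Ico τ T, ∀ x ∈ closure Ω, ∀ v, Real.exp (-(A * (1 + ‖v‖ ^ 2))) ≤ f t x v := by
    refine hcomp.induction_on (p := fun S => ∃ A > 0, ∀ (Φ : ℝ → ℝ) (f₀ : R3 → R3 → ℝ)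
      (f : ℝ → R3 → R3 → ℝ), IsControlledSolution Ω b α TB T γ cΦ CΦ CL Φ f₀ f →
      (∃ z ∈ S, ∀ x ∈ closure Ω, ‖x - z.1‖ < δ → ∀ v, ‖v - z.2‖ < δ → κ ≤ f 0 x v) →
      ∀ t ∈ Ico τ T, ∀ x ∈ closure Ω, ∀ v, Real.exp (-(A * (1 + ‖v‖ ^ 2))) ≤ f t x v)
      ⟨1, one_pos, by simp⟩ ?_ ?_ ?_
    · rintro S S' hSS ⟨A, hA, H⟩
      exact ⟨A, hA, fun Φ f₀ f hf ⟨z, hz, hz'⟩ => H Φ f₀ f hf ⟨z, hSS hz, hz'⟩⟩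
    · rintro S S' ⟨A, hA, H⟩ ⟨A', hA', H'⟩
      refine ⟨max A A', lt_max_of_lt_left hA, ?_⟩
      rintro Φ f₀ f hf ⟨z, hz | hz, hz'⟩ t ht x hx v
      · refine le_trans (Real.exp_le_exp.2 (neg_le_neg ?_)) (H Φ f₀ f hf ⟨z, hz, hz'⟩ t ht x hx v)
        exact mul_le_mul_of_nonneg_right (le_max_left _ _) (by positivity)
      · refine le_trans (Real.exp_le_exp.2 (neg_le_neg ?_)) (H' Φ f₀ f hf ⟨z, hz, hz'⟩ t ht x hx v)
        exact mul_le_mul_of_nonneg_right (le_max_right _ _) (by positivity)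
    · rintro ⟨x₁, v₁⟩ ⟨hx₁, -⟩
      set ι := {F : (ℝ → ℝ) × (R3 → R3 → ℝ) × (ℝ → R3 → R3 → ℝ) //
        IsControlledSolution Ω b α TB T γ cΦ CΦ CL F.1 F.2.1 F.2.2 ∧
        ∀ x ∈ closure Ω, ‖x - x₁‖ < δ / 2 → ∀ v, ‖v - v₁‖ < δ / 2 → κ ≤ F.2.2 0 x v}
      obtain ⟨A, hA, H⟩ := exists_maxwellian_of_bump (ι := ι) (Φ := fun i => i.1.1)
        (f₀ := fun i => i.1.2.1) (f := fun i => i.1.2.2) hΩ hα hTB (fun i => i.2.1) hCL hb hγ hcΦ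
        hτ.1 hτ.2 (hKsub hx₁) (half_pos hδ) hκ (fun i => i.2.2)
      refine ⟨_, mem_nhdsWithin_of_mem_nhds (Metric.ball_mem_nhds (x₁, v₁) (half_pos hδ)), A,
          hA, ?_⟩
      rintro Φ f₀ f hf ⟨⟨x₂, v₂⟩, hz, hz'⟩
      rw [Metric.mem_ball, Prod.dist_eq, max_lt_iff, dist_eq_norm, dist_eq_norm] at hz
      refine H ⟨(Φ, f₀, f), hf, fun x hx hxx v hvv => hz' x hx ?_ v ?_⟩
      · have := norm_sub_le_norm_sub_add_norm_sub x x₁ x₂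
        rw [norm_sub_rev x₁ x₂] at this
        exact this.trans_lt (by linarith [hz.1])
      · have := norm_sub_le_norm_sub_add_norm_sub v v₁ v₂
        rw [norm_sub_rev v₁ v₂] at this
        exact this.trans_lt (by linarith [hz.2])
  obtain ⟨A, hA, H⟩ := hmain
  refine ⟨A, hA, fun Φ f₀ f hΦ hf hmod hmass hE hΛ => H Φ f₀ f
    ⟨hΦ, hf, HL Φ f₀ f hΦ hf hE hΛ⟩ ?_⟩
  have h0 : ∀ x ∈ closure Ω, ∀ v, f 0 x v = f₀ x v := fun x hx v => hf.eq_init hT hx v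
  have hmass' : totalMass Ω f₀ = ENNReal.ofReal M := by
    rw [← hmass]
    refine setLIntegral_congr_fun (hΩ.isOpen.measurableSet.prod MeasurableSet.univ) fun z hz => ?_
    rw [h0 z.1 (subset_closure hz.1)]
  obtain ⟨x₁, hx₁, v₁, hv₁, hbump⟩ := Hbump f₀ hf.init_nonneg hf.init_continuous hmod hmass'
    fun x hx => by
      simp only [← h0 x (subset_closure hx)]
      refine le_trans ?_ hE
      exact le_trans (le_iSup₂_of_le (f := fun (y : R3) (_ : y ∈ Ω) =>
        ((∫⁻ v, ENNReal.ofReal (‖v‖ ^ 2 * f 0 y v)) + ∫⁻ v, ENNReal.ofReal (f 0 y v ^ 2))) x hx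
            le_rfl)
        (le_iSup₂_of_le (f := fun (t : ℝ) (_ : t ∈ Ico 0 T) => ⨆ y ∈ Ω,
        ((∫⁻ v, ENNReal.ofReal (‖v‖ ^ 2 * f t y v)) + ∫⁻ v, ENNReal.ofReal (f t y v ^ 2))) 0
        ⟨le_rfl, hT⟩ le_rfl)
  refine ⟨(x₁, v₁), ⟨hx₁, by simpa using hv₁.le⟩, fun x hx hxx v hvv => ?_⟩
  rw [h0 x hx]
  exact hbump x hx hxx v hvv

end

end Boltzmann

end

theorem theorem1p2
    (Ω : Set Boltzmann.R3) (hΩ : Boltzmann.IsC2Domain Ω)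
    (γ cΦ CΦ : ℝ) (hγ : γ ∈ Ioc (-3 : ℝ) 1) (hcΦ : 0 < cΦ) (hCΦ : 0 < CΦ)
    (b : ℝ → ℝ) (ν b₀ : ℝ) (hν : ν < 0) (hb₀ : 0 < b₀) (hb : Boltzmann.IsAngularFactor b ν b₀)
    (α : ℝ) (hα : α ∈ Icc (0 : ℝ) 1) (TB : ℝ) (hTB : 0 < TB)
    (T : ℝ) (hT : 0 < T) (τ : ℝ) (hτ : τ ∈ Ioo 0 T)
    (M E Λ p : ℝ) (hM : 0 < M) (hp : γ < 0 → 3 / (3 + γ) < p)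
    (ω : ℝ → ℝ) (hω : Tendsto ω (𝓝[≥] 0) (𝓝 0)) :
    ∃ ρ > 0, ∃ θ > 0, ∀ (Φ : ℝ → ℝ) (f₀ : Boltzmann.R3 → Boltzmann.R3 → ℝ)
      (f : ℝ → Boltzmann.R3 → Boltzmann.R3 → ℝ),
      Boltzmann.IsKineticFactor Φ γ cΦ CΦ →
      Boltzmann.IsContinuousMildSolution Ω Φ b α TB T f₀ f →
      Boltzmann.HasModulus Ω ω f₀ →
      Boltzmann.totalMass Ω (f 0) = ENNReal.ofReal M →
      Boltzmann.energyBound Ω T f ≤ ENNReal.ofReal E →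
      (γ < 0 → Boltzmann.lpBound Ω T p f ≤ ENNReal.ofReal Λ) →
      ∀ t ∈ Ico τ T, ∀ x ∈ closure Ω, ∀ v : Boltzmann.R3,
        ρ / (2 * Real.pi * θ) ^ (3 / 2 : ℝ) * Real.exp (-‖v‖ ^ 2 / (2 * θ)) ≤ f t x v := by
  obtain ⟨A, hA, H⟩ := Boltzmann.exists_maxwellian Ω hΩ γ cΦ CΦ hγ hcΦ hCΦ b ν b₀ hν hb α hα.2 TB
      hTB
    T τ hτ M E Λ p hM hp ω hω
  refine ⟨(2 * Real.pi * (1 / (2 * A))) ^ (3 / 2 : ℝ) * Real.exp (-A), by positivity,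
    1 / (2 * A), by positivity, fun Φ f₀ f hΦ hf hmod hmass hE hΛ t ht x hx v => ?_⟩
  refine le_trans (le_of_eq ?_) (H Φ f₀ f hΦ hf hmod hmass hE hΛ t ht x hx v)
  have hpos : (0 : ℝ) < (2 * Real.pi * (1 / (2 * A))) ^ (3 / 2 : ℝ) := by positivity
  rw [mul_div_cancel_left₀ _ hpos.ne', ← Real.exp_add]
  congr 1
  field_simp
  ring
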